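/- Let $\mathbb T^3=[0,2\pi]^3$ be the three-dimensional torus, $H$ the space of mean-zero divergence-free periodic fields in $L^2(\mathbb T^3;\mathbb R^3)$, $\mathcal P$ the orthogonal projection of $L^2(\mathbb T^3;\mathbb R^3)$ onto $H$, $A=-\mathcal P\Delta$ the Stokes operator, $B(u,v)=\mathcal P\,(u\cdot\nabla)v$, and $V_\alpha=D(A^{\alpha/2})$ with norm $|u|_{V_\alpha}=|A^{\alpha/2}u|_H$. For $k\in\mathbb Z^3\setminus\{0\}$ let $e_k(\xi)=\cos(k\cdot\xi)$ if the first non-zero coordinate of $k$ is positive and $e_k(\xi)=\sin(k\cdot\xi)$ otherwise, and let $\pi_N$ be the orthogonal projection of $H$ onto the span of the fields $y\,e_k$ with $y\in k^\perp\subset\mathbb R^3$ and $0<\max_i|k_i|\le N$. Let $\alpha_0>\tfrac12$, let $N_0\ge 1$ be an integer, and let $Q:H\to H$ be a bounded linear operator such that 1. for every $k\in\mathbb Z^3\setminus\{0\}$ there is a linear map $q_k:k^\perp\to k^\perp$ with $Q(y\,e_k)=(q_k y)\,e_k$ for all $y\in k^\perp$; 2. $\pi_{N_0}Q=0$, and $Q$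 is injective on $(\mathrm{Id}-\pi_{N_0})H$; 3. $A^{\alpha_0+3/4}Q$ is a bounded operator with bounded inverse on $(\mathrm{Id}-\pi_{N_0})H$. Put $\mathcal W=V_{2\alpha_0+1/2}$. Then there is a function $\rho_0$ of three real variables (depending on $\alpha_0$, $N_0$ and $Q$ only) such that for all $T>0$, all $x,y\in\mathcal W$ and all $\varepsilon>0$ there are $w\in L^2([0,T];H)$ and $u\in C([0,T];\mathcal W)$ with $u(0)=x$, $|u(T)-y|_{\mathcal W}\le\varepsilon$, $\sup_{t\in[0,T]}|u(t)|_{\mathcal W}\le\rho_0(|x|_{\mathcal W},|y|_{\mathcal W},T)$, and $$\partial_t u+Au+B(u,u)=Qw\qquad\text{on }[0,T]$$ in the weak sense, that is, for every $\varphi=y'\,e_k$ with $k\in\mathbb Z^3\setminus\{0\}$, $y'\in k^\perp$, and every $t\in[0,T]$, $$\langle u(t)-u(0),\varphi\rangle_H+\int_0^t\langle u(s),A\varphi\rangle_H\,ds-\int_0^t\langle (u(s)\cdot\nabla)\varphi,u(s)\rangle_{L^2}\,ds=\int_0^t\langle Qw(s),\varphi\rangle_H\,ds .$$ -/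

import Mathlib

open MeasureTheory Set Filter Topology

noncomputable section

namespace NSControl

/-! ### The torus and its square-integrable vector fields -/

/-- Points of the periodic cell `[0,2π]³` (in coordinates). -/
abbrev X : Type := Fin 3 → ℝ

/-- Values of vector fields, with the Euclidean norm. -/
abbrev E3 : Type := EuclideanSpace ℝ (Fin 3)

/-- The cell `[0,2π]³`. -/
def cell : Set X := Icc 0 (fun _ => 2 * Real.pi)

/-- Lebesgue measure on the cell, normalized so that the functions `cos (k·ξ)`, `sin (k·ξ)`,
`k ≠ 0`, have norm one in `L²`. -/
def torusMeasure : Measure X :=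
  ENNReal.ofReal (2 / (2 * Real.pi) ^ 3) • volume.restrict cell

/-- `L²(𝕋³; ℝ³)`. -/
abbrev L2 : Type := Lp E3 2 torusMeasure

/-- `2π`-periodicity in each coordinate. -/
def IsPeriodic {F : Type*} (f : X → F) : Prop :=
  ∀ (ξ : X) (i : Fin 3), f (ξ + Pi.single i (2 * Real.pi)) = f ξ

/-- The gradient of a scalar function. -/
def grad (φ : X → ℝ) (ξ : X) : E3 :=
  WithLp.toLp 2 (fun i => fderiv ℝ φ ξ (Pi.single i 1))

theorem isCompact_cell : IsCompact cell := isCompact_Icc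

instance : IsFiniteMeasure torusMeasure := by
  have : IsFiniteMeasure ((volume : Measure X).restrict cell) :=
    ⟨by simpa using isCompact_cell.measure_lt_top⟩
  unfold torusMeasure
  exact Measure.smul_finite _ ENNReal.ofReal_ne_top

theorem memLp_of_continuous {f : X → E3} (hf : Continuous f) : MemLp f 2 torusMeasure := by
  obtain ⟨C, hC⟩ := isCompact_cell.exists_bound_of_continuousOn hf.continuousOn
  refine MemLp.of_bound hf.aestronglyMeasurable C ?_
  unfold torusMeasure
  refine Measure.ae_smul_measure ?_ _
  exact (ae_restrict_iff' measurableSet_Icc).2 (Eventually.of_forall hC)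

theorem continuous_grad {φ : X → ℝ} (hφ : ContDiff ℝ (⊤ : ℕ∞) φ) : Continuous (grad φ) := by
  have h : Continuous (fderiv ℝ φ) := hφ.continuous_fderiv (by simp)
  unfold grad
  refine (PiLp.continuous_toLp 2 _).comp (continuous_pi fun i => ?_)
  exact h.clm_apply continuous_const

theorem integrable_inner_grad {φ : X → ℝ} (hφ : ContDiff ℝ (⊤ : ℕ∞) φ) (u : L2) :
    Integrable (fun ξ => inner ℝ (grad φ ξ) (u ξ)) torusMeasure := by
  have h := MemLp.integrable_mul ((memLp_of_continuous (continuous_grad hφ)).norm) (Lp.memLp u).norm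
  refine h.mono ((continuous_grad hφ).aestronglyMeasurable.inner (Lp.aestronglyMeasurable u)) ?_
  refine Eventually.of_forall fun ξ => ?_
  simpa using norm_inner_le_norm (𝕜 := ℝ) (grad φ ξ) (u ξ)

theorem integrable_L2 (u : L2) : Integrable (fun ξ => u ξ) torusMeasure :=
  (Lp.memLp u).integrable (by norm_num)

/-- The space `H` of mean-zero, (weakly) divergence-free square-integrable periodic fields. -/
def H : Submodule ℝ L2 where
  carrier := {u | ∫ ξ, u ξ ∂torusMeasure = 0 ∧
    ∀ φ : X → ℝ, ContDiff ℝ (⊤ : ℕ∞) φ → IsPeriodic φ →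
      ∫ ξ, inner ℝ (grad φ ξ) (u ξ) ∂torusMeasure = 0}
  zero_mem' := by
    have h0 := Lp.coeFn_zero E3 2 torusMeasure
    refine ⟨?_, fun φ _ _ => ?_⟩
    · rw [integral_eq_zero_of_ae h0]
    · refine integral_eq_zero_of_ae ?_
      filter_upwards [h0] with ξ hξ
      exact (congrArg (inner ℝ (grad φ ξ)) hξ).trans (inner_zero_right _)
  add_mem' := by
    rintro u v ⟨hu, hu'⟩ ⟨hv, hv'⟩
    have ha := Lp.coeFn_add u v
    refine ⟨?_, fun φ hφ hp => ?_⟩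
    · rw [integral_congr_ae ha]
      simp only [Pi.add_apply]
      rw [integral_add (integrable_L2 u) (integrable_L2 v), hu, hv, add_zero]
    · have : (fun ξ => inner ℝ (grad φ ξ) ((u + v : L2) ξ)) =ᵐ[torusMeasure]
          fun ξ => inner ℝ (grad φ ξ) (u ξ) + inner ℝ (grad φ ξ) (v ξ) := by
        filter_upwards [ha] with ξ hξ
        rw [hξ, Pi.add_apply, inner_add_right]
      rw [integral_congr_ae this,
        integral_add (integrable_inner_grad hφ u) (integrable_inner_grad hφ v),
        hu' φ hφ hp, hv' φ hφ hp, add_zero]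
  smul_mem' := by
    rintro c u ⟨hu, hu'⟩
    have ha := Lp.coeFn_smul c u
    refine ⟨?_, fun φ hφ hp => ?_⟩
    · rw [integral_congr_ae ha]
      simp only [Pi.smul_apply]
      rw [integral_smul, hu, smul_zero]
    · have : (fun ξ => inner ℝ (grad φ ξ) ((c • u : L2) ξ)) =ᵐ[torusMeasure]
          fun ξ => c * inner ℝ (grad φ ξ) (u ξ) := by
        filter_upwards [ha] with ξ hξ
        rw [hξ, Pi.smul_apply, inner_smul_right]
      rw [integral_congr_ae this, integral_const_mul, hu' φ hφ hp, mul_zero]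

/-! ### The Fourier basis -/

/-- `ℤ³ ∖ {0}`. -/
abbrev ZStar : Type := {k : Fin 3 → ℤ // k ≠ 0}

/-- The half `ℤ³₊` of the frequencies. -/
def IsPos (k : Fin 3 → ℤ) : Prop :=
  0 < k 0 ∨ (k 0 = 0 ∧ 0 < k 1) ∨ (k 0 = 0 ∧ k 1 = 0 ∧ 0 < k 2)

/-- The frequency `k` as a Euclidean vector; `‖kvec k‖ = |k|`. -/
def kvec (k : ZStar) : E3 := WithLp.toLp 2 (fun i => (k.1 i : ℝ))

/-- The plane `k^⊥`. -/
def kperp (k : ZStar) : Submodule ℝ E3 := (Submodule.span ℝ {kvec k})ᗮ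

/-- The phase `k·ξ`. -/
def phase (k : ZStar) (ξ : X) : ℝ := ∑ i, (k.1 i : ℝ) * ξ i

open Classical in
/-- `e_k = cos (k·ξ)` for `k ∈ ℤ³₊` and `e_k = sin (k·ξ)` for `k ∈ ℤ³₋ = -ℤ³₊`. -/
def e (k : ZStar) (ξ : X) : ℝ :=
  if IsPos k.1 then Real.cos (phase k ξ) else Real.sin (phase k ξ)

/-- The smooth vector field `y e_k`. -/
def modeField (k : ZStar) (y : E3) (ξ : X) : E3 := e k ξ • y

theorem integral_torus (f : X → ℝ) (hf : ∫ ξ in cell, f ξ = 0) :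
    ∫ ξ, f ξ ∂torusMeasure = 0 := by
  unfold torusMeasure
  rw [integral_smul_measure, hf, smul_zero]

theorem integral_deriv_periodic {g : X → ℝ} (hg : ContDiff ℝ 1 g) (hp : IsPeriodic g) (a : X) :
    ∫ ξ, fderiv ℝ g ξ a ∂torusMeasure = 0 := by
  refine integral_torus _ ?_
  have hcont : Continuous (fderiv ℝ g) := hg.continuous_fderiv (by simp)
  have hpt : ∀ ξ, fderiv ℝ g ξ a = ∑ i, (a i • fderiv ℝ g ξ) (Pi.single i 1) := by
    intro ξ
    conv_lhs => rw [pi_eq_sum_univ' a]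
    simp [map_sum, map_smul]
  simp_rw [hpt]
  have hle : (0 : X) ≤ fun _ => 2 * Real.pi := fun _ => by simp [Real.pi_pos.le]
  unfold cell
  rw [integral_divergence_of_hasFDerivAt_off_countable' (0 : X) (fun _ => 2 * Real.pi) hle
    (fun i ξ => a i • g ξ) (fun i ξ => a i • fderiv ℝ g ξ) ∅ countable_empty
    (fun i => (hg.continuous.const_smul (a i)).continuousOn)
    (fun ξ _ i => ((hg.differentiable (by simp)) ξ).hasFDerivAt.const_smul (a i))]
  · refine Finset.sum_eq_zero fun i _ => sub_eq_zero.2 ?_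
    refine integral_congr_ae (Eventually.of_forall fun x => ?_)
    have : (i.insertNth (2 * Real.pi) x : X)
        = i.insertNth (0 : ℝ) x + Pi.single i (2 * Real.pi) := by
      funext j
      refine Fin.succAboveCases i ?_ (fun j => ?_) j
      · simp
      · simp
    show a i • g (i.insertNth (2 * Real.pi) x : X) = a i • g (i.insertNth (0 : ℝ) x : X)
    rw [this, hp]
  · refine Continuous.integrableOn_Icc ?_
    refine continuous_finsetSum _ fun i _ => ?_
    exact (hcont.const_smul (a i)).clm_apply continuous_const

theorem contDiff_phase (k : ZStar) : ContDiff ℝ (⊤ : ℕ∞) (phase k) := by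
  unfold phase
  fun_prop

theorem hasFDerivAt_phase (k : ZStar) (ξ : X) :
    HasFDerivAt (phase k)
      (∑ i, (k.1 i : ℝ) • (ContinuousLinearMap.proj i : X →L[ℝ] ℝ)) ξ := by
  unfold phase
  refine HasFDerivAt.fun_sum fun i _ => ?_
  exact (ContinuousLinearMap.proj (R := ℝ) (φ := fun _ : Fin 3 => ℝ) i).hasFDerivAt.const_mul _

theorem fderiv_phase (k : ZStar) (ξ a : X) : fderiv ℝ (phase k) ξ a = phase k a := by
  rw [(hasFDerivAt_phase k ξ).fderiv]
  simp [phase]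

theorem phase_add_single (k : ZStar) (ξ : X) (i : Fin 3) :
    phase k (ξ + Pi.single i (2 * Real.pi)) = phase k ξ + (k.1 i : ℝ) * (2 * Real.pi) := by
  simp [phase, mul_add, Finset.sum_add_distrib, Pi.single_apply]

theorem periodic_sin (k : ZStar) : IsPeriodic fun ξ => Real.sin (phase k ξ) := fun ξ i => by
  simp only [phase_add_single]
  exact Real.sin_add_int_mul_two_pi _ _

theorem periodic_cos (k : ZStar) : IsPeriodic fun ξ => Real.cos (phase k ξ) := fun ξ i => by
  simp only [phase_add_single]
  exact Real.cos_add_int_mul_two_pi _ _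

theorem contDiff_e (k : ZStar) : ContDiff ℝ (⊤ : ℕ∞) (e k) := by
  unfold e
  split_ifs
  · exact (contDiff_phase k).cos
  · exact (contDiff_phase k).sin

theorem periodic_e (k : ZStar) : IsPeriodic (e k) := by
  unfold e
  split_ifs
  · exact periodic_cos k
  · exact periodic_sin k

theorem fderiv_sin_phase (k : ZStar) (ξ a : X) :
    fderiv ℝ (fun ξ => Real.sin (phase k ξ)) ξ a = Real.cos (phase k ξ) * phase k a := by
  rw [(((hasFDerivAt_phase k ξ).differentiableAt).hasFDerivAt.sin).fderiv]
  simp [fderiv_phase]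

theorem fderiv_cos_phase (k : ZStar) (ξ a : X) :
    fderiv ℝ (fun ξ => Real.cos (phase k ξ)) ξ a = -(Real.sin (phase k ξ) * phase k a) := by
  rw [(((hasFDerivAt_phase k ξ).differentiableAt).hasFDerivAt.cos).fderiv]
  simp [fderiv_phase]

theorem phase_self_ne_zero (k : ZStar) : phase k (fun i => (k.1 i : ℝ)) ≠ 0 := by
  intro h
  apply k.2
  unfold phase at h
  rw [Finset.sum_eq_zero_iff_of_nonneg fun i _ => mul_self_nonneg _] at h
  funext i
  have := h i (Finset.mem_univ i)
  simpa using this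

theorem integral_e (k : ZStar) : ∫ ξ, e k ξ ∂torusMeasure = 0 := by
  have hk := phase_self_ne_zero k
  unfold e
  split_ifs
  · have h := integral_deriv_periodic (((contDiff_phase k).of_le (by simp)).sin) (periodic_sin k)
      (fun i => (k.1 i : ℝ))
    simp_rw [fderiv_sin_phase] at h
    rw [integral_mul_const] at h
    exact (mul_eq_zero.1 h).resolve_right hk
  · have h := integral_deriv_periodic (((contDiff_phase k).of_le (by simp)).cos) (periodic_cos k)
      (fun i => (k.1 i : ℝ))
    simp_rw [fderiv_cos_phase] at h
    rw [integral_neg, neg_eq_zero, integral_mul_const] at h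
    exact (mul_eq_zero.1 h).resolve_right hk

theorem phase_kperp (k : ZStar) {y : E3} (hy : y ∈ kperp k) : phase k (WithLp.ofLp y) = 0 := by
  have h := (Submodule.mem_orthogonal_singleton_iff_inner_right).1 hy
  simpa [kvec, phase, PiLp.inner_apply, mul_comm] using h

theorem fderiv_e_kperp (k : ZStar) (ξ : X) {y : E3} (hy : y ∈ kperp k) :
    fderiv ℝ (e k) ξ (WithLp.ofLp y) = 0 := by
  have h := phase_kperp k hy
  unfold e
  split_ifs
  · rw [fderiv_cos_phase, h, mul_zero, neg_zero]
  · rw [fderiv_sin_phase, h, mul_zero]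

theorem continuous_modeField (k : ZStar) (y : E3) : Continuous (modeField k y) :=
  (contDiff_e k).continuous.smul continuous_const

theorem inner_grad (φ : X → ℝ) (ξ : X) (y : E3) :
    inner ℝ (grad φ ξ) y = fderiv ℝ φ ξ (WithLp.ofLp y) := by
  conv_rhs => rw [pi_eq_sum_univ' (WithLp.ofLp y)]
  simp [grad, PiLp.inner_apply, map_sum, map_smul]

theorem modeField_mem (k : ZStar) (y : kperp k) :
    (memLp_of_continuous (continuous_modeField k (y : E3))).toLp (modeField k y) ∈ H := by
  have hae := MemLp.coeFn_toLp (memLp_of_continuous (continuous_modeField k (y : E3)))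
  refine ⟨?_, fun φ hφ hp => ?_⟩
  · rw [integral_congr_ae hae]
    unfold modeField
    rw [integral_smul_const, integral_e, zero_smul]
  · have h := integral_deriv_periodic (g := fun ξ => e k ξ * φ ξ)
      (((contDiff_e k).mul hφ).of_le (by simp))
      (fun ξ i => by simp only [periodic_e k ξ i, hp ξ i]) (WithLp.ofLp (y : E3))
    rw [← h]
    refine integral_congr_ae ?_
    filter_upwards [hae] with ξ hξ
    have hd := ((((contDiff_e k).differentiable (by simp)) ξ).hasFDerivAt.mul
      ((hφ.differentiable (by simp)) ξ).hasFDerivAt).fderiv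
    have hd' : fderiv ℝ (fun ξ => e k ξ * φ ξ) ξ = e k ξ • fderiv ℝ φ ξ + φ ξ • fderiv ℝ (e k) ξ :=
      hd
    rw [hξ, hd', modeField, inner_smul_right, inner_grad]
    simp [fderiv_e_kperp k ξ y.2]

/-- The element `y e_k` of `H`, for `y ∈ k^⊥`. -/
def mode (k : ZStar) (y : kperp k) : H :=
  ⟨(memLp_of_continuous (continuous_modeField k (y : E3))).toLp (modeField k y), modeField_mem k y⟩

/-- The Fourier coefficient `u_k` of `u = ∑ u_k e_k`. -/
def coef (u : H) (k : ZStar) : E3 := ∫ ξ, e k ξ • (u : L2) ξ ∂torusMeasure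

/-! ### The Stokes operator and its domains -/

/-- `A ^ s v = f` for the Stokes operator `A`, which acts on `y e_k`, `y ∈ k^⊥`, as
multiplication by `|k|²`; in particular `v` lies in the domain of `A ^ s`. -/
def IsStokesPow (s : ℝ) (v f : H) : Prop :=
  ∀ k : ZStar, coef f k = (‖kvec k‖ ^ (2 * s)) • coef v k

/-- `u ∈ V_α = D(A^{α/2})`. -/
def MemV (α : ℝ) (u : H) : Prop :=
  Summable fun k : ZStar => ‖kvec k‖ ^ (2 * α) * ‖coef u k‖ ^ 2

/-- `|u|_{V_α} = |A^{α/2} u|_H`, for `u ∈ V_α`. -/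
def normV (α : ℝ) (u : H) : ℝ :=
  Real.sqrt (∑' k : ZStar, ‖kvec k‖ ^ (2 * α) * ‖coef u k‖ ^ 2)

/-- `u ∈ C([0,T]; V_α)`. -/
def ContinuousInV (α T : ℝ) (u : ℝ → H) : Prop :=
  (∀ t ∈ Icc 0 T, MemV α (u t)) ∧
    ∀ t₀ ∈ Icc 0 T, Tendsto (fun t => normV α (u t - u t₀)) (𝓝[Icc 0 T] t₀) (𝓝 0)

/-! ### The noise operator -/

/-- `π_N H`: the span of all modes with `|k|_∞ ≤ N`. -/
def lowModes (N : ℕ) : Submodule ℝ H :=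
  Submodule.span ℝ {v | ∃ (k : ZStar) (y : kperp k), (∀ i, |k.1 i| ≤ (N : ℤ)) ∧ v = mode k y}

/-- `(Id - π_N) H`, where `π_N` is the orthogonal projection onto `lowModes N`. -/
def highModes (N : ℕ) : Submodule ℝ H := (lowModes N)ᗮ

/-- The assumptions on the bounded operator `Q` on `H`: it is diagonal on the Fourier basis,
vanishes after projection on the modes `|k|_∞ ≤ N₀`, is injective on the other modes, and
`A^{α₀+3/4} Q` is bounded with a bounded inverse on `(Id - π_{N₀}) H`. -/
structure NoiseAssumption (α₀ : ℝ) (N₀ : ℕ) (Q : H →L[ℝ] H) : Prop where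
  half_lt : 1 / 2 < α₀
  one_le : 1 ≤ N₀
  diagonal : ∀ k : ZStar, ∃ q : kperp k →ₗ[ℝ] kperp k, ∀ y, Q (mode k y) = mode k (q y)
  range_high : ∀ v : H, Q v ∈ highModes N₀
  injective_high : ∀ v ∈ highModes N₀, Q v = 0 → v = 0
  regular : ∃ R : highModes N₀ ≃L[ℝ] highModes N₀,
    ∀ v : highModes N₀, IsStokesPow (α₀ + 3 / 4) (Q v) (R v)

/-! ### The controlled equation -/

/-- `⟨B(u,v), φ⟩ = -∫ ((u·∇)φ)·v` for `u, v ∈ H` and a smooth divergence-free field `φ`: the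
pairing of `B(u,v) = 𝒫 (u·∇) v` with `φ`, after an integration by parts (`div u = 0`). -/
def Bpair (u v : H) (φ : X → E3) : ℝ :=
  -∫ ξ, inner ℝ (fderiv ℝ φ ξ (WithLp.ofLp ((u : L2) ξ))) ((v : L2) ξ) ∂torusMeasure

/-- `∂_t u + A u + B(u,u) = f` on `[0,T]`, in the sense of distributions, integrated in time:
the equation is tested with all fields `y e_k`, `k ∈ ℤ³ ∖ {0}`, `y ∈ k^⊥`, for which
`A (y e_k) = |k|² y e_k`. -/
def SolvesNS (T : ℝ) (u f : ℝ → H) : Prop :=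
  ∀ (k : ZStar) (y : kperp k), ∀ t ∈ Icc 0 T,
    inner ℝ (u t) (mode k y) - inner ℝ (u 0) (mode k y) =
      ∫ s in (0 : ℝ)..t, (-(‖kvec k‖ ^ 2 * inner ℝ (u s) (mode k y))
        - Bpair (u s) (u s) (modeField k y) + inner ℝ (f s) (mode k y))

end NSControl

end

open scoped ENNReal

noncomputable section

namespace NSControl

/-! ### Trigonometric integrals -/

/-! Put `α = 2 α₀ + 1/2 > 3/2`. Since `2 (α₀ + 3/4) = α + 1`, the operator `Q` can be inverted on
the high modes (those with some `|k i| > N₀`), at the price of `α + 1` derivatives. The control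
problem is therefore one of designing a path. A path `u` is a controlled solution as soon as its
residual `∂_t u + A u + B(u,u)` vanishes on the low modes and is square-integrable in time with
values in `V_{α+1}`; the control is `Q⁻¹` of the residual (`exists_isControlled`). All paths are
written in the coordinates `a = A^{α/2} u ∈ H`, in which the residual has to lie in `V_1`.

The finitely many low modes receive no noise and must be moved through the nonlinearity. To each low
`k` are attached two high frequencies, `l ⟂ k` and `q = ±(k - l)`, so sparse that the only one of
these frequencies, or of the low ones, with which `l` interacts at a low mode is `q`, and the mode
reached is `k` alone (`exists_companions`). If the `l`-modes are frozen in a steady field `f` and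
the `q`-modes are a suitable linear function `b g` of a force `g`, then `f + b g` acts on the low
modes exactly as the force `g` (`exists_low_forcing`). With such forces the low modes can follow any
smooth curve (`exists_reach_low`).

It remains to bring the high modes to `f` and away from it. Without control, a short mild solution
enters `V_{α+1}` at some time (`exists_reach_regular`). From there the high modes are switched to
`f` along the Stokes flow, while the low modes solve their own ODE (`exists_reach_steady`). Near the
final time the high modes go linearly from `f` to those of the target, and the low ODE is solved
backwards from the target (`exists_reach_target`). The low parts at the inner ends of these two legs
are uncontrolled but bounded, and the steering of low modes joins them.

A target with finitely many modes is thus reached exactly; `ε` pays only for truncating `y`. Every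
duration and bound depends on the norms of the data and on `T` only, which gives `ρ₀`. -/

open Classical in
/-- The phase shift that writes `e k` as a cosine. -/
def shift (k : ZStar) : ℝ := if IsPos k.1 then 0 else Real.pi / 2

theorem e_eq_cos (k : ZStar) (ξ : X) : e k ξ = Real.cos (phase k ξ - shift k) := by
  unfold e shift
  split_ifs
  · simp
  · rw [Real.cos_sub_pi_div_two]

theorem abs_e_le_one (k : ZStar) (ξ : X) : |e k ξ| ≤ 1 := by
  rw [e_eq_cos]
  exact Real.abs_cos_le_one _

/-- The phase of an arbitrary integer frequency. -/
def phaseZ (n : Fin 3 → ℤ) (ξ : X) : ℝ := ∑ i, (n i : ℝ) * ξ i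

theorem phaseZ_coe (k : ZStar) (ξ : X) : phaseZ k.1 ξ = phase k ξ := rfl

theorem phaseZ_add (m n : Fin 3 → ℤ) (ξ : X) : phaseZ (m + n) ξ = phaseZ m ξ + phaseZ n ξ := by
  simp [phaseZ, add_mul, Finset.sum_add_distrib]

theorem phaseZ_sub (m n : Fin 3 → ℤ) (ξ : X) : phaseZ (m - n) ξ = phaseZ m ξ - phaseZ n ξ := by
  simp [phaseZ, sub_mul, Finset.sum_sub_distrib]

theorem continuous_phaseZ (n : Fin 3 → ℤ) : Continuous (phaseZ n) := by
  unfold phaseZ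
  fun_prop

theorem integrable_of_continuous {F : Type*} [NormedAddCommGroup F] {f : X → F}
    (hf : Continuous f) : Integrable f torusMeasure := by
  unfold torusMeasure
  exact Integrable.smul_measure (hf.integrableOn_Icc) ENNReal.ofReal_ne_top

theorem torusMeasure_real_univ : torusMeasure.real univ = 2 := by
  have h : (volume.restrict cell).real univ = (2 * Real.pi) ^ 3 := by
    rw [measureReal_def, Measure.restrict_apply_univ, cell, Real.volume_Icc_pi]
    simp [ENNReal.toReal_ofReal Real.pi_pos.le]
  unfold torusMeasure
  rw [measureReal_ennreal_smul_apply, h, ENNReal.toReal_ofReal (by positivity)]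
  field_simp

theorem integral_cos_phase (k : ZStar) : ∫ ξ, Real.cos (phase k ξ) ∂torusMeasure = 0 := by
  have h := integral_deriv_periodic (((contDiff_phase k).of_le (by simp)).sin) (periodic_sin k)
    (fun i => (k.1 i : ℝ))
  simp_rw [fderiv_sin_phase] at h
  rw [integral_mul_const] at h
  exact (mul_eq_zero.1 h).resolve_right (phase_self_ne_zero k)

theorem integral_sin_phase (k : ZStar) : ∫ ξ, Real.sin (phase k ξ) ∂torusMeasure = 0 := by
  have h := integral_deriv_periodic (((contDiff_phase k).of_le (by simp)).cos) (periodic_cos k)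
    (fun i => (k.1 i : ℝ))
  simp_rw [fderiv_cos_phase] at h
  rw [integral_neg, neg_eq_zero, integral_mul_const] at h
  exact (mul_eq_zero.1 h).resolve_right (phase_self_ne_zero k)

open Classical in
/-- Half the mean of `cos (n·ξ - s)` with respect to `torusMeasure`. -/
def cosMean (n : Fin 3 → ℤ) (s : ℝ) : ℝ := if n = 0 then Real.cos s else 0

theorem cosMean_of_ne {n : Fin 3 → ℤ} (h : n ≠ 0) (s : ℝ) : cosMean n s = 0 := if_neg h

theorem abs_cosMean_le (n : Fin 3 → ℤ) (s : ℝ) : |cosMean n s| ≤ if n = 0 then 1 else 0 := by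
  unfold cosMean
  split_ifs
  · exact Real.abs_cos_le_one s
  · simp

theorem integral_cos_phaseZ (n : Fin 3 → ℤ) (s : ℝ) :
    ∫ ξ, Real.cos (phaseZ n ξ - s) ∂torusMeasure = 2 * cosMean n s := by
  by_cases h : n = 0
  · subst h
    simp [phaseZ, cosMean, torusMeasure_real_univ]
  · have hc : Continuous (phaseZ n) := continuous_phaseZ n
    simp_rw [Real.cos_sub]
    rw [integral_add (integrable_of_continuous (by fun_prop))
      (integrable_of_continuous (by fun_prop)), integral_mul_const, integral_mul_const,
      cosMean_of_ne h]
    have h1 := integral_cos_phase ⟨n, h⟩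
    have h2 := integral_sin_phase ⟨n, h⟩
    simp only [← phaseZ_coe] at h1 h2
    rw [h1, h2]
    simp

theorem continuous_e (k : ZStar) : Continuous (e k) := (contDiff_e k).continuous

theorem integral_e_mul_e (p q : ZStar) :
    ∫ ξ, e p ξ * e q ξ ∂torusMeasure =
      cosMean (p.1 + q.1) (shift p + shift q) + cosMean (p.1 - q.1) (shift p - shift q) := by
  have h : ∀ ξ, e p ξ * e q ξ = (1 / 2) * (Real.cos (phaseZ (p.1 + q.1) ξ - (shift p + shift q))
      + Real.cos (phaseZ (p.1 - q.1) ξ - (shift p - shift q))) := by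
    intro ξ
    rw [e_eq_cos, e_eq_cos, phaseZ_add, phaseZ_sub, phaseZ_coe, phaseZ_coe,
      show phase p ξ + phase q ξ - (shift p + shift q)
        = (phase p ξ - shift p) + (phase q ξ - shift q) by ring,
      show phase p ξ - phase q ξ - (shift p - shift q)
        = (phase p ξ - shift p) - (phase q ξ - shift q) by ring, Real.cos_add,
      Real.cos_sub (phase p ξ - shift p)]
    ring
  have c1 := continuous_phaseZ (p.1 + q.1)
  have c2 := continuous_phaseZ (p.1 - q.1)
  simp_rw [h]
  rw [integral_const_mul, integral_add (integrable_of_continuous (by fun_prop))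
    (integrable_of_continuous (by fun_prop)), integral_cos_phaseZ, integral_cos_phaseZ]
  ring

/-- The interaction coefficient of three modes. -/
def triple (p q r : ZStar) : ℝ := ∫ ξ, e p ξ * e q ξ * e r ξ ∂torusMeasure

/-- A product of three cosines is a sum of four cosines of the signed sums of the phases. Only
resonant combinations (`±p ± q ± r = 0`) have a nonzero mean, and then the shifts decide its value.
-/
theorem triple_eq (p q r : ZStar) :
    triple p q r = (1 / 2) * (cosMean (p.1 + q.1 + r.1) (shift p + shift q + shift r)
      + cosMean (p.1 + q.1 - r.1) (shift p + shift q - shift r)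
      + cosMean (p.1 - q.1 + r.1) (shift p - shift q + shift r)
      + cosMean (p.1 - q.1 - r.1) (shift p - shift q - shift r)) := by
  have h : ∀ ξ, e p ξ * e q ξ * e r ξ = (1 / 4) *
      (Real.cos (phaseZ (p.1 + q.1 + r.1) ξ - (shift p + shift q + shift r))
      + Real.cos (phaseZ (p.1 + q.1 - r.1) ξ - (shift p + shift q - shift r))
      + Real.cos (phaseZ (p.1 - q.1 + r.1) ξ - (shift p - shift q + shift r))
      + Real.cos (phaseZ (p.1 - q.1 - r.1) ξ - (shift p - shift q - shift r))) := by
    intro ξ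
    simp only [e_eq_cos, phaseZ_add, phaseZ_sub, phaseZ_coe]
    have h1 : ∀ a b c d e f : ℝ, a + b + c - (d + e + f) = (a - d) + (b - e) + (c - f) := by
      intros; ring
    have h2 : ∀ a b c d e f : ℝ, a + b - c - (d + e - f) = (a - d) + (b - e) - (c - f) := by
      intros; ring
    have h3 : ∀ a b c d e f : ℝ, a - b + c - (d - e + f) = (a - d) - (b - e) + (c - f) := by
      intros; ring
    have h4 : ∀ a b c d e f : ℝ, a - b - c - (d - e - f) = (a - d) - (b - e) - (c - f) := by
      intros; ring
    rw [h1, h2, h3, h4]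
    simp only [Real.cos_add, Real.cos_sub, Real.sin_add, Real.sin_sub]
    ring
  have c1 := continuous_phaseZ (p.1 + q.1 + r.1)
  have c2 := continuous_phaseZ (p.1 + q.1 - r.1)
  have c3 := continuous_phaseZ (p.1 - q.1 + r.1)
  have c4 := continuous_phaseZ (p.1 - q.1 - r.1)
  unfold triple
  simp_rw [h]
  rw [integral_const_mul, integral_add (integrable_of_continuous (by fun_prop))
    (integrable_of_continuous (by fun_prop)), integral_add (integrable_of_continuous (by fun_prop))
    (integrable_of_continuous (by fun_prop)), integral_add (integrable_of_continuous (by fun_prop))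
    (integrable_of_continuous (by fun_prop))]
  simp only [integral_cos_phaseZ]
  ring

/-! ### Orthonormality of the `e_k` and the exchange of `k` and `-k` by differentiation. -/

theorem isPos_or_neg (k : ZStar) : IsPos k.1 ∨ IsPos (-k.1) := by
  have hk := k.2
  by_contra h
  apply hk
  simp only [IsPos, Pi.neg_apply, not_or] at h
  funext i
  fin_cases i <;> simp <;> omega

theorem not_isPos_neg {k : Fin 3 → ℤ} (h : IsPos k) : ¬ IsPos (-k) := by
  simp only [IsPos, Pi.neg_apply] at *
  omega

/-- The frequency `-k`. -/
def neg (k : ZStar) : ZStar := ⟨-k.1, neg_ne_zero.2 k.2⟩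

theorem neg_val (k : ZStar) : (neg k).1 = -k.1 := rfl

theorem shift_neg (k : ZStar) : shift (neg k) = Real.pi / 2 - shift k := by
  unfold shift
  rcases isPos_or_neg k with h | h
  · rw [if_neg, if_pos h, sub_zero]
    exact not_isPos_neg h
  · rw [if_pos, if_neg, sub_self]
    · intro h'
      exact not_isPos_neg h' h
    · exact h

theorem integral_e_mul_e_self (k : ZStar) : ∫ ξ, e k ξ * e k ξ ∂torusMeasure = 1 := by
  rw [integral_e_mul_e, cosMean_of_ne]
  · simp [cosMean]
  · intro h
    apply k.2
    funext i
    have := congrFun h i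
    simp only [Pi.add_apply, Pi.zero_apply] at this ⊢
    omega

theorem integral_e_mul_e_of_ne {p q : ZStar} (h : p ≠ q) :
    ∫ ξ, e p ξ * e q ξ ∂torusMeasure = 0 := by
  rw [integral_e_mul_e, cosMean_of_ne (n := p.1 - q.1), add_zero]
  · by_cases h' : p.1 + q.1 = 0
    · have : q = neg p := Subtype.ext (eq_neg_of_add_eq_zero_right h')
      rw [this, shift_neg]
      simp [cosMean]
    · exact cosMean_of_ne h' _
  · intro h'
    exact h (Subtype.ext (sub_eq_zero.1 h'))

theorem e_neg_eq (k : ZStar) (ξ : X) : e (neg k) ξ = -Real.sin (phase k ξ - shift k) := by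
  have h : phase (neg k) ξ = - phase k ξ := by simp [phase, neg]
  rw [e_eq_cos, shift_neg, h, ← Real.cos_add_pi_div_two, ← Real.cos_neg]
  congr 1
  ring

/-- The formula carries no sign that depends on the parity of `e k`: the minus sign of `cos' = -sin`
is absorbed by the oddness of the sine at `-k`. This is why `neg k` occurs in all interaction
coefficients below. -/
theorem fderiv_e (k : ZStar) (ξ a : X) : fderiv ℝ (e k) ξ a = phase k a * e (neg k) ξ := by
  have : e k = fun ξ => Real.cos (phase k ξ - shift k) := funext (e_eq_cos k)
  rw [this, (((hasFDerivAt_phase k ξ).sub_const (shift k)).cos).fderiv, e_neg_eq]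
  simp [phase]
  ring

/-! ### Completeness of the trigonometric system -/

section Torus

local instance : MeasureSpace UnitAddCircle := ⟨AddCircle.haarAddCircle⟩

local instance : Measure.IsAddHaarMeasure (volume : Measure UnitAddCircle) :=
  inferInstanceAs (Measure.IsAddHaarMeasure AddCircle.haarAddCircle)

local instance : IsProbabilityMeasure (volume : Measure UnitAddCircle) :=
  inferInstanceAs (IsProbabilityMeasure AddCircle.haarAddCircle)

/-- The unit cell `(0,1]³`. -/
def unitCell : Set X := {x : X | ∀ i, x i ∈ Ioc ((0 : X) i) ((0 : X) i + 1)}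

theorem measurableSet_unitCell : MeasurableSet unitCell :=
  MeasurableSet.univ_pi' fun _ => measurableSet_Ioc

/-- The representative in `(0,1]³` of a point of the torus. -/
def torusRep (q : UnitAddTorus (Fin 3)) : X :=
  (UnitAddTorus.measurableEquivPiIoc (0 : X) q).1

theorem measurable_torusRep : Measurable torusRep :=
  measurable_subtype_coe.comp (UnitAddTorus.measurableEquivPiIoc (0 : X)).measurable

theorem torusRep_coe {x : X} (hx : x ∈ unitCell) : torusRep (fun i => (x i : UnitAddCircle)) = x := by
  have := (UnitAddTorus.measurableEquivPiIoc (0 : X)).apply_symm_apply ⟨x, hx⟩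
  exact congrArg Subtype.val this

theorem mFourier_coe (n : Fin 3 → ℤ) (x : X) :
    UnitAddTorus.mFourier n (fun i => (x i : UnitAddCircle)) =
      Complex.exp (2 * Real.pi * Complex.I * (phaseZ n x : ℝ)) := by
  simp only [UnitAddTorus.mFourier, ContinuousMap.coe_mk, fourier_coe_apply]
  rw [← Complex.exp_sum]
  congr 1
  simp only [phaseZ, Complex.ofReal_sum, Finset.mul_sum]
  refine Finset.sum_congr rfl fun i _ => ?_
  push_cast
  ring

/-- Transported to the torus, this is the completeness of the multivariate Fourier basis. The
statement is pulled back to the half-open cell, which represents each point of the torus once. -/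
theorem ae_eq_zero_of_unitCell_coeff {f : X → ℂ} (hm : Measurable f)
    (hf : ∫⁻ x in unitCell, ‖f x‖ₑ ^ 2 < ⊤)
    (h : ∀ n : Fin 3 → ℤ,
      ∫ x in unitCell, Complex.exp (2 * Real.pi * Complex.I * (phaseZ n x : ℝ)) * f x = 0) :
    ∀ᵐ x ∂(volume.restrict unitCell), f x = 0 := by
  set F : UnitAddTorus (Fin 3) → ℂ := fun q => f (torusRep q) with hF
  have hFm : Measurable F := hm.comp measurable_torusRep
  have key : ∫⁻ q, ‖F q‖ₑ ^ 2 = ∫⁻ x in unitCell, ‖f x‖ₑ ^ 2 := by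
    rw [UnitAddTorus.lintegral_preimage _ (0 : X)]
    refine setLIntegral_congr_fun measurableSet_unitCell fun x hx => ?_
    simp only [hF]
    rw [torusRep_coe hx]
  have hL : MemLp F 2 volume := by
    refine ⟨hFm.aestronglyMeasurable, ?_⟩
    rw [eLpNorm_lt_top_iff_lintegral_rpow_enorm_lt_top (by norm_num) (by norm_num)]
    simpa [key] using hf
  have hc : ∀ n, UnitAddTorus.mFourierCoeff (hL.toLp F) n = 0 := by
    intro n
    have : UnitAddTorus.mFourierCoeff (hL.toLp F) n = UnitAddTorus.mFourierCoeff F n := by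
      unfold UnitAddTorus.mFourierCoeff
      refine integral_congr_ae ?_
      filter_upwards [hL.coeFn_toLp] with q hq
      rw [hq]
    rw [this, UnitAddTorus.mFourierCoeff_eq_integral F n (0 : X), ← h (-n)]
    refine setIntegral_congr_fun measurableSet_unitCell fun x hx => ?_
    simp only [hF]
    rw [torusRep_coe hx, mFourier_coe, smul_eq_mul]
  have hz : hL.toLp F = 0 := by
    apply UnitAddTorus.mFourierBasis.repr.injective
    ext n
    rw [UnitAddTorus.mFourierBasis_repr, hc]
    simp
  have hF0 : ∫⁻ q, ‖F q‖ₑ ^ 2 = 0 := by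
    have : F =ᵐ[volume] 0 := (MemLp.toLp_eq_toLp_iff hL MemLp.zero).1 (by rw [hz]; rfl)
    rw [lintegral_congr_ae (g := fun _ => 0)]
    · simp
    · filter_upwards [this] with q hq
      simp [hq]
  rw [key, lintegral_eq_zero_iff (by fun_prop)] at hF0
  filter_upwards [hF0] with x hx
  simpa using hx

end Torus

/-- The two cells differ by a null set once rescaled. The value of the constant is irrelevant, since
only null sets and vanishing integrals are transported; `c ≠ 0` is what allows null sets to be
pulled back. -/
theorem map_smul_unitCell :
    ∃ c : ENNReal, c ≠ 0 ∧
      (volume.restrict unitCell).map (fun x : X => (2 * Real.pi) • x) = c • torusMeasure := by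
  have hp := Real.two_pi_pos
  set s : Set X := Set.pi univ fun _ => Ioc 0 (2 * Real.pi) with hs
  have hsm : MeasurableSet s := MeasurableSet.univ_pi fun _ => measurableSet_Ioc
  have hpre : (fun x : X => (2 * Real.pi) • x) ⁻¹' s = unitCell := by
    ext x
    simp only [hs, unitCell, mem_preimage, mem_ofPred_eq, Pi.smul_apply, smul_eq_mul, Pi.zero_apply,
      zero_add, mem_Ioc, Set.mem_pi, mem_univ, forall_true_left]
    refine forall_congr' fun i => ?_
    rw [mul_le_iff_le_one_right hp]
    simp [hp]
  have hae : s =ᵐ[volume] cell := Measure.univ_pi_Ioc_ae_eq_Icc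
  have hr := Measure.restrict_map (μ := (volume : Measure X))
    (f := fun x : X => (2 * Real.pi) • x) (measurable_const_smul _) hsm
  rw [hpre, Measure.map_addHaar_smul _ hp.ne', Measure.restrict_smul,
    Measure.restrict_congr_set hae] at hr
  set A : ENNReal := ENNReal.ofReal |((2 * Real.pi) ^ Module.finrank ℝ X)⁻¹| with hA
  set B : ENNReal := ENNReal.ofReal (2 / (2 * Real.pi) ^ 3) with hB
  have hA0 : A ≠ 0 := by
    rw [hA, Ne, ENNReal.ofReal_eq_zero, not_le]
    positivity
  have hB0 : B ≠ 0 := by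
    rw [hB, Ne, ENNReal.ofReal_eq_zero, not_le]
    positivity
  refine ⟨A * B⁻¹, mul_ne_zero hA0 (ENNReal.inv_ne_zero.2 ENNReal.ofReal_ne_top), ?_⟩
  rw [← hr]
  unfold torusMeasure
  rw [smul_smul, mul_assoc, ENNReal.inv_mul_cancel hB0 ENNReal.ofReal_ne_top, mul_one]

theorem ae_eq_zero_of_trig {f : X → ℝ} (hf : MemLp f 2 torusMeasure)
    (hc : ∀ n : Fin 3 → ℤ, ∫ ξ, Real.cos (phaseZ n ξ) * f ξ ∂torusMeasure = 0)
    (hs : ∀ n : Fin 3 → ℤ, ∫ ξ, Real.sin (phaseZ n ξ) * f ξ ∂torusMeasure = 0) :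
    f =ᵐ[torusMeasure] 0 := by
  obtain ⟨c, hc0, hmap⟩ := map_smul_unitCell
  have hsm : Measurable (fun x : X => (2 * Real.pi) • x) := measurable_const_smul _
  set g := hf.1.mk f with hg
  have hgm : Measurable g := hf.1.stronglyMeasurable_mk.measurable
  have hfg : f =ᵐ[torusMeasure] g := hf.1.ae_eq_mk
  have hgL : MemLp g 2 torusMeasure := hf.ae_eq hfg
  -- Finiteness is needed to transport square integrability; an infinite constant would give the
  -- unit cell infinite volume.
  have hct : c ≠ ⊤ := by
    intro h
    have h1 := congrArg (fun m => m univ) hmap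
    simp only [Measure.map_apply hsm MeasurableSet.univ, preimage_univ,
      Measure.restrict_apply_univ, h, Measure.smul_apply, smul_eq_mul] at h1
    have h2 : torusMeasure univ ≠ 0 := by
      intro h
      have := torusMeasure_real_univ
      simp [measureReal_def, h] at this
    rw [ENNReal.top_mul h2] at h1
    have h3 : volume unitCell ≤ volume (Icc (0 : X) 1) := by
      refine measure_mono fun x hx => ⟨fun i => ?_, fun i => ?_⟩
      · exact (hx i).1.le
      · simpa using (hx i).2
    rw [h1] at h3
    exact absurd (isCompact_Icc.measure_lt_top (μ := (volume : Measure X))) (not_lt.2 h3)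
  have hint : ∀ b : ℝ → ℝ, Continuous b → (∀ x, |b x| ≤ 1) → ∀ n : Fin 3 → ℤ,
      Integrable (fun ξ => b (phaseZ n ξ) * g ξ) torusMeasure := by
    intro b hb hb1 n
    refine (hgL.integrable (by norm_num)).bdd_mul
      ((hb.comp (continuous_phaseZ n)).aestronglyMeasurable) (c := 1) ?_
    exact Eventually.of_forall fun ξ => by simpa using hb1 _
  have hz := ae_eq_zero_of_unitCell_coeff (f := fun x => ((g ((2 * Real.pi) • x) : ℝ) : ℂ))
    (Complex.measurable_ofReal.comp (hgm.comp hsm)) ?_ ?_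
  · have h1 : ∀ᵐ ξ ∂(c • torusMeasure), g ξ = 0 := by
      rw [← hmap, ae_map_iff hsm.aemeasurable (measurableSet_eq_fun hgm measurable_const)]
      filter_upwards [hz] with x hx
      exact_mod_cast hx
    have h2 : ∀ᵐ ξ ∂torusMeasure, g ξ = 0 := by
      rw [ae_iff, Measure.smul_apply, smul_eq_mul] at h1
      exact (mul_eq_zero.1 h1).resolve_left hc0
    filter_upwards [h2, hfg] with ξ h h'
    rw [h', h]
    rfl
  · have h1 : ∫⁻ ξ, ‖g ξ‖ₑ ^ 2 ∂(c • torusMeasure) < ⊤ := by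
      rw [lintegral_smul_measure]
      have := hgL.2
      rw [eLpNorm_lt_top_iff_lintegral_rpow_enorm_lt_top (by norm_num) (by norm_num)] at this
      refine ENNReal.mul_lt_top hct.lt_top ?_
      simpa using this
    rw [← hmap, lintegral_map (by fun_prop) hsm] at h1
    have h2 : ∀ r : ℝ, ‖(r : ℂ)‖ₑ = ‖r‖ₑ := fun r => enorm_eq_iff_norm_eq.2 (Complex.norm_real r)
    simpa only [h2] using h1
  · intro n
    have h1 : ∫ ξ, Complex.exp (Complex.I * (phaseZ n ξ : ℝ)) * (g ξ : ℂ) ∂(c • torusMeasure) = 0 := by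
      rw [integral_smul_measure]
      have h2 : ∀ ξ, Complex.exp (Complex.I * (phaseZ n ξ : ℝ)) * (g ξ : ℂ)
          = ((Real.cos (phaseZ n ξ) * g ξ : ℝ) : ℂ)
            + ((Real.sin (phaseZ n ξ) * g ξ : ℝ) : ℂ) * Complex.I := by
        intro ξ
        rw [mul_comm Complex.I, Complex.exp_mul_I]
        push_cast
        ring
      simp_rw [h2]
      have h3 := hc n
      have h4 := hs n
      rw [integral_congr_ae (g := fun ξ => Real.cos (phaseZ n ξ) * g ξ)
        (by filter_upwards [hfg] with ξ h; rw [h])] at h3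
      rw [integral_congr_ae (g := fun ξ => Real.sin (phaseZ n ξ) * g ξ)
        (by filter_upwards [hfg] with ξ h; rw [h])] at h4
      rw [integral_add, integral_mul_const, integral_complex_ofReal, integral_complex_ofReal, h3, h4]
      · simp
      · exact (hint _ Real.continuous_cos Real.abs_cos_le_one n).ofReal
      · exact (hint _ Real.continuous_sin Real.abs_sin_le_one n).ofReal.mul_const _
    have hpc := continuous_phaseZ n
    rw [← hmap, integral_map hsm.aemeasurable] at h1
    · rw [← h1]
      refine integral_congr_ae (Eventually.of_forall fun x => ?_)
      have : phaseZ n ((2 * Real.pi) • x) = 2 * Real.pi * phaseZ n x := by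
        simp only [phaseZ, Pi.smul_apply, smul_eq_mul, Finset.mul_sum]
        exact Finset.sum_congr rfl fun i _ => by ring
      simp only [this]
      push_cast
      ring_nf
    · exact ((by fun_prop : Measurable fun ξ =>
        Complex.exp (Complex.I * (phaseZ n ξ : ℝ)) * (g ξ : ℂ))).aestronglyMeasurable

/-! ### `H` as a Hilbert sum of the planes `k^⊥` -/

theorem inner_toLp {G : X → E3} (hG : Continuous G) (u : L2) :
    inner ℝ ((memLp_of_continuous hG).toLp G) u = ∫ ξ, inner ℝ (G ξ) (u ξ) ∂torusMeasure := by
  rw [L2.inner_def]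
  refine integral_congr_ae ?_
  filter_upwards [(memLp_of_continuous hG).coeFn_toLp] with ξ h
  rw [h]

/-- All defining conditions are orthogonality relations: the mean vanishes when the field is
orthogonal to every constant vector, in particular to its own mean. -/
theorem isClosed_H : IsClosed (H : Set L2) := by
  have : (H : Set L2) =
      (⋂ y : E3, {u : L2 | inner ℝ ((memLp_of_continuous (continuous_const (y := y))).toLp _) u
        = (0 : ℝ)}) ∩
      ⋂ φ : {φ : X → ℝ // ContDiff ℝ (⊤ : ℕ∞) φ ∧ IsPeriodic φ},
        {u : L2 | inner ℝ ((memLp_of_continuous (continuous_grad φ.2.1)).toLp _) u = (0 : ℝ)} := by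
    ext u
    simp only [mem_inter_iff, mem_iInter, mem_ofPred_eq, Subtype.forall, SetLike.mem_coe]
    constructor
    · rintro ⟨h1, h2⟩
      refine ⟨fun y => (inner_toLp continuous_const u).trans ?_,
        fun φ hφ => (inner_toLp (continuous_grad hφ.1) u).trans (h2 φ hφ.1 hφ.2)⟩
      rw [integral_inner (integrable_L2 u), h1, inner_zero_right]
    · rintro ⟨h1, h2⟩
      refine ⟨?_, fun φ hφ hp => (inner_toLp (continuous_grad hφ) u).symm.trans (h2 φ ⟨hφ, hp⟩)⟩
      have := (inner_toLp continuous_const u).symm.trans (h1 (∫ ξ, u ξ ∂torusMeasure))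
      rw [integral_inner (integrable_L2 u)] at this
      exact inner_self_eq_zero.1 this
  rw [this]
  refine IsClosed.inter (isClosed_iInter fun y => ?_) (isClosed_iInter fun φ => ?_) <;>
  exact isClosed_eq (by fun_prop) continuous_const

instance : CompleteSpace H := isClosed_H.completeSpace_coe

theorem integrable_e_smul (u : L2) (k : ZStar) :
    Integrable (fun ξ => e k ξ • u ξ) torusMeasure := by
  refine (integrable_L2 u).bdd_smul 1 (continuous_e k).aestronglyMeasurable ?_
  exact Eventually.of_forall fun ξ => by simpa using abs_e_le_one k ξ

theorem inner_mode (u : H) (k : ZStar) (y : kperp k) :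
    inner ℝ u (mode k y) = inner ℝ (coef u k) (y : E3) := by
  rw [real_inner_comm, Submodule.coe_inner, mode, inner_toLp (continuous_modeField k (y : E3)),
    real_inner_comm, coef, ← integral_inner (integrable_e_smul _ _)]
  refine integral_congr_ae (Eventually.of_forall fun ξ => ?_)
  simp only [modeField, inner_smul_left, inner_smul_right]
  rfl

/-- The divergence condition is tested with `e (neg k)`, whose gradient is `-e_k k`. -/
theorem coef_mem (u : H) (k : ZStar) : coef u k ∈ kperp k := by
  rw [kperp, Submodule.mem_orthogonal_singleton_iff_inner_right, coef,
    ← integral_inner (integrable_e_smul _ _)]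
  have h := u.2.2 (e (neg k)) (contDiff_e _) (periodic_e _)
  rw [← neg_eq_zero, ← integral_neg, ← h]
  refine integral_congr_ae (Eventually.of_forall fun ξ => ?_)
  have hk : neg (neg k) = k := Subtype.ext (neg_neg k.1)
  have : grad (e (neg k)) ξ = - (e k ξ • kvec k) := by
    ext i
    simp only [grad, fderiv_e, hk, kvec, PiLp.neg_apply, PiLp.smul_apply, smul_eq_mul]
    simp [phase, neg, Pi.single_apply]
    ring
  simp only [this, inner_neg_left, inner_smul_left, inner_smul_right]
  rfl

theorem coef_mode_self (k : ZStar) (y : kperp k) : coef (mode k y) k = y := by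
  have : ∀ᵐ ξ ∂torusMeasure, e k ξ • ((mode k y : H) : L2) ξ = (e k ξ * e k ξ) • (y : E3) := by
    filter_upwards [(memLp_of_continuous (continuous_modeField k (y : E3))).coeFn_toLp] with ξ h
    rw [mode, h, modeField, smul_smul]
  rw [coef, integral_congr_ae this, integral_smul_const, integral_e_mul_e_self, one_smul]

theorem coef_mode_of_ne {k l : ZStar} (h : l ≠ k) (y : kperp k) : coef (mode k y) l = 0 := by
  have : ∀ᵐ ξ ∂torusMeasure, e l ξ • ((mode k y : H) : L2) ξ = (e l ξ * e k ξ) • (y : E3) := by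
    filter_upwards [(memLp_of_continuous (continuous_modeField k (y : E3))).coeFn_toLp] with ξ h
    rw [mode, h, modeField, smul_smul]
  rw [coef, integral_congr_ae this, integral_smul_const, integral_e_mul_e_of_ne h, zero_smul]

theorem coef_add (u v : H) (k : ZStar) : coef (u + v) k = coef u k + coef v k := by
  have : ∀ᵐ ξ ∂torusMeasure, e k ξ • ((u + v : H) : L2) ξ
      = e k ξ • (u : L2) ξ + e k ξ • (v : L2) ξ := by
    filter_upwards [Lp.coeFn_add (u : L2) (v : L2)] with ξ h
    rw [Submodule.coe_add, h, Pi.add_apply, smul_add]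
  rw [coef, integral_congr_ae this, integral_add (integrable_e_smul _ _) (integrable_e_smul _ _)]
  rfl

theorem coef_smul (c : ℝ) (u : H) (k : ZStar) : coef (c • u) k = c • coef u k := by
  have : ∀ᵐ ξ ∂torusMeasure, e k ξ • ((c • u : H) : L2) ξ = c • (e k ξ • (u : L2) ξ) := by
    filter_upwards [Lp.coeFn_smul c (u : L2)] with ξ h
    rw [Submodule.coe_smul, h, Pi.smul_apply, smul_comm]
  rw [coef, integral_congr_ae this, integral_smul]
  rfl

/-- Each component is handled separately: `e k` and `e (neg k)` span the cosine and the sine of the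
phase `k·ξ`, and the zero frequency is covered by the mean-zero condition. -/
theorem eq_zero_of_coef (u : H) (h : ∀ k, coef u k = 0) : u = 0 := by
  apply Subtype.ext
  rw [Submodule.coe_zero, Lp.eq_zero_iff_ae_eq_zero]
  have hcomp : ∀ j : Fin 3, (fun ξ => (u : L2) ξ j) =ᵐ[torusMeasure] 0 := by
    intro j
    have hL : MemLp (fun ξ => (u : L2) ξ j) 2 torusMeasure :=
      (EuclideanSpace.proj (𝕜 := ℝ) j).comp_memLp' (Lp.memLp (u : L2))
    have hI : Integrable (fun ξ => (u : L2) ξ j) torusMeasure := hL.integrable (by norm_num)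
    have hE : ∀ k : ZStar, ∫ ξ, e k ξ * (u : L2) ξ j ∂torusMeasure = 0 := by
      intro k
      have := ContinuousLinearMap.integral_comp_comm (EuclideanSpace.proj (𝕜 := ℝ) j)
        (integrable_e_smul (u : L2) k)
      change _ = EuclideanSpace.proj (𝕜 := ℝ) j (coef u k) at this
      rw [h k, map_zero] at this
      simpa using this
    have hEI : ∀ k : ZStar, Integrable (fun ξ => e k ξ * (u : L2) ξ j) torusMeasure := by
      intro k
      refine hI.bdd_mul (continuous_e k).aestronglyMeasurable (c := 1) ?_
      exact Eventually.of_forall fun ξ => by simpa using abs_e_le_one k ξ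
    have h0 : ∫ ξ, (u : L2) ξ j ∂torusMeasure = 0 := by
      have := ContinuousLinearMap.integral_comp_comm (EuclideanSpace.proj (𝕜 := ℝ) j)
        (integrable_L2 (u : L2))
      rw [u.2.1, map_zero] at this
      simpa using this
    have lin : ∀ (k : ZStar) (a b : ℝ),
        ∫ ξ, (a * e k ξ + b * e (neg k) ξ) * (u : L2) ξ j ∂torusMeasure = 0 := by
      intro k a b
      simp_rw [add_mul, mul_assoc]
      rw [integral_add ((hEI k).const_mul a) ((hEI _).const_mul b), integral_const_mul,
        integral_const_mul, hE, hE]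
      simp
    refine ae_eq_zero_of_trig hL (fun n => ?_) (fun n => ?_)
    · by_cases hn : n = 0
      · subst hn
        simpa [phaseZ] using h0
      · rw [← lin ⟨n, hn⟩ (Real.cos (shift ⟨n, hn⟩)) (Real.sin (shift ⟨n, hn⟩))]
        congr 1
        funext ξ
        rw [e_eq_cos, e_neg_eq, ← phaseZ_coe]
        conv_lhs => rw [show phaseZ n ξ = (phaseZ n ξ - shift ⟨n, hn⟩) + shift ⟨n, hn⟩ by ring,
          Real.cos_add]
        ring
    · by_cases hn : n = 0
      · subst hn
        simp [phaseZ]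
      · rw [← lin ⟨n, hn⟩ (Real.sin (shift ⟨n, hn⟩)) (-Real.cos (shift ⟨n, hn⟩))]
        congr 1
        funext ξ
        rw [e_eq_cos, e_neg_eq, ← phaseZ_coe]
        conv_lhs => rw [show phaseZ n ξ = (phaseZ n ξ - shift ⟨n, hn⟩) + shift ⟨n, hn⟩ by ring,
          Real.sin_add]
        ring
  filter_upwards [hcomp 0, hcomp 1, hcomp 2] with ξ h0 h1 h2
  ext i
  fin_cases i
  · exact h0
  · exact h1
  · exact h2

/-- The Fourier coefficient as a linear map. -/
def coefₗ (k : ZStar) : H →ₗ[ℝ] E3 where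
  toFun u := coef u k
  map_add' u v := coef_add u v k
  map_smul' c u := coef_smul c u k

theorem coef_injective {u v : H} (h : ∀ k, coef u k = coef v k) : u = v := by
  rw [← sub_eq_zero]
  refine eq_zero_of_coef _ fun k => ?_
  have := map_sub (coefₗ k) u v
  change coef (u - v) k = coef u k - coef v k at this
  rw [this, h, sub_self]

/-- The isometric embedding `y ↦ y e_k`. -/
def modeₗᵢ (k : ZStar) : kperp k →ₗᵢ[ℝ] H where
  toFun := mode k
  map_add' y z := by
    refine coef_injective fun l => ?_
    rw [coef_add]
    by_cases h : l = k
    · subst h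
      simp [coef_mode_self]
    · simp [coef_mode_of_ne h]
  map_smul' c y := by
    refine coef_injective fun l => ?_
    simp only [RingHom.id_apply]
    rw [coef_smul]
    by_cases h : l = k
    · subst h
      simp [coef_mode_self]
    · simp [coef_mode_of_ne h]
  norm_map' y := by
    have h : inner ℝ (mode k y) (mode k y) = inner ℝ (y : E3) (y : E3) := by
      rw [inner_mode, coef_mode_self]
    rw [real_inner_self_eq_norm_sq, real_inner_self_eq_norm_sq] at h
    exact (sq_eq_sq₀ (norm_nonneg _) (norm_nonneg _)).1 h

theorem modeₗᵢ_apply (k : ZStar) (y : kperp k) : modeₗᵢ k y = mode k y := rfl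

theorem isHilbertSum_mode : IsHilbertSum ℝ (fun k : ZStar => kperp k) modeₗᵢ := by
  refine IsHilbertSum.mk (fun k l hkl y z => ?_) ?_
  · rw [modeₗᵢ_apply, modeₗᵢ_apply, inner_mode, coef_mode_of_ne hkl.symm, inner_zero_left]
  · rw [top_le_iff, Submodule.topologicalClosure_eq_top_iff, Submodule.eq_bot_iff]
    intro u hu
    refine eq_zero_of_coef u fun k => ?_
    have h := Submodule.mem_orthogonal' _ u |>.1 hu (mode k ⟨coef u k, coef_mem u k⟩)
      (Submodule.mem_iSup_of_mem k ⟨_, rfl⟩)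
    rw [inner_mode] at h
    exact inner_self_eq_zero.1 h

theorem linearIsometryEquiv_coef (u : H) (k : ZStar) :
    ((isHilbertSum_mode.linearIsometryEquiv u k : kperp k) : E3) = coef u k := by
  set f := isHilbertSum_mode.linearIsometryEquiv u with hf
  have h := isHilbertSum_mode.hasSum_linearIsometryEquiv_symm f
  rw [hf, LinearIsometryEquiv.symm_apply_apply] at h
  refine ext_inner_right ℝ fun z => ?_
  -- Both vectors lie in `k^⊥`, so it suffices to test them against vectors of `k^⊥`, where pairing
  -- with a mode is available.
  have hz : ∀ c ∈ kperp k, inner ℝ c z = inner ℝ c ((kperp k).starProjection z) := by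
    intro c hc
    rw [← Submodule.inner_starProjection_left_eq_right, Submodule.starProjection_eq_self_iff.2 hc]
  rw [hz _ (f k).2, hz _ (coef_mem u k)]
  set y : kperp k := ⟨(kperp k).starProjection z, Submodule.starProjection_apply_mem _ _⟩
  have h2 := h.mapL (innerSL ℝ (mode k y))
  have h3 : HasSum (fun l => innerSL ℝ (mode k y) (modeₗᵢ l (f l))) (inner ℝ (f k : E3) (y : E3)) := by
    convert hasSum_single k ?_ using 1
    · rw [innerSL_apply_apply, real_inner_comm, modeₗᵢ_apply, inner_mode, coef_mode_self]
    · intro l hl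
      rw [innerSL_apply_apply, real_inner_comm, modeₗᵢ_apply, inner_mode, coef_mode_of_ne hl.symm,
        inner_zero_left]
  have h4 := h3.unique h2
  rw [innerSL_apply_apply, real_inner_comm u, inner_mode] at h4
  exact h4

theorem hasSum_mode (u : H) : HasSum (fun k => mode k ⟨coef u k, coef_mem u k⟩) u := by
  have h := isHilbertSum_mode.hasSum_linearIsometryEquiv_symm (isHilbertSum_mode.linearIsometryEquiv u)
  rw [LinearIsometryEquiv.symm_apply_apply] at h
  have h2 : (fun k => mode k ⟨coef u k, coef_mem u k⟩) =
      fun k => modeₗᵢ k (isHilbertSum_mode.linearIsometryEquiv u k) := by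
    funext k
    exact congrArg (mode k) (Subtype.ext (linearIsometryEquiv_coef u k).symm)
  rw [h2]
  exact h

theorem hasSum_norm_coef_sq (u : H) : HasSum (fun k => ‖coef u k‖ ^ 2) (‖u‖ ^ 2) := by
  have h := lp.hasSum_norm (p := 2) (by norm_num) (isHilbertSum_mode.linearIsometryEquiv u)
  rw [LinearIsometryEquiv.norm_map] at h
  simpa [← linearIsometryEquiv_coef] using h

theorem exists_coef_eq (c : ZStar → E3) (hc : ∀ k, c k ∈ kperp k)
    (hs : Summable fun k => ‖c k‖ ^ 2) : ∃ u : H, ∀ k, coef u k = c k := by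
  have : Memℓp (fun k => (⟨c k, hc k⟩ : kperp k)) 2 := by
    refine memℓp_gen ?_
    simpa using hs
  refine ⟨isHilbertSum_mode.linearIsometryEquiv.symm ⟨_, this⟩, fun k => ?_⟩
  rw [← linearIsometryEquiv_coef, LinearIsometryEquiv.apply_symm_apply]

/-! ### Fourier multipliers -/

theorem one_le_norm_kvec (k : ZStar) : 1 ≤ ‖kvec k‖ := by
  obtain ⟨i, hi⟩ := Function.ne_iff.1 k.2
  have h1 : (1 : ℝ) ≤ |(k.1 i : ℝ)| := by
    exact_mod_cast Int.one_le_abs hi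
  have h2 := PiLp.norm_apply_le (kvec k) i
  rw [Real.norm_eq_abs] at h2
  exact h1.trans h2

theorem norm_kvec_pos (k : ZStar) : 0 < ‖kvec k‖ := one_pos.trans_le (one_le_norm_kvec k)

theorem norm_coef_le (u : H) (k : ZStar) : ‖coef u k‖ ≤ ‖u‖ := by
  have h := (hasSum_norm_coef_sq u)
  have h2 := h.summable.le_tsum k (fun _ _ => sq_nonneg _)
  rw [h.tsum_eq] at h2
  exact (sq_le_sq₀ (norm_nonneg _) (norm_nonneg _)).1 h2

/-- The Fourier coefficient as a continuous linear map. -/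
def coefL (k : ZStar) : H →L[ℝ] E3 :=
  (coefₗ k).mkContinuous 1 fun u => by
    rw [one_mul]
    exact norm_coef_le u k

@[simp] theorem coefL_apply (k : ZStar) (u : H) : coefL k u = coef u k := rfl

theorem coef_sub (u v : H) (k : ZStar) : coef (u - v) k = coef u k - coef v k :=
  map_sub (coefL k) u v

theorem coef_neg (u : H) (k : ZStar) : coef (-u) k = -coef u k := map_neg (coefL k) u

@[simp] theorem coef_zero (k : ZStar) : coef 0 k = 0 := map_zero (coefL k)

theorem coef_sum {ι : Type*} (s : Finset ι) (u : ι → H) (k : ZStar) :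
    coef (∑ i ∈ s, u i) k = ∑ i ∈ s, coef (u i) k := map_sum (coefL k) u s

theorem norm_le_of_coef_le {u v : H} {C : ℝ} (hC : 0 ≤ C)
    (h : ∀ k, ‖coef u k‖ ≤ C * ‖coef v k‖) : ‖u‖ ≤ C * ‖v‖ := by
  rw [← sq_le_sq₀ (norm_nonneg _) (by positivity), mul_pow]
  refine hasSum_le (fun k => ?_) (hasSum_norm_coef_sq u) ((hasSum_norm_coef_sq v).mul_left (C ^ 2))
  rw [← mul_pow]
  exact pow_le_pow_left₀ (norm_nonneg _) (h k) 2

theorem exists_diag (m : ZStar → ℝ) (C : ℝ) (hm : ∀ k, |m k| ≤ C) (u : H) :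
    ∃ v : H, ∀ k, coef v k = m k • coef u k := by
  refine exists_coef_eq _ (fun k => Submodule.smul_mem _ _ (coef_mem u k)) ?_
  refine Summable.of_nonneg_of_le (fun _ => sq_nonneg _) (fun k => ?_)
    ((hasSum_norm_coef_sq u).summable.mul_left (C ^ 2))
  rw [norm_smul, mul_pow, Real.norm_eq_abs]
  gcongr
  exact hm k

open Classical in
/-- The Fourier multiplier with bounded symbol `m`. -/
def diag (m : ZStar → ℝ) : H →L[ℝ] H :=
  -- An unbounded symbol gives the zero operator. Hence `lift α` and `heat t` have their meaning for
  -- nonnegative parameters, and `heatHalf t` for `t > 0` only.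
  if h : ∃ C, ∀ k, |m k| ≤ C then
    LinearMap.mkContinuous
      { toFun := fun u => (exists_diag m h.choose h.choose_spec u).choose
        map_add' := fun u v => coef_injective fun k => by
          rw [coef_add, (exists_diag m h.choose h.choose_spec _).choose_spec,
            (exists_diag m h.choose h.choose_spec _).choose_spec,
            (exists_diag m h.choose h.choose_spec _).choose_spec, coef_add, smul_add]
        map_smul' := fun c u => coef_injective fun k => by
          rw [RingHom.id_apply, coef_smul, (exists_diag m h.choose h.choose_spec _).choose_spec,
            (exists_diag m h.choose h.choose_spec _).choose_spec, coef_smul, smul_comm] }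
      |h.choose| fun u => by
        refine norm_le_of_coef_le (abs_nonneg _) fun k => ?_
        change ‖coef (exists_diag m h.choose h.choose_spec u).choose k‖ ≤ _
        rw [(exists_diag m h.choose h.choose_spec _).choose_spec, norm_smul, Real.norm_eq_abs]
        exact mul_le_mul_of_nonneg_right ((h.choose_spec k).trans (le_abs_self _)) (norm_nonneg _)
  else 0

theorem coef_diag {m : ZStar → ℝ} {C : ℝ} (hm : ∀ k, |m k| ≤ C) (u : H) (k : ZStar) :
    coef (diag m u) k = m k • coef u k := by
  have h : ∃ C, ∀ k, |m k| ≤ C := ⟨C, hm⟩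
  unfold diag
  rw [dif_pos h]
  exact (exists_diag m h.choose h.choose_spec u).choose_spec k

theorem norm_diag_le {m : ZStar → ℝ} {C : ℝ} (hm : ∀ k, |m k| ≤ C) : ‖diag m‖ ≤ C := by
  have hC : 0 ≤ C := by
    have k : ZStar := ⟨fun _ => 1, fun h => by simpa using congrFun h 0⟩
    exact (abs_nonneg _).trans (hm k)
  refine ContinuousLinearMap.opNorm_le_bound _ hC fun u => ?_
  refine norm_le_of_coef_le hC fun k => ?_
  rw [coef_diag hm, norm_smul, Real.norm_eq_abs]
  gcongr
  exact hm k

theorem tsum_enorm_coef_sq (u : H) : ∑' k, ‖coef u k‖ₑ ^ 2 = ‖u‖ₑ ^ 2 := by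
  have h := hasSum_norm_coef_sq u
  have h2 := ENNReal.ofReal_tsum_of_nonneg (fun k => sq_nonneg ‖coef u k‖) h.summable
  rw [h.tsum_eq] at h2
  simp only [ENNReal.ofReal_pow (norm_nonneg _), ofReal_norm] at h2
  exact h2.symm

theorem exists_coef_eq_of_tsum (c : ZStar → E3) (hc : ∀ k, c k ∈ kperp k)
    (hs : ∑' k, ‖c k‖ₑ ^ 2 ≠ ⊤) : ∃ u : H, ∀ k, coef u k = c k := by
  refine exists_coef_eq c hc ?_
  have h := ENNReal.summable_toReal hs
  simpa using h

/-! ### The convection term -/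

theorem inner_kvec_ofLp (k : ZStar) (y : E3) : phase k (WithLp.ofLp y) = inner ℝ (kvec k) y := by
  simp [kvec, phase, PiLp.inner_apply, mul_comm]

theorem norm_sq_L2 (u : L2) : ‖u‖ ^ 2 = ∫ ξ, ‖u ξ‖ ^ 2 ∂torusMeasure := by
  rw [← real_inner_self_eq_norm_sq, L2.inner_def]
  simp

theorem integrable_norm_mul_norm (u v : L2) :
    Integrable (fun ξ => ‖u ξ‖ * ‖v ξ‖) torusMeasure :=
  MemLp.integrable_mul (Lp.memLp u).norm (Lp.memLp v).norm

theorem integral_norm_mul_norm_le (u v : L2) :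
    ∫ ξ, ‖u ξ‖ * ‖v ξ‖ ∂torusMeasure ≤ ‖u‖ * ‖v‖ := by
  have h := integral_mul_norm_le_Lp_mul_Lq (μ := torusMeasure) (f := u) (g := v) (p := 2) (q := 2)
    (by constructor <;> norm_num) (by simpa using Lp.memLp u) (by simpa using Lp.memLp v)
  have h2 : ∀ w : L2, (∫ ξ, ‖w ξ‖ ^ (2 : ℝ) ∂torusMeasure) ^ (1 / (2 : ℝ)) = ‖w‖ := by
    intro w
    rw [← Real.sqrt_eq_rpow]
    simp_rw [Real.rpow_two]
    rw [← norm_sq_L2, Real.sqrt_sq (norm_nonneg _)]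
  rwa [h2, h2] at h

theorem norm_convection_le (k : ZStar) (u v : L2) (ξ : X) :
    ‖(e (neg k) ξ * inner ℝ (kvec k) (u ξ)) • v ξ‖ ≤ ‖kvec k‖ * (‖u ξ‖ * ‖v ξ‖) := by
  rw [norm_smul, norm_mul, Real.norm_eq_abs, Real.norm_eq_abs]
  calc |e (neg k) ξ| * |inner ℝ (kvec k) (u ξ)| * ‖v ξ‖
      ≤ 1 * (‖kvec k‖ * ‖u ξ‖) * ‖v ξ‖ := by
        gcongr
        · exact abs_e_le_one _ _
        · exact abs_real_inner_le_norm _ _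
    _ = _ := by ring

theorem integrable_convection (k : ZStar) (u v : L2) :
    Integrable (fun ξ => (e (neg k) ξ * inner ℝ (kvec k) (u ξ)) • v ξ) torusMeasure := by
  refine ((integrable_norm_mul_norm u v).const_mul ‖kvec k‖).mono' ?_
    (Eventually.of_forall (norm_convection_le k u v))
  refine AEStronglyMeasurable.smul (AEStronglyMeasurable.mul
    (continuous_e _).aestronglyMeasurable ?_) (Lp.aestronglyMeasurable v)
  exact aestronglyMeasurable_const.inner (Lp.aestronglyMeasurable u)

/-- The integral `∫ (k·u) v e_{-k}` as a bilinear map. -/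
def convection (k : ZStar) : H →L[ℝ] H →L[ℝ] E3 :=
  LinearMap.mkContinuous₂
    (LinearMap.mk₂ ℝ (fun u v : H =>
        ∫ ξ, (e (neg k) ξ * inner ℝ (kvec k) ((u : L2) ξ)) • (v : L2) ξ ∂torusMeasure)
      (fun u u' v => by
        rw [← integral_add (integrable_convection k _ _) (integrable_convection k _ _)]
        refine integral_congr_ae ?_
        filter_upwards [Lp.coeFn_add (u : L2) (u' : L2)] with ξ h
        rw [Submodule.coe_add, h, Pi.add_apply, inner_add_right, mul_add, add_smul])
      (fun c u v => by
        rw [← integral_smul]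
        refine integral_congr_ae ?_
        filter_upwards [Lp.coeFn_smul c (u : L2)] with ξ h
        rw [Submodule.coe_smul, h, Pi.smul_apply, inner_smul_right, smul_smul]
        congr 1
        ring)
      (fun u v v' => by
        rw [← integral_add (integrable_convection k _ _) (integrable_convection k _ _)]
        refine integral_congr_ae ?_
        filter_upwards [Lp.coeFn_add (v : L2) (v' : L2)] with ξ h
        rw [Submodule.coe_add, h, Pi.add_apply, smul_add])
      (fun c u v => by
        rw [← integral_smul]
        refine integral_congr_ae ?_
        filter_upwards [Lp.coeFn_smul c (v : L2)] with ξ h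
        rw [Submodule.coe_smul, h, Pi.smul_apply, smul_comm]))
    ‖kvec k‖ fun u v => by
      change ‖∫ ξ, (e (neg k) ξ * inner ℝ (kvec k) ((u : L2) ξ)) • (v : L2) ξ ∂torusMeasure‖ ≤ _
      refine (norm_integral_le_of_norm_le ((integrable_norm_mul_norm (u : L2) v).const_mul ‖kvec k‖)
        (Eventually.of_forall (norm_convection_le k u v))).trans ?_
      rw [integral_const_mul, mul_assoc]
      gcongr
      exact integral_norm_mul_norm_le (u : L2) v

theorem convection_apply (k : ZStar) (u v : H) : convection k u v =
    ∫ ξ, (e (neg k) ξ * inner ℝ (kvec k) ((u : L2) ξ)) • (v : L2) ξ ∂torusMeasure := rfl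

/-- The Fourier coefficient of `B(u,v) = 𝒫 (u·∇) v`. -/
def bcoef (k : ZStar) : H →L[ℝ] H →L[ℝ] E3 :=
  (ContinuousLinearMap.compL ℝ H E3 E3 (-(kperp k).starProjection)).comp (convection k)

theorem bcoef_apply (k : ZStar) (u v : H) :
    bcoef k u v = -(kperp k).starProjection (convection k u v) := rfl

theorem bcoef_mem (k : ZStar) (u v : H) : bcoef k u v ∈ kperp k := by
  rw [bcoef_apply]
  exact Submodule.neg_mem _ (Submodule.starProjection_apply_mem _ _)

theorem fderiv_modeField (k : ZStar) (y : E3) (ξ : X) (a : E3) :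
    fderiv ℝ (modeField k y) ξ (WithLp.ofLp a) = (e (neg k) ξ * inner ℝ (kvec k) a) • y := by
  have h : HasFDerivAt (modeField k y) ((fderiv ℝ (e k) ξ).smulRight y) ξ :=
    (((contDiff_e k).differentiable (by simp)) ξ).hasFDerivAt.smul_const y
  rw [h.fderiv, ContinuousLinearMap.smulRight_apply, fderiv_e, inner_kvec_ofLp, mul_comm]

/-- This ties the coefficients used throughout to the weak form of the convection term. The
projection may be dropped because the test vector is already in `k^⊥`. -/
theorem inner_bcoef (k : ZStar) (u v : H) (y : kperp k) :
    inner ℝ (bcoef k u v) (y : E3) = Bpair u v (modeField k y) := by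
  rw [bcoef_apply, inner_neg_left, Submodule.inner_starProjection_left_eq_right,
    Submodule.starProjection_eq_self_iff.2 y.2, Bpair, convection_apply, real_inner_comm,
    ← integral_inner (integrable_convection k _ _)]
  congr 1
  refine integral_congr_ae (Eventually.of_forall fun ξ => ?_)
  simp only [fderiv_modeField, inner_smul_left, inner_smul_right]
  rfl

theorem bcoef_mode (k p q : ZStar) (a : kperp p) (b : kperp q) :
    bcoef k (mode p a) (mode q b) =
      -(triple p q (neg k) * inner ℝ (kvec k) (a : E3)) • (kperp k).starProjection (b : E3) := by
  have : ∀ᵐ ξ ∂torusMeasure, (e (neg k) ξ * inner ℝ (kvec k) (((mode p a : H) : L2) ξ)) •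
      ((mode q b : H) : L2) ξ =
      (e p ξ * e q ξ * e (neg k) ξ * inner ℝ (kvec k) (a : E3)) • (b : E3) := by
    filter_upwards [(memLp_of_continuous (continuous_modeField p (a : E3))).coeFn_toLp,
      (memLp_of_continuous (continuous_modeField q (b : E3))).coeFn_toLp] with ξ h1 h2
    rw [mode, mode, h1, h2, modeField, modeField, inner_smul_right, smul_smul]
    congr 1
    ring
  rw [bcoef_apply, convection_apply, integral_congr_ae this, integral_smul_const,
    integral_mul_const, map_smul, neg_smul]
  rfl

/-- The Fourier series of `u` and of `v` may be inserted one after the other because `bcoef k` is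
continuous in each argument on `H`. Values in `[0,∞]` avoid every question of summability. -/
theorem enorm_bcoef_le (k : ZStar) (u v : H) :
    ‖bcoef k u v‖ₑ ≤ ‖kvec k‖ₑ * ∑' p, ∑' q, ‖coef u p‖ₑ * ‖coef v q‖ₑ * ‖triple p q (neg k)‖ₑ := by
  have h1 : HasSum (fun p => bcoef k (mode p ⟨coef u p, coef_mem u p⟩) v) (bcoef k u v) := by
    have := (hasSum_mode u).mapL ((bcoef k).flip v)
    simpa using this
  have h2 : ∀ p, HasSum (fun q => bcoef k (mode p ⟨coef u p, coef_mem u p⟩)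
      (mode q ⟨coef v q, coef_mem v q⟩)) (bcoef k (mode p ⟨coef u p, coef_mem u p⟩) v) := by
    intro p
    exact (hasSum_mode v).mapL (bcoef k (mode p ⟨coef u p, coef_mem u p⟩))
  rw [← h1.tsum_eq, ← ENNReal.tsum_mul_left]
  refine enorm_tsum_le_tsum_enorm.trans (ENNReal.tsum_le_tsum fun p => ?_)
  rw [← (h2 p).tsum_eq, ← ENNReal.tsum_mul_left]
  refine enorm_tsum_le_tsum_enorm.trans (ENNReal.tsum_le_tsum fun q => ?_)
  rw [bcoef_mode]
  have h3 : ‖(-(triple p q (neg k) * inner ℝ (kvec k) (coef u p))) •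
      (kperp k).starProjection (coef v q)‖ ≤
      ‖kvec k‖ * (‖coef u p‖ * ‖coef v q‖ * ‖triple p q (neg k)‖) := by
    rw [norm_smul, norm_neg, norm_mul]
    calc ‖triple p q (neg k)‖ * ‖inner ℝ (kvec k) (coef u p)‖
          * ‖(kperp k).starProjection (coef v q)‖
        ≤ ‖triple p q (neg k)‖ * (‖kvec k‖ * ‖coef u p‖) * ‖coef v q‖ := by
          gcongr
          · exact norm_inner_le_norm _ _
          · exact Submodule.norm_starProjection_apply_le _ _
      _ = _ := by ring
  have h4 := ENNReal.ofReal_le_ofReal h3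
  rw [ENNReal.ofReal_mul (norm_nonneg _), ENNReal.ofReal_mul (by positivity),
    ENNReal.ofReal_mul (norm_nonneg _)] at h4
  simpa only [ofReal_norm] using h4

/-! ### Sobolev estimates for the convection term -/

/-- The frequencies embed in a lattice of rank three, where the exponent `-3` is critical. This is
the source of the condition `α > 3/2`. -/
theorem summable_norm_kvec_rpow {r : ℝ} (hr : r < -3) : Summable fun k : ZStar => ‖kvec k‖ ^ r := by
  obtain ⟨b, hb⟩ : ∃ b : Module.Basis (Fin 3) ℝ E3, ∀ i, b i = EuclideanSpace.single i 1 :=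
    ⟨(EuclideanSpace.basisFun (Fin 3) ℝ).toBasis, fun i => by simp⟩
  have hrank : Module.finrank ℤ (Submodule.span ℤ (Set.range b)) = 3 := by
    rw [ZLattice.rank ℝ]
    simp
  have h : Summable fun z : Submodule.span ℤ (Set.range b) => ‖(z : E3)‖ ^ r :=
    ZLattice.summable_norm_rpow _ r (by rw [hrank]; exact_mod_cast hr)
  have hmem : ∀ k : ZStar, kvec k ∈ Submodule.span ℤ (Set.range b) := by
    intro k
    have : kvec k = ∑ i, k.1 i • b i := by
      ext j
      simp [kvec, hb, Finset.sum_apply, Pi.single_apply]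
    rw [this]
    exact Submodule.sum_mem _ fun i _ => Submodule.smul_mem _ _ (Submodule.subset_span ⟨i, rfl⟩)
  have hinj : Function.Injective
      (fun k : ZStar => (⟨kvec k, hmem k⟩ : Submodule.span ℤ (Set.range b))) := by
    intro k l hkl
    have h1 : kvec k = kvec l := congrArg Subtype.val hkl
    refine Subtype.ext (funext fun i => ?_)
    have h2 := congrArg (fun v : E3 => v i) h1
    simpa [kvec] using h2
  have := h.comp_injective hinj
  simp only [Function.comp_def] at this
  exact this

/-! ### Cauchy–Schwarz and Young inequalities for sums in `[0,∞]`. -/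

theorem ENNReal_two_mul_le (x y : ℝ≥0∞) : 2 * (x * y) ≤ x ^ 2 + y ^ 2 := by
  wlog h : x ≤ y generalizing x y
  · rw [mul_comm x, add_comm]
    exact this y x (le_of_not_ge h)
  obtain ⟨d, rfl⟩ := exists_add_of_le h
  have h1 : x ^ 2 + (x + d) ^ 2 = 2 * (x * (x + d)) + d ^ 2 := by ring
  rw [h1]
  exact le_self_add

theorem ENNReal_add_sq_le (x y : ℝ≥0∞) : (x + y) ^ 2 ≤ 2 * (x ^ 2 + y ^ 2) := by
  calc (x + y) ^ 2 = x ^ 2 + y ^ 2 + 2 * (x * y) := by ring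
    _ ≤ x ^ 2 + y ^ 2 + (x ^ 2 + y ^ 2) := by gcongr; exact ENNReal_two_mul_le x y
    _ = _ := by ring

theorem tsum_mul_sq_le {ι : Type*} (f w : ι → ℝ≥0∞) :
    (∑' i, f i * w i) ^ 2 ≤ (∑' i, w i) * ∑' i, f i ^ 2 * w i := by
  -- The square is written as a double sum and symmetrized with `2 f_i f_j ≤ f_i² + f_j²`; the
  -- factor 2 is kept so that no division is needed before the end.
  have h : 2 * (∑' i, f i * w i) ^ 2 ≤ 2 * ((∑' i, w i) * ∑' i, f i ^ 2 * w i) := by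
    calc 2 * (∑' i, f i * w i) ^ 2 = ∑' i, ∑' j, 2 * ((f i * f j) * (w i * w j)) := by
          rw [sq, ← ENNReal.tsum_mul_right, ← ENNReal.tsum_mul_left]
          refine tsum_congr fun i => ?_
          rw [← ENNReal.tsum_mul_left, ← ENNReal.tsum_mul_left]
          exact tsum_congr fun j => by ring
      _ ≤ ∑' i, ∑' j, (f i ^ 2 * w i * w j + w i * (f j ^ 2 * w j)) := by
          refine ENNReal.tsum_le_tsum fun i => ENNReal.tsum_le_tsum fun j => ?_
          calc 2 * ((f i * f j) * (w i * w j)) = 2 * (f i * f j) * (w i * w j) := by ring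
            _ ≤ (f i ^ 2 + f j ^ 2) * (w i * w j) := by
              gcongr
              exact ENNReal_two_mul_le _ _
            _ = _ := by ring
      _ = _ := by
          simp_rw [ENNReal.tsum_add, ENNReal.tsum_mul_left, ENNReal.tsum_mul_right]
          ring
  rwa [ENNReal.mul_le_mul_iff_right (by norm_num) (by norm_num)] at h

/-- This is the convolution inequality `ℓ² * ℓ¹ → ℓ²` for a kernel that is only almost a
convolution. Cauchy–Schwarz with weight `B_q J_{pqk}` uses the bound on the sums over `p`, and the
sum over `k` uses the other one. -/
theorem tsum_young {ι κ ν : Type*} (A : ι → ℝ≥0∞) (B : κ → ℝ≥0∞) (J : ι → κ → ν → ℝ≥0∞) (c : ℝ≥0∞)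
    (h1 : ∀ q k, ∑' p, J p q k ≤ c) (h2 : ∀ p q, ∑' k, J p q k ≤ c) :
    ∑' k, (∑' p, ∑' q, A p * B q * J p q k) ^ 2 ≤ c ^ 2 * ((∑' p, A p ^ 2) * (∑' q, B q) ^ 2) := by
  have hk : ∀ k, (∑' p, ∑' q, A p * B q * J p q k) ^ 2 ≤
      (c * ∑' q, B q) * ∑' p, ∑' q, A p ^ 2 * (B q * J p q k) := by
    intro k
    have := tsum_mul_sq_le (fun x : ι × κ => A x.1) (fun x => B x.2 * J x.1 x.2 k)
    rw [ENNReal.tsum_prod (f := fun p q => A p * (B q * J p q k)),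
      ENNReal.tsum_prod (f := fun p q => B q * J p q k),
      ENNReal.tsum_prod (f := fun p q => A p ^ 2 * (B q * J p q k))] at this
    simp_rw [mul_assoc (A _)]
    refine this.trans (mul_le_mul' ?_ le_rfl)
    rw [ENNReal.tsum_comm, mul_comm c, ← ENNReal.tsum_mul_right]
    refine ENNReal.tsum_le_tsum fun q => ?_
    rw [ENNReal.tsum_mul_left]
    gcongr
    exact h1 q k
  calc _ ≤ ∑' k, (c * ∑' q, B q) * ∑' p, ∑' q, A p ^ 2 * (B q * J p q k) :=
        ENNReal.tsum_le_tsum hk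
    _ = (c * ∑' q, B q) * ∑' p, ∑' q, A p ^ 2 * (B q * ∑' k, J p q k) := by
        rw [ENNReal.tsum_mul_left, ENNReal.tsum_comm]
        congr 1
        refine tsum_congr fun p => ?_
        rw [ENNReal.tsum_comm]
        refine tsum_congr fun q => ?_
        rw [ENNReal.tsum_mul_left, ENNReal.tsum_mul_left]
    _ ≤ (c * ∑' q, B q) * ∑' p, ∑' q, A p ^ 2 * (B q * c) := by
        gcongr with p q
        exact h2 p q
    _ = _ := by
        simp_rw [ENNReal.tsum_mul_left, ENNReal.tsum_mul_right]
        ring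

/-- The indicator of `n = 0`. -/
def indZero (n : Fin 3 → ℤ) : ℝ≥0∞ := if n = 0 then 1 else 0

theorem tsum_indZero_le {g : ZStar → Fin 3 → ℤ} (hg : Function.Injective g) :
    ∑' p, indZero (g p) ≤ 1 := by
  by_cases h : ∃ p, g p = 0
  · obtain ⟨p, hp⟩ := h
    rw [tsum_eq_single p]
    · simp [indZero, hp]
    · intro q hq
      have : g q ≠ 0 := fun h => hq (hg (h.trans hp.symm))
      simp [indZero, this]
  · simp only [not_exists] at h
    simp [indZero, h]

theorem enorm_cosMean_le (n : Fin 3 → ℤ) (s : ℝ) : ‖cosMean n s‖ₑ ≤ indZero n := by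
  have h := ENNReal.ofReal_le_ofReal (abs_cosMean_le n s)
  rw [← Real.norm_eq_abs, ofReal_norm] at h
  unfold indZero
  refine h.trans ?_
  split_ifs <;> simp

theorem enorm_triple_le (p q k : ZStar) :
    ‖triple p q (neg k)‖ₑ ≤ indZero (p.1 + q.1 - k.1) + indZero (p.1 + q.1 + k.1)
      + indZero (p.1 - q.1 - k.1) + indZero (p.1 - q.1 + k.1) := by
  rw [triple_eq, neg_val, enorm_mul]
  have h1 : ‖(1 / 2 : ℝ)‖ₑ ≤ 1 := by
    rw [← ofReal_norm, ENNReal.ofReal_le_one]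
    norm_num
  refine (mul_le_mul' h1 ((enorm_add_le _ _).trans (add_le_add ((enorm_add_le _ _).trans
    (add_le_add (enorm_add_le _ _) le_rfl)) le_rfl))).trans ?_
  rw [one_mul, ← sub_eq_add_neg, sub_neg_eq_add, ← sub_eq_add_neg, sub_neg_eq_add]
  gcongr <;> exact enorm_cosMean_le _ _

theorem injective_val_add_const (c : Fin 3 → ℤ) :
    Function.Injective (fun p : ZStar => p.1 + c) := fun _ _ h =>
  Subtype.ext (add_right_cancel h)

theorem injective_const_sub_val (c : Fin 3 → ℤ) :
    Function.Injective (fun p : ZStar => c - p.1) := fun _ _ h =>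
  Subtype.ext (sub_right_injective h)

/-- Two frequencies determine the third one in each of the four resonance relations, whence the 4
here and in the next two lemmas. -/
theorem tsum_triple_le₁ (q k : ZStar) : ∑' p, ‖triple p q (neg k)‖ₑ ≤ 4 := by
  refine (ENNReal.tsum_le_tsum fun p => enorm_triple_le p q k).trans ?_
  simp_rw [ENNReal.tsum_add]
  have h1 := tsum_indZero_le (injective_val_add_const (q.1 - k.1))
  have h2 := tsum_indZero_le (injective_val_add_const (q.1 + k.1))
  have h3 := tsum_indZero_le (injective_val_add_const (-q.1 - k.1))
  have h4 := tsum_indZero_le (injective_val_add_const (-q.1 + k.1))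
  simp only [add_sub_assoc', ← add_assoc, ← sub_eq_add_neg] at h1 h2 h3 h4
  calc _ ≤ (1 : ℝ≥0∞) + 1 + 1 + 1 := by gcongr
    _ = 4 := by norm_num

theorem tsum_triple_le₂ (p k : ZStar) : ∑' q, ‖triple p q (neg k)‖ₑ ≤ 4 := by
  refine (ENNReal.tsum_le_tsum fun q => enorm_triple_le p q k).trans ?_
  simp_rw [ENNReal.tsum_add]
  have h1 := tsum_indZero_le (injective_val_add_const (p.1 - k.1))
  have h2 := tsum_indZero_le (injective_val_add_const (p.1 + k.1))
  have h3 := tsum_indZero_le (injective_const_sub_val (p.1 - k.1))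
  have h4 := tsum_indZero_le (injective_const_sub_val (p.1 + k.1))
  have e1 : ∀ q : ZStar, q.1 + (p.1 - k.1) = p.1 + q.1 - k.1 := fun q => by abel
  have e2 : ∀ q : ZStar, q.1 + (p.1 + k.1) = p.1 + q.1 + k.1 := fun q => by abel
  have e3 : ∀ q : ZStar, p.1 - k.1 - q.1 = p.1 - q.1 - k.1 := fun q => by abel
  have e4 : ∀ q : ZStar, p.1 + k.1 - q.1 = p.1 - q.1 + k.1 := fun q => by abel
  simp only [e1, e2, e3, e4] at h1 h2 h3 h4
  calc _ ≤ (1 : ℝ≥0∞) + 1 + 1 + 1 := by gcongr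
    _ = 4 := by norm_num

theorem tsum_triple_le₃ (p q : ZStar) : ∑' k, ‖triple p q (neg k)‖ₑ ≤ 4 := by
  refine (ENNReal.tsum_le_tsum fun k => enorm_triple_le p q k).trans ?_
  simp_rw [ENNReal.tsum_add]
  have h1 := tsum_indZero_le (injective_const_sub_val (p.1 + q.1))
  have h2 := tsum_indZero_le (injective_val_add_const (p.1 + q.1))
  have h3 := tsum_indZero_le (injective_const_sub_val (p.1 - q.1))
  have h4 := tsum_indZero_le (injective_val_add_const (p.1 - q.1))
  have e1 : ∀ k : ZStar, k.1 + (p.1 + q.1) = p.1 + q.1 + k.1 := fun q => by abel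
  have e2 : ∀ k : ZStar, k.1 + (p.1 - q.1) = p.1 - q.1 + k.1 := fun q => by abel
  simp only [e1, e2] at h1 h2 h3 h4
  calc _ ≤ (1 : ℝ≥0∞) + 1 + 1 + 1 := by gcongr
    _ = 4 := by norm_num

/-- The weight `|k|^s`. -/
def wt (s : ℝ) (k : ZStar) : ℝ≥0∞ := ENNReal.ofReal (‖kvec k‖ ^ s)

theorem wt_add (s r : ℝ) (k : ZStar) : wt (s + r) k = wt s k * wt r k := by
  unfold wt
  rw [Real.rpow_add (norm_kvec_pos k), ENNReal.ofReal_mul (by positivity)]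

theorem wt_zero (k : ZStar) : wt 0 k = 1 := by simp [wt]

theorem wt_one (k : ZStar) : wt 1 k = ‖kvec k‖ₑ := by simp [wt]

theorem norm_kvec_le_of_triple_ne_zero {p q k : ZStar} (h : triple p q (neg k) ≠ 0) :
    ‖kvec k‖ ≤ ‖kvec p‖ + ‖kvec q‖ := by
  have key : ∀ (a b : ℝ), |a| ≤ 1 → |b| ≤ 1 → kvec k = a • kvec p + b • kvec q →
      ‖kvec k‖ ≤ ‖kvec p‖ + ‖kvec q‖ := by
    intro a b ha hb hk
    rw [hk]
    refine (norm_add_le _ _).trans ?_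
    rw [norm_smul, norm_smul]
    have h1 := mul_le_mul_of_nonneg_right ha (norm_nonneg (kvec p))
    have h2 := mul_le_mul_of_nonneg_right hb (norm_nonneg (kvec q))
    simp only [Real.norm_eq_abs]
    linarith
  have conv : ∀ (a b : ℤ), k.1 = a • p.1 + b • q.1 →
      kvec k = (a : ℝ) • kvec p + (b : ℝ) • kvec q := by
    intro a b hk
    ext i
    have := congrFun hk i
    simp only [Pi.add_apply, Pi.smul_apply, smul_eq_mul] at this
    simp [kvec, this]
  by_contra hn
  apply h
  rw [triple_eq, neg_val]
  rw [cosMean_of_ne, cosMean_of_ne, cosMean_of_ne, cosMean_of_ne]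
  · simp
  · exact fun h => hn (key _ _ (by simp) (by simp) (conv (-1) 1 (funext fun i => by
      have := congrFun h i
      simp at this ⊢
      lia)))
  · exact fun h => hn (key _ _ (by simp) (by simp) (conv 1 (-1) (funext fun i => by
      have := congrFun h i
      simp at this ⊢
      lia)))
  · exact fun h => hn (key _ _ (by simp) (by simp) (conv (-1) (-1) (funext fun i => by
      have := congrFun h i
      simp at this ⊢
      lia)))
  · exact fun h => hn (key _ _ (by simp) (by simp) (conv 1 1 (funext fun i => by
      have := congrFun h i
      simp at this ⊢
      lia)))

/-- In a resonance `k = ±p ± q`, so `|k|` is at most twice the larger of `|p|` and `|q|`. The weight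
of the product can thus be moved onto one of the factors. -/
theorem wt_mul_triple_le {s : ℝ} (hs : 0 ≤ s) (p q k : ZStar) :
    wt s k * ‖triple p q (neg k)‖ₑ ≤
      ENNReal.ofReal (2 ^ s) * (wt s p + wt s q) * ‖triple p q (neg k)‖ₑ := by
  by_cases h : triple p q (neg k) = 0
  · simp [h]
  gcongr
  have h1 := norm_kvec_le_of_triple_ne_zero h
  unfold wt
  rw [← ENNReal.ofReal_add (by positivity) (by positivity), ← ENNReal.ofReal_mul (by positivity)]
  apply ENNReal.ofReal_le_ofReal
  set P := ‖kvec p‖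
  set Q := ‖kvec q‖
  have hP : 0 ≤ P := norm_nonneg _
  have hQ : 0 ≤ Q := norm_nonneg _
  have h2 : ‖kvec k‖ ≤ 2 * max P Q := by
    have := le_max_left P Q
    have := le_max_right P Q
    linarith
  calc ‖kvec k‖ ^ s ≤ (2 * max P Q) ^ s := Real.rpow_le_rpow (norm_nonneg _) h2 hs
    _ = 2 ^ s * (max P Q) ^ s := Real.mul_rpow (by norm_num) (le_max_of_le_left hP)
    _ ≤ 2 ^ s * (P ^ s + Q ^ s) := by
      gcongr
      rcases max_choice P Q with h | h <;> rw [h]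
      · have : 0 ≤ Q ^ s := by positivity
        linarith
      · have : 0 ≤ P ^ s := by positivity
        linarith

/-- The square of the `V_s` norm, with values in `[0,∞]`. -/
def sobSq (s : ℝ) (u : H) : ℝ≥0∞ := ∑' k, (wt s k * ‖coef u k‖ₑ) ^ 2

/-- The sum `∑ |k|^{-2α}`. -/
def wtSum (α : ℝ) : ℝ≥0∞ := ∑' k, wt (-2 * α) k

theorem wtSum_ne_top {α : ℝ} (hα : 3 / 2 < α) : wtSum α ≠ ⊤ := by
  unfold wtSum wt
  rw [← ENNReal.ofReal_tsum_of_nonneg (fun k => by positivity)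
    (summable_norm_kvec_rpow (by linarith))]
  exact ENNReal.ofReal_ne_top

/-- For `α > 3/2` this is the embedding of `V_α` in the fields with absolutely summable Fourier
series. It is Cauchy–Schwarz with weight `|k|^{-2α}`. -/
theorem tsum_enorm_coef_le (α : ℝ) (u : H) : (∑' k, ‖coef u k‖ₑ) ^ 2 ≤ wtSum α * sobSq α u := by
  have h := tsum_mul_sq_le (fun k => wt (2 * α) k * ‖coef u k‖ₑ) (fun k => wt (-2 * α) k)
  have e1 : ∀ k, wt (2 * α) k * ‖coef u k‖ₑ * wt (-2 * α) k = ‖coef u k‖ₑ := by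
    intro k
    calc _ = wt (2 * α) k * wt (-2 * α) k * ‖coef u k‖ₑ := by ring
      _ = _ := by rw [← wt_add, show 2 * α + -2 * α = 0 by ring, wt_zero, one_mul]
  have e2 : ∀ k, (wt (2 * α) k * ‖coef u k‖ₑ) ^ 2 * wt (-2 * α) k = (wt α k * ‖coef u k‖ₑ) ^ 2 := by
    intro k
    calc _ = wt (2 * α) k * (wt (2 * α) k * wt (-2 * α) k) * ‖coef u k‖ₑ ^ 2 := by ring
      _ = _ := by
        rw [← wt_add, show 2 * α + -2 * α = 0 by ring, wt_zero, mul_one,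
          show 2 * α = α + α by ring, wt_add]
        ring
  simp only [e1, e2] at h
  exact h

/-- The tame product estimate: the derivative in `B` costs one power of `|k|`, and in each term only
one factor carries the norm of order `s` while the other is measured in `V_α`. After splitting the
weight, each half is a Young inequality with constant `4² = 16`; the 2 from squaring a sum makes 32.
-/
theorem tsum_bcoef_le {s : ℝ} (hs : 0 ≤ s) (α : ℝ) (u v : H) :
    ∑' k, (wt (s - 1) k * ‖bcoef k u v‖ₑ) ^ 2 ≤
      32 * ENNReal.ofReal (2 ^ s) ^ 2 * wtSum α *
        (sobSq s u * sobSq α v + sobSq α u * sobSq s v) := by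
  set c := ENNReal.ofReal (2 ^ s)
  have hk : ∀ k, (wt (s - 1) k * ‖bcoef k u v‖ₑ) ^ 2 ≤ 2 * c ^ 2 *
      ((∑' p, ∑' q, (wt s p * ‖coef u p‖ₑ) * ‖coef v q‖ₑ * ‖triple p q (neg k)‖ₑ) ^ 2
       + (∑' q, ∑' p, (wt s q * ‖coef v q‖ₑ) * ‖coef u p‖ₑ * ‖triple p q (neg k)‖ₑ) ^ 2) := by
    intro k
    have h1 : wt (s - 1) k * ‖bcoef k u v‖ₑ ≤ c *
        ((∑' p, ∑' q, (wt s p * ‖coef u p‖ₑ) * ‖coef v q‖ₑ * ‖triple p q (neg k)‖ₑ)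
        + (∑' q, ∑' p, (wt s q * ‖coef v q‖ₑ) * ‖coef u p‖ₑ * ‖triple p q (neg k)‖ₑ)) := by
      calc wt (s - 1) k * ‖bcoef k u v‖ₑ
          ≤ wt (s - 1) k * (‖kvec k‖ₑ *
            ∑' p, ∑' q, ‖coef u p‖ₑ * ‖coef v q‖ₑ * ‖triple p q (neg k)‖ₑ) := by
            gcongr
            exact enorm_bcoef_le k u v
        _ = ∑' p, ∑' q, ‖coef u p‖ₑ * ‖coef v q‖ₑ * (wt s k * ‖triple p q (neg k)‖ₑ) := by
            rw [← mul_assoc, ← wt_one, ← wt_add, sub_add_cancel, ← ENNReal.tsum_mul_left]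
            refine tsum_congr fun p => ?_
            rw [← ENNReal.tsum_mul_left]
            exact tsum_congr fun q => by ring
        _ ≤ ∑' p, ∑' q, ‖coef u p‖ₑ * ‖coef v q‖ₑ *
            (c * (wt s p + wt s q) * ‖triple p q (neg k)‖ₑ) := by
            exact ENNReal.tsum_le_tsum fun p => ENNReal.tsum_le_tsum fun q =>
              mul_le_mul' le_rfl (wt_mul_triple_le hs p q k)
        _ = _ := by
            rw [ENNReal.tsum_comm (f := fun q p =>
                wt s q * ‖coef v q‖ₑ * ‖coef u p‖ₑ * ‖triple p q (neg k)‖ₑ), ← ENNReal.tsum_add,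
              ← ENNReal.tsum_mul_left]
            refine tsum_congr fun p => ?_
            rw [← ENNReal.tsum_add, ← ENNReal.tsum_mul_left]
            exact tsum_congr fun q => by ring
    refine (pow_le_pow_left' h1 2).trans ?_
    rw [mul_pow]
    calc _ ≤ c ^ 2 * (2 * _) := by
          gcongr
          exact ENNReal_add_sq_le _ _
      _ = _ := by ring
  refine (ENNReal.tsum_le_tsum hk).trans ?_
  rw [ENNReal.tsum_mul_left, ENNReal.tsum_add]
  have y1 := tsum_young (fun p => wt s p * ‖coef u p‖ₑ) (fun q => ‖coef v q‖ₑ)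
    (fun p q k => ‖triple p q (neg k)‖ₑ) 4 (fun q k => tsum_triple_le₁ q k)
    (fun p q => tsum_triple_le₃ p q)
  have y2 := tsum_young (fun q => wt s q * ‖coef v q‖ₑ) (fun p => ‖coef u p‖ₑ)
    (fun q p k => ‖triple p q (neg k)‖ₑ) 4 (fun p k => tsum_triple_le₂ p k)
    (fun q p => tsum_triple_le₃ p q)
  have z1 := y1.trans (mul_le_mul' le_rfl (mul_le_mul' le_rfl (tsum_enorm_coef_le α v)))
  have z2 := y2.trans (mul_le_mul' le_rfl (mul_le_mul' le_rfl (tsum_enorm_coef_le α u)))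
  refine (mul_le_mul' le_rfl (add_le_add z1 z2)).trans (le_of_eq ?_)
  change 2 * c ^ 2 * (4 ^ 2 * (sobSq s u * (wtSum α * sobSq α v))
    + 4 ^ 2 * (sobSq s v * (wtSum α * sobSq α u))) = _
  ring

/-! ### Weighted coordinates

A field `u ∈ V_α` is represented by `a = A^{α/2} u ∈ H`. -/

theorem rpow_norm_kvec_le_one {s : ℝ} (hs : s ≤ 0) (k : ZStar) : |‖kvec k‖ ^ s| ≤ 1 := by
  rw [abs_of_nonneg (by positivity)]
  exact Real.rpow_le_one_of_one_le_of_nonpos (one_le_norm_kvec k) hs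

/-- The operator `A^{-α/2}`. -/
def lift (α : ℝ) : H →L[ℝ] H := diag fun k => ‖kvec k‖ ^ (-α)

theorem coef_lift {α : ℝ} (hα : 0 ≤ α) (a : H) (k : ZStar) :
    coef (lift α a) k = ‖kvec k‖ ^ (-α) • coef a k :=
  coef_diag (rpow_norm_kvec_le_one (by linarith)) a k

theorem enorm_coef_lift {α : ℝ} (hα : 0 ≤ α) (a : H) (k : ZStar) :
    ‖coef (lift α a) k‖ₑ = wt (-α) k * ‖coef a k‖ₑ := by
  rw [coef_lift hα, enorm_smul, wt, ← ofReal_norm, Real.norm_of_nonneg (by positivity)]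

theorem sobSq_lift {α : ℝ} (hα : 0 ≤ α) (s : ℝ) (a : H) : sobSq s (lift α a) = sobSq (s - α) a := by
  unfold sobSq
  refine tsum_congr fun k => ?_
  rw [enorm_coef_lift hα, ← mul_assoc, ← wt_add, ← sub_eq_add_neg]

theorem sobSq_zero (a : H) : sobSq 0 a = ‖a‖ₑ ^ 2 := by
  rw [← tsum_enorm_coef_sq, sobSq]
  simp [wt_zero]

/-- The constant in the product estimate. -/
def bilinConst (α s : ℝ) : ℝ≥0∞ := 64 * ENNReal.ofReal (2 ^ s) ^ 2 * wtSum α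

theorem bilinConst_ne_top {α : ℝ} (hα : 3 / 2 < α) (s : ℝ) : bilinConst α s ≠ ⊤ :=
  ENNReal.mul_ne_top (ENNReal.mul_ne_top (by norm_num) (ENNReal.pow_ne_top ENNReal.ofReal_ne_top))
    (wtSum_ne_top hα)

theorem tsum_bcoef_lift_le {α : ℝ} (hα : 0 ≤ α) (a b : H) :
    ∑' k, ‖‖kvec k‖ ^ (α - 1) • bcoef k (lift α a) (lift α b)‖ₑ ^ 2 ≤
      bilinConst α α * (‖a‖ₑ ^ 2 * ‖b‖ₑ ^ 2) := by
  have h := tsum_bcoef_le hα α (lift α a) (lift α b)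
  simp only [sobSq_lift hα, sub_self, sobSq_zero] at h
  have e1 : ∀ k, ‖‖kvec k‖ ^ (α - 1) • bcoef k (lift α a) (lift α b)‖ₑ
      = wt (α - 1) k * ‖bcoef k (lift α a) (lift α b)‖ₑ := by
    intro k
    rw [enorm_smul, wt, ← ofReal_norm, Real.norm_of_nonneg (by positivity)]
  simp only [e1]
  refine h.trans (le_of_eq ?_)
  unfold bilinConst
  ring

theorem exists_bilin {α : ℝ} (hα : 3 / 2 < α) (a b : H) :
    ∃ c : H, ∀ k, coef c k = ‖kvec k‖ ^ (α - 1) • bcoef k (lift α a) (lift α b) := by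
  refine exists_coef_eq_of_tsum _ (fun k => Submodule.smul_mem _ _ (bcoef_mem _ _ _)) ?_
  refine ne_top_of_le_ne_top ?_ (tsum_bcoef_lift_le (by linarith) a b)
  exact ENNReal.mul_ne_top (bilinConst_ne_top hα α)
    (ENNReal.mul_ne_top (ENNReal.pow_ne_top enorm_ne_top) (ENNReal.pow_ne_top enorm_ne_top))

/-- The field with coefficients `|k|^{α-1} B(A^{-α/2} a, A^{-α/2} b)_k`. -/
def bilinFun {α : ℝ} (hα : 3 / 2 < α) (a b : H) : H := (exists_bilin hα a b).choose

theorem coef_bilinFun {α : ℝ} (hα : 3 / 2 < α) (a b : H) (k : ZStar) :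
    coef (bilinFun hα a b) k = ‖kvec k‖ ^ (α - 1) • bcoef k (lift α a) (lift α b) :=
  (exists_bilin hα a b).choose_spec k

theorem norm_bilinFun_le {α : ℝ} (hα : 3 / 2 < α) (a b : H) :
    ‖bilinFun hα a b‖ ≤ Real.sqrt (bilinConst α α).toReal * ‖a‖ * ‖b‖ := by
  have h := tsum_bcoef_lift_le (α := α) (by linarith) a b
  simp only [← coef_bilinFun hα] at h
  rw [tsum_enorm_coef_sq] at h
  have h2 := ENNReal.toReal_mono (ENNReal.mul_ne_top (bilinConst_ne_top hα α)
    (ENNReal.mul_ne_top (ENNReal.pow_ne_top enorm_ne_top) (ENNReal.pow_ne_top enorm_ne_top))) h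
  simp only [ENNReal.toReal_mul, ENNReal.toReal_pow, toReal_enorm] at h2
  rw [← sq_le_sq₀ (norm_nonneg _) (by positivity), mul_pow, mul_pow,
    Real.sq_sqrt ENNReal.toReal_nonneg, mul_assoc]
  exact h2

/-- The convection term in weighted coordinates: `A^{(α-1)/2} B(A^{-α/2} a, A^{-α/2} b)`. -/
def bilin {α : ℝ} (hα : 3 / 2 < α) : H →L[ℝ] H →L[ℝ] H :=
  LinearMap.mkContinuous₂
    (LinearMap.mk₂ ℝ (bilinFun hα)
      (fun a a' b => coef_injective fun k => by
        rw [coef_add, coef_bilinFun, coef_bilinFun, coef_bilinFun, map_add, map_add, add_apply,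
          smul_add])
      (fun c a b => coef_injective fun k => by
        rw [coef_smul, coef_bilinFun, coef_bilinFun, map_smul, map_smul, smul_apply, smul_comm])
      (fun a b b' => coef_injective fun k => by
        rw [coef_add, coef_bilinFun, coef_bilinFun, coef_bilinFun, map_add, map_add, smul_add])
      (fun c a b => coef_injective fun k => by
        rw [coef_smul, coef_bilinFun, coef_bilinFun, map_smul, map_smul, smul_comm]))
    (Real.sqrt (bilinConst α α).toReal) (norm_bilinFun_le hα)

theorem coef_bilin {α : ℝ} (hα : 3 / 2 < α) (a b : H) (k : ZStar) :
    coef (bilin hα a b) k = ‖kvec k‖ ^ (α - 1) • bcoef k (lift α a) (lift α b) :=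
  coef_bilinFun hα a b k

/-- By tameness the norm of order 2 enters only once. Hence a path bounded in `H` and
square-integrable in time with values in `V_2` has a nonlinear residual that can be cancelled by the
control. -/
theorem sobSq_two_bilin_le {α : ℝ} (hα : 3 / 2 < α) (a : H) :
    sobSq 2 (bilin hα a a) ≤ bilinConst α (α + 2) * (‖a‖ₑ ^ 2 * sobSq 2 a) := by
  have hα0 : 0 ≤ α := by linarith
  have h := tsum_bcoef_le (s := α + 2) (by linarith) α (lift α a) (lift α a)
  simp only [sobSq_lift hα0, sub_self, sobSq_zero, add_sub_cancel_left] at h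
  have e1 : sobSq 2 (bilin hα a a)
      = ∑' k, (wt (α + 2 - 1) k * ‖bcoef k (lift α a) (lift α a)‖ₑ) ^ 2 := by
    unfold sobSq
    refine tsum_congr fun k => ?_
    rw [coef_bilin, enorm_smul, ← ofReal_norm, Real.norm_of_nonneg (by positivity), ← wt,
      ← mul_assoc, ← wt_add]
    congr 3
    ring
  rw [e1]
  refine h.trans (le_of_eq ?_)
  unfold bilinConst
  ring

/-! ### The Stokes semigroup -/

/-- Uniformly bounded symbols that converge pointwise give strongly convergent multipliers, by
dominated convergence in Parseval's sum. -/
theorem tendsto_diag {ι : Type*} {l : Filter ι} {m : ι → ZStar → ℝ} {m₀ : ZStar → ℝ} {C : ℝ}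
    (hm : ∀ᶠ i in l, ∀ k, |m i k| ≤ C) (hm₀ : ∀ k, |m₀ k| ≤ C)
    (hlim : ∀ k, Tendsto (fun i => m i k) l (𝓝 (m₀ k))) (x : H) :
    Tendsto (fun i => diag (m i) x) l (𝓝 (diag m₀ x)) := by
  rw [tendsto_iff_norm_sub_tendsto_zero]
  have h2 : Tendsto (fun i => ∑' k, ‖m i k - m₀ k‖ ^ 2 * ‖coef x k‖ ^ 2) l
      (𝓝 (∑' k : ZStar, 0)) := by
    refine tendsto_tsum_of_dominated_convergence
      (bound := fun k => (2 * C) ^ 2 * ‖coef x k‖ ^ 2)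
      ((hasSum_norm_coef_sq x).summable.mul_left _) (fun k => ?_) ?_
    · have := ((tendsto_iff_norm_sub_tendsto_zero.1 (hlim k)).pow 2).mul_const (‖coef x k‖ ^ 2)
      simpa using this
    · filter_upwards [hm] with i hi k
      rw [Real.norm_of_nonneg (by positivity)]
      gcongr
      calc ‖m i k - m₀ k‖ ≤ ‖m i k‖ + ‖m₀ k‖ := norm_sub_le _ _
        _ ≤ C + C := add_le_add (hi k) (hm₀ k)
        _ = 2 * C := by ring
  rw [tsum_zero] at h2
  have h3 := (Real.continuous_sqrt.tendsto 0).comp h2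
  rw [Real.sqrt_zero] at h3
  refine h3.congr' ?_
  filter_upwards [hm] with i hi
  have h4 := hasSum_norm_coef_sq (diag (m i) x - diag m₀ x)
  have h5 : ∀ k, ‖coef (diag (m i) x - diag m₀ x) k‖ ^ 2 = ‖m i k - m₀ k‖ ^ 2 * ‖coef x k‖ ^ 2 := by
    intro k
    rw [coef_sub, coef_diag hi, coef_diag hm₀, ← sub_smul, norm_smul, mul_pow]
  simp only [h5] at h4
  rw [Function.comp_apply, h4.tsum_eq, Real.sqrt_sq (norm_nonneg _)]

/-- The Stokes semigroup `e^{-tA}`. -/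
def heat (t : ℝ) : H →L[ℝ] H := diag fun k => Real.exp (-(t * ‖kvec k‖ ^ 2))

/-- The operator `A^{1/2} e^{-tA}`. -/
def heatHalf (t : ℝ) : H →L[ℝ] H := diag fun k => ‖kvec k‖ * Real.exp (-(t * ‖kvec k‖ ^ 2))

theorem heat_bound {t : ℝ} (ht : 0 ≤ t) (k : ZStar) : |Real.exp (-(t * ‖kvec k‖ ^ 2))| ≤ 1 := by
  rw [abs_of_nonneg (Real.exp_nonneg _), Real.exp_le_one_iff, neg_nonpos]
  positivity

theorem coef_heat {t : ℝ} (ht : 0 ≤ t) (x : H) (k : ZStar) :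
    coef (heat t x) k = Real.exp (-(t * ‖kvec k‖ ^ 2)) • coef x k := coef_diag (heat_bound ht) x k

theorem norm_heat_le {t : ℝ} (ht : 0 ≤ t) : ‖heat t‖ ≤ 1 := norm_diag_le (heat_bound ht)

theorem heat_zero (x : H) : heat 0 x = x :=
  coef_injective fun k => by rw [coef_heat le_rfl]; simp

theorem continuousOn_heat (x : H) : ContinuousOn (fun t => heat t x) (Ici 0) := by
  intro t ht
  refine tendsto_diag (C := 1) ?_ (heat_bound ht) (fun k => ?_) x
  · filter_upwards [self_mem_nhdsWithin] with s hs using heat_bound hs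
  · exact (Continuous.tendsto (by fun_prop) t).mono_left nhdsWithin_le_nhds

theorem heatHalf_bound {t : ℝ} (ht : 0 < t) (k : ZStar) :
    |‖kvec k‖ * Real.exp (-(t * ‖kvec k‖ ^ 2))| ≤ t ^ (-(1 / 2) : ℝ) := by
  set n := ‖kvec k‖
  have hn : 0 < n := norm_kvec_pos k
  rw [abs_of_nonneg (by positivity), Real.exp_neg, Real.rpow_neg ht.le, ← Real.sqrt_eq_rpow,
    ← div_eq_mul_inv, div_le_iff₀ (Real.exp_pos _), inv_mul_eq_div, le_div_iff₀ (Real.sqrt_pos.2 ht)]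
  have h1 := Real.add_one_le_exp (t * n ^ 2)
  have h2 : (n * Real.sqrt t) ^ 2 = t * n ^ 2 := by
    rw [mul_pow, Real.sq_sqrt ht.le]
    ring
  -- With `x = n √t`, the claim is `x ≤ exp (x²)`, which follows from `2 x ≤ 1 + x² ≤ exp (x²)`.
  nlinarith [sq_nonneg (n * Real.sqrt t - 1)]

theorem coef_heatHalf {t : ℝ} (ht : 0 < t) (x : H) (k : ZStar) :
    coef (heatHalf t x) k = (‖kvec k‖ * Real.exp (-(t * ‖kvec k‖ ^ 2))) • coef x k :=
  coef_diag (heatHalf_bound ht) x k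

theorem norm_heatHalf_le {t : ℝ} (ht : 0 < t) : ‖heatHalf t‖ ≤ t ^ (-(1 / 2) : ℝ) :=
  norm_diag_le (heatHalf_bound ht)

theorem continuousOn_heatHalf (x : H) : ContinuousOn (fun t => heatHalf t x) (Ioi 0) := by
  intro t ht
  have ht' : 0 < t := ht
  have hmono : ∀ s, t / 2 ≤ s → s ^ (-(1 / 2) : ℝ) ≤ (t / 2) ^ (-(1 / 2) : ℝ) := fun s hs =>
    Real.rpow_le_rpow_of_nonpos (by linarith) hs (by norm_num)
  refine tendsto_diag (C := (t / 2) ^ (-(1 / 2) : ℝ)) ?_ (fun k => ?_) (fun k => ?_) x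
  · have : ∀ᶠ s in 𝓝[Ioi 0] t, t / 2 ≤ s :=
      nhdsWithin_le_nhds (Ici_mem_nhds (by linarith))
    filter_upwards [this] with s hs k
    exact (heatHalf_bound (by linarith) k).trans (hmono s hs)
  · exact (heatHalf_bound ht' k).trans (hmono t (by linarith))
  · exact (Continuous.tendsto (by fun_prop) t).mono_left nhdsWithin_le_nhds

/-! ### Mild solutions of semilinear equations with a singular kernel -/

section Mild

variable {E : Type*} [NormedAddCommGroup E] [NormedSpace ℝ E]

theorem continuousOn_kernel_apply {K : ℝ → E →L[ℝ] E}
    (hKc : ∀ x, ContinuousOn (fun r => K r x) (Ioi 0))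
    (hKn : ∀ r, 0 < r → ‖K r‖ ≤ r ^ (-(1 / 2) : ℝ)) {g : ℝ → E} (hg : Continuous g) :
    ContinuousOn (fun r => K r (g r)) (Ioi 0) := by
  intro r₀ hr₀
  have hr₀' : 0 < r₀ := hr₀
  have h1 : Tendsto (fun r => K r (g r - g r₀)) (𝓝[Ioi 0] r₀) (𝓝 0) := by
    have hb : Tendsto (fun r => (r₀ / 2) ^ (-(1 / 2) : ℝ) * ‖g r - g r₀‖) (𝓝[Ioi 0] r₀) (𝓝 0) := by
      have : Tendsto (fun r => ‖g r - g r₀‖) (𝓝[Ioi 0] r₀) (𝓝 0) :=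
        (tendsto_iff_norm_sub_tendsto_zero.1 (hg.tendsto r₀)).mono_left nhdsWithin_le_nhds
      simpa using this.const_mul ((r₀ / 2) ^ (-(1 / 2) : ℝ))
    refine squeeze_zero_norm' ?_ hb
    have : ∀ᶠ s in 𝓝[Ioi 0] r₀, r₀ / 2 ≤ s := nhdsWithin_le_nhds (Ici_mem_nhds (by linarith))
    filter_upwards [this] with r hr
    refine (K r).le_of_opNorm_le ((hKn r (by linarith)).trans ?_) _
    exact Real.rpow_le_rpow_of_nonpos (by linarith) hr (by norm_num)
  have h2 := h1.add (hKc (g r₀) r₀ hr₀)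
  simpa [ContinuousWithinAt] using h2

theorem integral_rpow_neg_half {t : ℝ} :
    ∫ r in (0 : ℝ)..t, r ^ (-(1 / 2) : ℝ) = 2 * Real.sqrt t := by
  rw [integral_rpow (Or.inl (by norm_num)), Real.sqrt_eq_rpow]
  norm_num
  ring

theorem norm_kernel_apply_le {K : ℝ → E →L[ℝ] E}
    (hKn : ∀ r, 0 < r → ‖K r‖ ≤ r ^ (-(1 / 2) : ℝ)) {M : ℝ} {r : ℝ} (hr : 0 < r) {x : E}
    (hx : ‖x‖ ≤ M) : ‖K r x‖ ≤ M * r ^ (-(1 / 2) : ℝ) := by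
  refine ((K r).le_of_opNorm_le (hKn r hr) x).trans ?_
  rw [mul_comm]
  gcongr

theorem norm_integral_kernel_le {K : ℝ → E →L[ℝ] E}
    (hKn : ∀ r, 0 < r → ‖K r‖ ≤ r ^ (-(1 / 2) : ℝ)) {g : ℝ → E} {M t : ℝ} (ht : 0 ≤ t)
    (hg : ∀ r, ‖g r‖ ≤ M) : ‖∫ r in (0 : ℝ)..t, K r (g r)‖ ≤ M * (2 * Real.sqrt t) := by
  have hi : IntervalIntegrable (fun r : ℝ => M * r ^ (-(1 / 2) : ℝ)) volume 0 t :=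
    (intervalIntegral.intervalIntegrable_rpow' (by norm_num)).const_mul M
  have := intervalIntegral.norm_integral_le_of_norm_le (f := fun r => K r (g r)) ht
    (Eventually.of_forall fun r hr => norm_kernel_apply_le hKn hr.1 (hg r)) hi
  rwa [intervalIntegral.integral_const_mul, integral_rpow_neg_half] at this

theorem intervalIntegrable_kernel {K : ℝ → E →L[ℝ] E}
    (hKc : ∀ x, ContinuousOn (fun r => K r x) (Ioi 0))
    (hKn : ∀ r, 0 < r → ‖K r‖ ≤ r ^ (-(1 / 2) : ℝ)) {g : ℝ → E} {M t : ℝ} (ht : 0 ≤ t)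
    (hgc : Continuous g) (hg : ∀ r, ‖g r‖ ≤ M) :
    IntervalIntegrable (fun r => K r (g r)) volume 0 t := by
  have hi : IntervalIntegrable (fun r : ℝ => M * r ^ (-(1 / 2) : ℝ)) volume 0 t :=
    (intervalIntegral.intervalIntegrable_rpow' (by norm_num)).const_mul M
  rw [intervalIntegrable_iff_integrableOn_Ioc_of_le ht] at hi ⊢
  refine hi.mono' ?_ ?_
  · exact ((continuousOn_kernel_apply hKc hKn hgc).mono Ioc_subset_Ioi_self).aestronglyMeasurable
      measurableSet_Ioc
  · exact (ae_restrict_iff' measurableSet_Ioc).2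
      (Eventually.of_forall fun r hr => norm_kernel_apply_le hKn hr.1 (hg r))

/-- The moving endpoint is turned into an indicator on a fixed interval. Dominated convergence
applies with the integrable bound `M r^(-1/2)`; the indicator is discontinuous in `t` at `t₀` only
for the single value `r = t₀`. -/
theorem continuousOn_integral_kernel {K : ℝ → E →L[ℝ] E}
    (hKc : ∀ x, ContinuousOn (fun r => K r x) (Ioi 0))
    (hKn : ∀ r, 0 < r → ‖K r‖ ≤ r ^ (-(1 / 2) : ℝ)) {g : ℝ → E} {M τ : ℝ}
    (hgc : Continuous g) (hg : ∀ r, ‖g r‖ ≤ M) :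
    ContinuousOn (fun t => ∫ r in (0 : ℝ)..t, K r (g (t - r))) (Icc 0 τ) := by
  classical
  intro t₀ ht₀
  have hτ : 0 ≤ τ := ht₀.1.trans ht₀.2
  set F : ℝ → ℝ → E := fun t => (Iio t).indicator fun r => K r (g (t - r)) with hF
  have hM : 0 ≤ M := (norm_nonneg _).trans (hg 0)
  have key : ContinuousWithinAt (fun t => ∫ r in Ioc 0 τ, F t r) (Icc 0 τ) t₀ := by
    refine continuousWithinAt_of_dominated (bound := fun r => M * r ^ (-(1 / 2) : ℝ)) ?_ ?_ ?_ ?_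
    · refine Eventually.of_forall fun t => ?_
      refine AEStronglyMeasurable.indicator ?_ measurableSet_Iio
      exact ((continuousOn_kernel_apply hKc hKn (g := fun r => g (t - r)) (by fun_prop)).mono
        Ioc_subset_Ioi_self).aestronglyMeasurable measurableSet_Ioc
    · refine Eventually.of_forall fun t => (ae_restrict_iff' measurableSet_Ioc).2
        (Eventually.of_forall fun r hr => ?_)
      refine (norm_indicator_le_norm_self _ _).trans ?_
      exact norm_kernel_apply_le hKn hr.1 (hg _)
    · have : IntervalIntegrable (fun r : ℝ => M * r ^ (-(1 / 2) : ℝ)) volume 0 τ :=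
        (intervalIntegral.intervalIntegrable_rpow' (by norm_num)).const_mul M
      rwa [intervalIntegrable_iff_integrableOn_Ioc_of_le hτ] at this
    · have h0 : ∀ᵐ r ∂(volume.restrict (Ioc 0 τ)), r ≠ t₀ := by
        refine ae_restrict_of_ae ?_
        simp [ae_iff]
      filter_upwards [h0] with r hr
      refine ContinuousAt.continuousWithinAt ?_
      rcases lt_or_gt_of_ne hr with h | h
      · have : (fun t => K r (g (t - r))) =ᶠ[𝓝 t₀] fun t => F t r := by
          filter_upwards [Ioi_mem_nhds h] with t ht
          simp only [hF]
          rw [indicator_of_mem (by exact ht)]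
        refine ContinuousAt.congr ?_ this
        exact ((K r).continuous.comp (hgc.comp (continuous_sub_right r))).continuousAt
      · have : (fun _ => (0 : E)) =ᶠ[𝓝 t₀] fun t => F t r := by
          filter_upwards [Iio_mem_nhds h] with t ht
          simp only [hF]
          rw [indicator_of_notMem]
          exact not_lt.2 (le_of_lt (mem_Iio.1 ht))
        exact continuousAt_const.congr this
  have heq : ∀ t ∈ Icc 0 τ, ∫ r in (0 : ℝ)..t, K r (g (t - r)) = ∫ r in Ioc 0 τ, F t r := by
    intro t ht
    rw [intervalIntegral.integral_of_le ht.1, integral_Ioc_eq_integral_Ioo, hF,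
      setIntegral_indicator measurableSet_Iio]
    congr 2
    ext r
    simp only [mem_Ioo, mem_inter_iff, mem_Ioc, mem_Iio]
    constructor
    · rintro ⟨h1, h2⟩
      exact ⟨⟨h1, h2.le.trans ht.2⟩, h2⟩
    · rintro ⟨⟨h1, -⟩, h2⟩
      exact ⟨h1, h2⟩
  exact key.congr heq (heq t₀ ht₀)

variable [CompleteSpace E]

/-- A fixed point of the Duhamel map in a ball of `C([0,τ];E)`. The singularity `r^(-1/2)` of the
kernel is integrable and contributes a factor `2 √τ`. What matters later is that `τ` depends on the
size `R` of the data and not on the datum `x`. -/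
theorem exists_mild {S K : ℝ → E →L[ℝ] E} (hSc : ∀ x, ContinuousOn (fun t => S t x) (Ici 0))
    (hSn : ∀ t, 0 ≤ t → ‖S t‖ ≤ 1) (hKc : ∀ x, ContinuousOn (fun r => K r x) (Ioi 0))
    (hKn : ∀ r, 0 < r → ‖K r‖ ≤ r ^ (-(1 / 2) : ℝ)) (B : E →L[ℝ] E →L[ℝ] E) {R : ℝ} (hR : 0 ≤ R) :
    ∃ τ > 0, ∀ x : E, ‖x‖ ≤ R → ∃ a : ℝ → E, Continuous a ∧ (∀ t, ‖a t‖ ≤ R + 1) ∧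
      ∀ t ∈ Icc 0 τ, a t = S t x + ∫ r in (0 : ℝ)..t, K r (B (a (t - r)) (a (t - r))) := by
  set ρ := R + 1 with hρ
  have hρ1 : 1 ≤ ρ := by linarith
  -- With `√τ = 1/c` the integral term is at most `1/4` on the ball of radius `ρ`, and the Lipschitz
  -- constant of the map is at most `1/2`.
  set c := 8 * (‖B‖ + 1) * ρ ^ 2 with hc
  have hB0 : 0 ≤ ‖B‖ := norm_nonneg B
  have hc0 : 0 < c := by positivity
  set τ := (1 / c) ^ 2 with hτ
  have hτ0 : 0 < τ := by positivity
  have hsq : Real.sqrt τ = 1 / c := Real.sqrt_sq (by positivity)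
  refine ⟨τ, hτ0, fun x hx => ?_⟩
  set ext : C(Icc (0 : ℝ) τ, E) → ℝ → E := fun a => IccExtend hτ0.le a with hext
  have hextc : ∀ a, Continuous (ext a) := fun a => a.continuous.Icc_extend'
  have hextn : ∀ a t, ‖ext a t‖ ≤ ‖a‖ := fun a t => a.norm_coe_le_norm _
  have hBn : ∀ u v : E, ‖B u v‖ ≤ ‖B‖ * ‖u‖ * ‖v‖ := B.le_opNorm₂
  set G : C(Icc (0 : ℝ) τ, E) → ℝ → E := fun a t => B (ext a t) (ext a t) with hG
  have hGc : ∀ a, Continuous (G a) := fun a =>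
    (B.continuous.comp (hextc a)).clm_apply (hextc a)
  have hGn : ∀ a t, ‖G a t‖ ≤ ‖B‖ * ‖a‖ ^ 2 := by
    intro a t
    refine (hBn _ _).trans ?_
    rw [sq, ← mul_assoc]
    gcongr
    · exact hextn a t
    · exact hextn a t
  have hGd : ∀ a b t, ‖G a t - G b t‖ ≤ ‖B‖ * (‖a‖ + ‖b‖) * ‖a - b‖ := by
    intro a b t
    have h1 : G a t - G b t = B (ext a t) (ext (a - b) t) + B (ext (a - b) t) (ext b t) := by
      have : ext (a - b) t = ext a t - ext b t := rfl
      simp only [hG, this, map_sub, sub_apply]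
      abel
    rw [h1]
    refine (norm_add_le _ _).trans ?_
    calc ‖B (ext a t) (ext (a - b) t)‖ + ‖B (ext (a - b) t) (ext b t)‖
        ≤ ‖B‖ * ‖a‖ * ‖a - b‖ + ‖B‖ * ‖a - b‖ * ‖b‖ := by
          refine add_le_add ((hBn _ _).trans ?_) ((hBn _ _).trans ?_)
          · gcongr
            · exact hextn a t
            · exact hextn (a - b) t
          · gcongr
            · exact hextn (a - b) t
            · exact hextn b t
      _ = _ := by ring
  set Φ : C(Icc (0 : ℝ) τ, E) → C(Icc (0 : ℝ) τ, E) := fun a =>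
    ⟨fun t => S t x + ∫ r in (0 : ℝ)..t, K r (G a (t - r)), by
      have h1 : ContinuousOn (fun t : ℝ => S t x + ∫ r in (0 : ℝ)..t, K r (G a (t - r)))
          (Icc 0 τ) :=
        ((hSc x).mono Icc_subset_Ici_self).add
          (continuousOn_integral_kernel hKc hKn (hGc a) (hGn a))
      exact h1.domRestrict⟩ with hΦ
  have hΦa : ∀ a t, Φ a t = S t x + ∫ r in (0 : ℝ)..t, K r (G a (t - r)) := fun _ _ => rfl
  have hst : ∀ t : Icc (0 : ℝ) τ, Real.sqrt t ≤ 1 / c := fun t => by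
    rw [← hsq]
    exact Real.sqrt_le_sqrt t.2.2
  have hmaps : MapsTo Φ (Metric.closedBall 0 ρ) (Metric.closedBall 0 ρ) := by
    intro a ha
    rw [mem_closedBall_zero_iff] at ha ⊢
    rw [ContinuousMap.norm_le _ (by linarith)]
    intro t
    rw [hΦa]
    refine (norm_add_le _ _).trans ?_
    have h1 : ‖S t x‖ ≤ R := by
      refine ((S t).le_of_opNorm_le (hSn t t.2.1) x).trans ?_
      rwa [one_mul]
    have h2 := norm_integral_kernel_le (K := K) hKn (g := fun r => G a (t - r)) t.2.1
      (fun r => hGn a _)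
    have h3 : ‖B‖ * ‖a‖ ^ 2 * (2 * Real.sqrt t) ≤ 1 := by
      calc ‖B‖ * ‖a‖ ^ 2 * (2 * Real.sqrt t) ≤ (‖B‖ + 1) * ρ ^ 2 * (2 * (1 / c)) := by
            gcongr
            · linarith
            · exact hst t
        _ = 1 / 4 := by
            rw [hc]
            field_simp
            norm_num
        _ ≤ 1 := by norm_num
    linarith
  have hcontr : ContractingWith (1 / 2) (hmaps.restrict Φ _ _) := by
    refine ⟨by norm_num, LipschitzWith.of_dist_le_mul fun a b => ?_⟩
    have ha := mem_closedBall_zero_iff.1 a.2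
    have hb := mem_closedBall_zero_iff.1 b.2
    rw [Subtype.dist_eq, Subtype.dist_eq, dist_eq_norm, dist_eq_norm,
      ContinuousMap.norm_le _ (by positivity)]
    intro t
    have h1 : (Φ a - Φ b) t = ∫ r in (0 : ℝ)..t, K r (G a (t - r) - G b (t - r)) := by
      rw [ContinuousMap.sub_apply, hΦa, hΦa, add_sub_add_left_eq_sub,
        ← intervalIntegral.integral_sub]
      · simp
      · exact intervalIntegrable_kernel hKc hKn t.2.1 (g := fun r => G a (t - r))
          ((hGc a).comp (continuous_const.sub continuous_id)) (fun r => hGn a _)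
      · exact intervalIntegrable_kernel hKc hKn t.2.1 (g := fun r => G b (t - r))
          ((hGc b).comp (continuous_const.sub continuous_id)) (fun r => hGn b _)
    simp only [MapsTo.val_restrict_apply]
    rw [h1]
    refine (norm_integral_kernel_le hKn t.2.1 (fun r => hGd a b _)).trans ?_
    calc ‖B‖ * (‖a.1‖ + ‖b.1‖) * ‖a.1 - b.1‖ * (2 * Real.sqrt t)
        ≤ (‖B‖ + 1) * (ρ ^ 2 + ρ ^ 2) * ‖a.1 - b.1‖ * (2 * (1 / c)) := by
          have : ρ ≤ ρ ^ 2 := by nlinarith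
          gcongr
          · linarith
          · linarith
          · linarith
          · exact hst t
      _ = ((1 / 2 : NNReal) : ℝ) * ‖a.1 - b.1‖ := by
          rw [hc]
          push_cast
          field_simp
          ring
  obtain ⟨a, ha, hfix, -⟩ := hcontr.exists_fixedPoint' Metric.isClosed_closedBall.isComplete hmaps
    (x := 0) (by simp; linarith) (edist_ne_top _ _)
  rw [mem_closedBall_zero_iff] at ha
  refine ⟨ext a, hextc a, fun t => (hextn a t).trans ha, fun t ht => ?_⟩
  have h1 := congrArg (fun f : C(Icc (0 : ℝ) τ, E) => f ⟨t, ht⟩) hfix.symm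
  simp only [hΦa] at h1
  rw [← h1]
  exact IccExtend_of_mem _ _ ht

end Mild

/-! ### Controlled paths -/

/-- The frequencies `|k|_∞ ≤ N` on which the noise does not act. -/
def IsLow (N : ℕ) (k : ZStar) : Prop := ∀ i, |k.1 i| ≤ (N : ℤ)

theorem mem_highModes_iff {N : ℕ} {v : H} : v ∈ highModes N ↔ ∀ k, IsLow N k → coef v k = 0 := by
  constructor
  · intro hv k hk
    have h := (Submodule.mem_orthogonal' _ v).1 hv (mode k ⟨coef v k, coef_mem v k⟩)
      (Submodule.subset_span ⟨k, _, hk, rfl⟩)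
    rw [inner_mode] at h
    exact inner_self_eq_zero.1 h
  · intro h
    rw [highModes, lowModes, Submodule.mem_orthogonal']
    intro u hu
    induction hu using Submodule.span_induction with
    | mem u hu =>
      obtain ⟨k, y, hk, rfl⟩ := hu
      rw [inner_mode, h k hk, inner_zero_left]
    | zero => exact inner_zero_right _
    | add u u' _ _ hu hu' => rw [inner_add_right, hu, hu', add_zero]
    | smul c u _ hu => rw [inner_smul_right, hu, mul_zero]

/-- Here `L` is the inverse of `A^{α₀+3/4} Q` on the high modes, extended by the orthogonal
projection so that it is bounded on all of `H`. The exponent is `2 (α₀ + 3/4) = α + 1`: of these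
powers `α` belong to the weighted coordinates, and the residual has to supply the remaining one. -/
theorem exists_control_operator {α₀ : ℝ} {N₀ : ℕ} {Q : H →L[ℝ] H} (hQ : NoiseAssumption α₀ N₀ Q) :
    ∃ L : H →L[ℝ] H, ∀ F : H, (∀ k, IsLow N₀ k → coef F k = 0) → ∀ k,
      coef F k = ‖kvec k‖ ^ (2 * α₀ + 1 / 2 + 1) • coef (Q (L F)) k := by
  obtain ⟨R, hR⟩ := hQ.regular
  have : CompleteSpace (highModes N₀) := by
    unfold highModes
    infer_instance
  refine ⟨(highModes N₀).subtypeL.comp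
    ((R.symm : highModes N₀ →L[ℝ] highModes N₀).comp (highModes N₀).orthogonalProjectionOnto),
    fun F hF k => ?_⟩
  have hmem : F ∈ highModes N₀ := mem_highModes_iff.2 hF
  have h1 : (highModes N₀).orthogonalProjectionOnto F = ⟨F, hmem⟩ :=
    Submodule.orthogonalProjectionOnto_mem_subspace_eq_self (⟨F, hmem⟩ : highModes N₀)
  have h := hR (R.symm ⟨F, hmem⟩) k
  rw [ContinuousLinearEquiv.apply_symm_apply] at h
  simp only [ContinuousLinearMap.comp_apply, ContinuousLinearEquiv.coe_coe, h1,
    Submodule.subtypeL_apply]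
  rw [show 2 * α₀ + 1 / 2 + 1 = 2 * (α₀ + 3 / 4) by ring]
  exact h

/-- The right-hand side of the equation for the `k`-th weighted coefficient. -/
def modeRhs {α : ℝ} (hα : 3 / 2 < α) (k : ZStar) (a f : H) : E3 :=
  -(‖kvec k‖ ^ 2 • coef a k) - ‖kvec k‖ • coef (bilin hα a a) k + ‖kvec k‖ ^ α • coef f k

/-- `a` is, in weighted coordinates, a solution on `[s,t]` with control `w`. -/
structure IsControlled {α : ℝ} (hα : 3 / 2 < α) (Q : H →L[ℝ] H) (s t : ℝ) (a w : ℝ → H) :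
    Prop where
  memLp : MemLp w 2 (volume.restrict (Icc s t))
  continuousOn : ContinuousOn a (Icc s t)
  eq : ∀ k, ∀ r ∈ Icc s t,
    coef (a r) k - coef (a s) k = ∫ σ in s..r, modeRhs hα k (a σ) (Q (w σ))

theorem continuous_bilin_self {α : ℝ} (hα : 3 / 2 < α) : Continuous fun a : H => bilin hα a a :=
  (bilin hα).continuous.clm_apply continuous_id

theorem continuous_coef (k : ZStar) : Continuous fun a : H => coef a k := (coefL k).continuous

theorem integrableOn_modeRhs {α : ℝ} (hα : 3 / 2 < α) {Q : H →L[ℝ] H} {s t : ℝ} {a w : ℝ → H}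
    (hw : MemLp w 2 (volume.restrict (Icc s t))) (ha : ContinuousOn a (Icc s t)) (k : ZStar) :
    IntegrableOn (fun σ => modeRhs hα k (a σ) (Q (w σ))) (Icc s t) := by
  unfold modeRhs
  have h1 : ContinuousOn (fun σ => -(‖kvec k‖ ^ 2 • coef (a σ) k)
      - ‖kvec k‖ • coef (bilin hα (a σ) (a σ)) k) (Icc s t) := by
    have c1 : ContinuousOn (fun σ => coef (a σ) k) (Icc s t) :=
      (continuous_coef k).comp_continuousOn ha
    have c2 : ContinuousOn (fun σ => coef (bilin hα (a σ) (a σ)) k) (Icc s t) :=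
      ((continuous_coef k).comp (continuous_bilin_self hα)).comp_continuousOn ha
    exact (c1.const_smul (‖kvec k‖ ^ 2)).neg.sub (c2.const_smul ‖kvec k‖)
  refine (h1.integrableOn_compact isCompact_Icc).add ?_
  have h2 : Integrable w (volume.restrict (Icc s t)) := hw.integrable (by norm_num)
  exact (((coefL k).comp Q).integrable_comp h2).smul (‖kvec k‖ ^ α)

/-- `y` can be reached from `x` on `[s,t]` by a controlled path bounded by `M`. -/
def Reach {α : ℝ} (hα : 3 / 2 < α) (Q : H →L[ℝ] H) (M s t : ℝ) (x y : H) : Prop :=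
  ∃ a w : ℝ → H, IsControlled hα Q s t a w ∧ a s = x ∧ a t = y ∧ ∀ σ ∈ Icc s t, ‖a σ‖ ≤ M

theorem Reach.mono {α : ℝ} {hα : 3 / 2 < α} {Q : H →L[ℝ] H} {M M' s t : ℝ} {x y : H}
    (h : Reach hα Q M s t x y) (hM : M ≤ M') : Reach hα Q M' s t x y := by
  obtain ⟨a, w, h1, h2, h3, h4⟩ := h
  exact ⟨a, w, h1, h2, h3, fun σ hσ => (h4 σ hσ).trans hM⟩

/-- Paths are concatenated. At the junction the paths agree, whereas the controls need not; the
single time `s` has measure zero. -/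
theorem Reach.trans {α : ℝ} {hα : 3 / 2 < α} {Q : H →L[ℝ] H} {M r s t : ℝ} {x y z : H}
    (hrs : r ≤ s) (hst : s ≤ t) (h : Reach hα Q M r s x y) (h' : Reach hα Q M s t y z) :
    Reach hα Q M r t x z := by
  classical
  obtain ⟨a, w, h1, h2, h3, h4⟩ := h
  obtain ⟨a', w', h1', h2', h3', h4'⟩ := h'
  set b : ℝ → H := fun σ => if σ ≤ s then a σ else a' σ with hb
  set v : ℝ → H := fun σ => if σ ≤ s then w σ else w' σ with hv
  have hb1 : EqOn b a (Icc r s) := fun σ hσ => if_pos hσ.2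
  have hb2 : EqOn b a' (Icc s t) := fun σ hσ => by
    rcases hσ.1.eq_or_lt with h | h
    · subst h
      simp only [hb, le_refl, if_true]
      rw [h3, h2']
    · exact if_neg (not_le.2 h)
  have hv1 : EqOn v w (Icc r s) := fun σ hσ => if_pos hσ.2
  have hv2 : EqOn v w' (Ioc s t) := fun σ hσ => if_neg (not_le.2 hσ.1)
  have hvm1 : MemLp v 2 (volume.restrict (Icc r s)) :=
    h1.memLp.ae_eq ((ae_restrict_iff' measurableSet_Icc).2
      (Eventually.of_forall fun σ hσ => (hv1 hσ).symm))
  have hvm2 : MemLp v 2 (volume.restrict (Icc s t)) := by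
    rw [← Measure.restrict_congr_set Ioc_ae_eq_Icc]
    have := h1'.memLp
    rw [← Measure.restrict_congr_set Ioc_ae_eq_Icc] at this
    exact this.ae_eq ((ae_restrict_iff' measurableSet_Ioc).2
      (Eventually.of_forall fun σ hσ => (hv2 hσ).symm))
  have hunion : Icc r s ∪ Icc s t = Icc r t := Icc_union_Icc_eq_Icc hrs hst
  have hbc1 : ContinuousOn b (Icc r s) := h1.continuousOn.congr hb1
  have hbc2 : ContinuousOn b (Icc s t) := h1'.continuousOn.congr hb2
  have hbc : ContinuousOn b (Icc r t) := by
    rw [← hunion]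
    exact hbc1.union_of_isClosed hbc2 isClosed_Icc isClosed_Icc
  have hvm : MemLp v 2 (volume.restrict (Icc r t)) := by
    rw [← hunion]
    have hm : AEStronglyMeasurable v (volume.restrict (Icc r s ∪ Icc s t)) :=
      (aestronglyMeasurable_union_iff).2 ⟨hvm1.1, hvm2.1⟩
    refine ⟨hm, ?_⟩
    rw [eLpNorm_lt_top_iff_lintegral_rpow_enorm_lt_top (by norm_num) (by norm_num)]
    have l1 := hvm1.2
    have l2 := hvm2.2
    rw [eLpNorm_lt_top_iff_lintegral_rpow_enorm_lt_top (by norm_num) (by norm_num)] at l1 l2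
    exact (lintegral_union_le _ _ _).trans_lt (ENNReal.add_lt_top.2 ⟨l1, l2⟩)
  refine ⟨b, v, ⟨hvm, hbc, fun k ρ hρ => ?_⟩, ?_, ?_, ?_⟩
  · have hint := integrableOn_modeRhs hα (Q := Q) hvm hbc k
    have hsub : ∀ p q, p ∈ Icc r t → q ∈ Icc r t →
        IntervalIntegrable (fun σ => modeRhs hα k (b σ) (Q (v σ))) volume p q := by
      intro p q hp hq
      refine IntegrableOn.intervalIntegrable (hint.mono_set ?_)
      exact (uIcc_subset_Icc hp hq)
    have hfirst : ∀ ρ ∈ Icc r s, coef (b ρ) k - coef (b r) k =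
        ∫ σ in r..ρ, modeRhs hα k (b σ) (Q (v σ)) := by
      intro ρ hρ
      rw [hb1 hρ, hb1 ⟨le_rfl, hrs⟩, h1.eq k ρ hρ]
      refine intervalIntegral.integral_congr fun σ hσ => ?_
      rw [uIcc_of_le hρ.1] at hσ
      have : σ ∈ Icc r s := ⟨hσ.1, hσ.2.trans hρ.2⟩
      simp only [hb1 this, hv1 this]
    rcases le_total ρ s with h | h
    · exact hfirst ρ ⟨hρ.1, h⟩
    · have hρ' : ρ ∈ Icc s t := ⟨h, hρ.2⟩
      have e1 := hfirst s ⟨hrs, le_rfl⟩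
      have e2 : coef (b ρ) k - coef (b s) k =
          ∫ σ in s..ρ, modeRhs hα k (b σ) (Q (v σ)) := by
        rw [hb2 hρ', hb2 ⟨le_rfl, hst⟩, h1'.eq k ρ hρ']
        refine intervalIntegral.integral_congr_ae (Eventually.of_forall fun σ hσ => ?_)
        rw [uIoc_of_le h] at hσ
        have m1 : σ ∈ Icc s t := ⟨hσ.1.le, hσ.2.trans hρ.2⟩
        have m2 : σ ∈ Ioc s t := ⟨hσ.1, hσ.2.trans hρ.2⟩
        simp only [hb2 m1, hv2 m2]
      rw [← intervalIntegral.integral_add_adjacent_intervals (hsub r s ⟨le_rfl, hrs.trans hst⟩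
        ⟨hrs, hst⟩) (hsub s ρ ⟨hrs, hst⟩ hρ), ← e1, ← e2]
      abel
  · rw [hb1 ⟨le_rfl, hrs⟩, h2]
  · rw [hb2 ⟨hst, le_rfl⟩, h3']
  · intro σ hσ
    rcases le_total σ s with h | h
    · rw [hb1 ⟨hσ.1, h⟩]
      exact h4 σ ⟨hσ.1, h⟩
    · rw [hb2 ⟨h, hσ.2⟩]
      exact h4' σ ⟨h, hσ.2⟩

/-! ### Paths with a square-integrable residual are controlled -/

/-- The projection of `c` to `k^⊥`, as a mode. -/
def modeL (k : ZStar) : E3 →L[ℝ] H :=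
  (modeₗᵢ k).toContinuousLinearMap.comp (kperp k).orthogonalProjectionOnto

theorem modeL_of_mem {k : ZStar} {c : E3} (hc : c ∈ kperp k) : modeL k c = mode k ⟨c, hc⟩ := by
  have : (kperp k).orthogonalProjectionOnto c = ⟨c, hc⟩ :=
    Submodule.orthogonalProjectionOnto_mem_subspace_eq_self (⟨c, hc⟩ : kperp k)
  simp [modeL, this, modeₗᵢ_apply]

/-- The partial Fourier sums are measurable and converge to `F` at almost every time. -/
theorem aestronglyMeasurable_of_coef {μ : Measure ℝ} {F : ℝ → H} {c : ZStar → ℝ → E3}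
    (hc : ∀ k, AEStronglyMeasurable (c k) μ) (hF : ∀ᵐ σ ∂μ, ∀ k, coef (F σ) k = c k σ) :
    AEStronglyMeasurable F μ := by
  refine aestronglyMeasurable_of_tendsto_ae (atTop : Filter (Finset ZStar))
    (f := fun s σ => ∑ k ∈ s, modeL k (c k σ)) (fun s => ?_) ?_
  · exact Finset.aestronglyMeasurable_fun_sum s fun k _ =>
      (modeL k).continuous.comp_aestronglyMeasurable (hc k)
  · filter_upwards [hF] with σ hσ
    have h := hasSum_mode (F σ)
    have e1 : (fun k => mode k ⟨coef (F σ) k, coef_mem (F σ) k⟩) = fun k => modeL k (c k σ) := by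
      funext k
      rw [← hσ k, modeL_of_mem (coef_mem (F σ) k)]
    rw [e1] at h
    exact h

/-- The equation is read backwards: the residual of a given path is declared to be the forcing, and
`exists_control_operator` produces the control from it. Everything else is reduced to designing
paths. -/
theorem exists_isControlled {α₀ : ℝ} {N₀ : ℕ} {Q : H →L[ℝ] H} (hQ : NoiseAssumption α₀ N₀ Q)
    (hα : 3 / 2 < 2 * α₀ + 1 / 2) {s t : ℝ} {a : ℝ → H} {d : ZStar → ℝ → E3}
    (ha : ContinuousOn a (Icc s t)) (hd : ∀ k, ContinuousOn (d k) (Icc s t))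
    (hdm : ∀ k σ, d k σ ∈ kperp k)
    (hderiv : ∀ k, ∀ σ ∈ Icc s t,
      HasDerivWithinAt (fun σ => coef (a σ) k) (d k σ) (Icc s t) σ)
    (hlow : ∀ k, IsLow N₀ k → ∀ σ ∈ Icc s t,
      d k σ + ‖kvec k‖ ^ 2 • coef (a σ) k + ‖kvec k‖ • coef (bilin hα (a σ) (a σ)) k = 0)
    (hfin : ∫⁻ σ in Icc s t, ∑' k, (wt 1 k * ‖d k σ + ‖kvec k‖ ^ 2 • coef (a σ) k
      + ‖kvec k‖ • coef (bilin hα (a σ) (a σ)) k‖ₑ) ^ 2 ≠ ⊤) :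
    ∃ w, IsControlled hα Q s t a w := by
  classical
  set μ := (volume : Measure ℝ).restrict (Icc s t) with hμ
  set res : ZStar → ℝ → E3 := fun k σ => d k σ + ‖kvec k‖ ^ 2 • coef (a σ) k
      + ‖kvec k‖ • coef (bilin hα (a σ) (a σ)) k with hres
  have c1 : ∀ k, ContinuousOn (fun σ => coef (a σ) k) (Icc s t) := fun k =>
    (continuous_coef k).comp_continuousOn ha
  have c2 : ∀ k, ContinuousOn (fun σ => coef (bilin hα (a σ) (a σ)) k) (Icc s t) := fun k =>
    ((continuous_coef k).comp (continuous_bilin_self hα)).comp_continuousOn ha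
  have hresc : ∀ k, ContinuousOn (res k) (Icc s t) := fun k =>
    ((hd k).add ((c1 k).const_smul (‖kvec k‖ ^ 2))).add ((c2 k).const_smul ‖kvec k‖)
  have hresm : ∀ k, AEStronglyMeasurable (res k) μ := fun k =>
    (hresc k).aestronglyMeasurable measurableSet_Icc
  have hresk : ∀ k σ, res k σ ∈ kperp k := fun k σ =>
    Submodule.add_mem _ (Submodule.add_mem _ (hdm k σ) (Submodule.smul_mem _ _ (coef_mem _ _)))
      (Submodule.smul_mem _ _ (coef_mem _ _))
  have hwt : ∀ k σ, wt 1 k * ‖res k σ‖ₑ = ‖‖kvec k‖ • res k σ‖ₑ := by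
    intro k σ
    rw [enorm_smul, wt_one, enorm_norm]
  have hfin' : ∫⁻ σ, ∑' k, ‖‖kvec k‖ • res k σ‖ₑ ^ 2 ∂μ ≠ ⊤ := by
    simp only [← hwt]
    exact hfin
  have hsm : ∀ k, AEStronglyMeasurable (fun σ => ‖kvec k‖ • res k σ) μ := fun k =>
    (hresm k).const_smul ‖kvec k‖
  have hfinae : ∀ᵐ σ ∂μ, ∑' k, ‖‖kvec k‖ • res k σ‖ₑ ^ 2 ≠ ⊤ := by
    have hm : AEMeasurable (fun σ => ∑' k, ‖‖kvec k‖ • res k σ‖ₑ ^ 2) μ :=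
      AEMeasurable.tsum fun k => ((hsm k).enorm.pow_const 2)
    filter_upwards [ae_lt_top' hm hfin'] with σ hσ using hσ.ne
  -- At almost every time the residual, with one more power of `|k|`, is an element of `H`; the
  -- default value 0 is used on a null set of times.
  set F : ℝ → H := fun σ =>
    if h : ∑' k, ‖‖kvec k‖ • res k σ‖ₑ ^ 2 ≠ ⊤ then
      (exists_coef_eq_of_tsum _ (fun k => Submodule.smul_mem _ _ (hresk k σ)) h).choose
    else 0 with hF
  have hFc : ∀ᵐ σ ∂μ, ∀ k, coef (F σ) k = ‖kvec k‖ • res k σ := by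
    filter_upwards [hfinae] with σ hσ k
    simp only [hF]
    rw [dif_pos hσ]
    exact (exists_coef_eq_of_tsum _ (fun k => Submodule.smul_mem _ _ (hresk k σ)) hσ).choose_spec k
  have hFm : AEStronglyMeasurable F μ := aestronglyMeasurable_of_coef hsm hFc
  have hFL : MemLp F 2 μ := by
    refine ⟨hFm, ?_⟩
    rw [eLpNorm_lt_top_iff_lintegral_rpow_enorm_lt_top (by norm_num) (by norm_num)]
    refine lt_of_eq_of_lt (lintegral_congr_ae ?_) (lt_top_iff_ne_top.2 hfin')
    filter_upwards [hFc] with σ hσ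
    simp only [← hσ, tsum_enorm_coef_sq]
    norm_num
  obtain ⟨L, hL⟩ := exists_control_operator hQ
  refine ⟨fun σ => L (F σ), L.comp_memLp' hFL, ha, fun k r hr => ?_⟩
  have hmem : ∀ᵐ σ ∂μ, σ ∈ Icc s t := ae_restrict_mem measurableSet_Icc
  have key : ∀ᵐ σ ∂μ, d k σ = modeRhs hα k (a σ) (Q (L (F σ))) := by
    filter_upwards [hFc, hmem] with σ hσ hσm
    have h1 := hL (F σ) (fun l hl => by rw [hσ l, hres]; simp only; rw [hlow l hl σ hσm, smul_zero]) k
    -- One factor `|k|` on both sides is cancelled, which leaves the residual equal to `|k|^α` times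
    -- the coefficient of `Q w`.
    rw [hσ k, Real.rpow_add (norm_kvec_pos k), Real.rpow_one, mul_comm, mul_smul] at h1
    have h2 := smul_right_injective E3 (norm_kvec_pos k).ne' h1
    unfold modeRhs
    rw [← h2, hres]
    simp only
    abel
  have hsub : Icc s r ⊆ Icc s t := Icc_subset_Icc_right hr.2
  have hftc : ∫ σ in s..r, d k σ = coef (a r) k - coef (a s) k := by
    refine intervalIntegral.integral_eq_sub_of_hasDerivAt_of_le hr.1 ((c1 k).mono hsub)
      (fun σ hσ => ?_) ?_
    · exact (hderiv k σ ⟨hσ.1.le, hσ.2.le.trans hr.2⟩).hasDerivAt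
        (Icc_mem_nhds hσ.1 (hσ.2.trans_le hr.2))
    · refine ContinuousOn.intervalIntegrable ?_
      rw [uIcc_of_le hr.1]
      exact (hd k).mono hsub
  rw [← hftc]
  refine intervalIntegral.integral_congr_ae ?_
  rw [hμ, ae_restrict_iff' measurableSet_Icc] at key
  filter_upwards [key] with σ hσ hσm
  rw [uIoc_of_le hr.1] at hσm
  exact hσ ⟨hσm.1.le, hσm.2.trans hr.2⟩

/-- The linear and the nonlinear residual are estimated separately, the latter by
`sobSq_two_bilin_le`. The separation is made on the high modes only, since on the low ones the whole
residual is zero. -/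
theorem exists_isControlled_of_sobSq {α₀ : ℝ} {N₀ : ℕ} {Q : H →L[ℝ] H}
    (hQ : NoiseAssumption α₀ N₀ Q)
    (hα : 3 / 2 < 2 * α₀ + 1 / 2) {s t : ℝ} {a : ℝ → H} {d : ZStar → ℝ → E3}
    (ha : ContinuousOn a (Icc s t)) (hd : ∀ k, ContinuousOn (d k) (Icc s t))
    (hdm : ∀ k σ, d k σ ∈ kperp k)
    (hderiv : ∀ k, ∀ σ ∈ Icc s t,
      HasDerivWithinAt (fun σ => coef (a σ) k) (d k σ) (Icc s t) σ)
    (hlow : ∀ k, IsLow N₀ k → ∀ σ ∈ Icc s t,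
      d k σ + ‖kvec k‖ ^ 2 • coef (a σ) k + ‖kvec k‖ • coef (bilin hα (a σ) (a σ)) k = 0)
    {C : ℝ≥0∞} (hC : C ≠ ⊤)
    (hlin : ∀ σ ∈ Icc s t, ∑' k : {k // ¬ IsLow N₀ k},
      (wt 1 k * ‖d k σ + ‖kvec k.1‖ ^ 2 • coef (a σ) k‖ₑ) ^ 2 ≤ C)
    (hsob : ∫⁻ σ in Icc s t, sobSq 2 (a σ) ≠ ⊤) :
    ∃ w, IsControlled hα Q s t a w := by
  classical
  refine exists_isControlled hQ hα ha hd hdm hderiv hlow ?_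
  obtain ⟨M, hM⟩ := isCompact_Icc.exists_bound_of_continuousOn ha
  set D : ℝ≥0∞ := bilinConst (2 * α₀ + 1 / 2) (2 * α₀ + 1 / 2 + 2) * ENNReal.ofReal M ^ 2 with hD
  have hDt : D ≠ ⊤ := ENNReal.mul_ne_top (bilinConst_ne_top hα _)
    (ENNReal.pow_ne_top ENNReal.ofReal_ne_top)
  have hpt : ∀ σ ∈ Icc s t, ∑' k, (wt 1 k * ‖d k σ + ‖kvec k‖ ^ 2 • coef (a σ) k
      + ‖kvec k‖ • coef (bilin hα (a σ) (a σ)) k‖ₑ) ^ 2 ≤ 2 * C + 2 * D * sobSq 2 (a σ) := by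
    intro σ hσ
    set g : ZStar → ℝ≥0∞ := fun k => (wt 1 k * ‖d k σ + ‖kvec k‖ ^ 2 • coef (a σ) k
      + ‖kvec k‖ • coef (bilin hα (a σ) (a σ)) k‖ₑ) ^ 2 with hg
    have h0 : ∑' k, g k = ∑' k : {k // ¬ IsLow N₀ k}, g k := by
      refine Eq.trans ?_ (tsum_subtype {k | ¬ IsLow N₀ k} g).symm
      refine tsum_congr fun k => ?_
      by_cases hk : IsLow N₀ k
      · rw [indicator_of_notMem (by simpa using hk), hg]
        simp only
        rw [hlow k hk σ hσ]
        simp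
      · rw [indicator_of_mem (by simpa using hk)]
    have hk : ∀ k, g k ≤ 2 * ((wt 1 k * ‖d k σ + ‖kvec k‖ ^ 2 • coef (a σ) k‖ₑ) ^ 2
        + (wt 2 k * ‖coef (bilin hα (a σ) (a σ)) k‖ₑ) ^ 2) := by
      intro k
      refine le_trans ?_ (ENNReal_add_sq_le _ _)
      refine pow_le_pow_left' ?_ 2
      have h2 : wt 2 k = wt 1 k * wt 1 k := by rw [← wt_add]; norm_num
      rw [h2, mul_assoc, ← mul_add]
      refine mul_le_mul' le_rfl ((enorm_add_le _ _).trans ?_)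
      rw [enorm_smul, wt_one, enorm_norm]
    rw [h0]
    calc ∑' k : {k // ¬ IsLow N₀ k}, g k
        ≤ ∑' k : {k // ¬ IsLow N₀ k}, 2 * ((wt 1 k * ‖d k σ + ‖kvec k.1‖ ^ 2 • coef (a σ) k‖ₑ) ^ 2
          + (wt 2 k * ‖coef (bilin hα (a σ) (a σ)) k‖ₑ) ^ 2) :=
          ENNReal.tsum_le_tsum fun k => hk k
      _ ≤ 2 * (C + sobSq 2 (bilin hα (a σ) (a σ))) := by
          rw [ENNReal.tsum_mul_left, ENNReal.tsum_add]
          refine mul_le_mul' le_rfl (add_le_add (hlin σ hσ) ?_)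
          exact ENNReal.tsum_comp_le_tsum_of_injective Subtype.val_injective _
      _ ≤ 2 * (C + D * sobSq 2 (a σ)) := by
          gcongr
          refine (sobSq_two_bilin_le hα (a σ)).trans ?_
          rw [hD, mul_assoc]
          gcongr
          rw [← ofReal_norm]
          exact ENNReal.ofReal_le_ofReal (hM σ hσ)
      _ = _ := by ring
  have h1 : ∫⁻ σ in Icc s t, (2 * C + 2 * D * sobSq 2 (a σ)) ≠ ⊤ := by
    rw [lintegral_add_left measurable_const, lintegral_const_mul' _ _
      (ENNReal.mul_ne_top (by norm_num) hDt), lintegral_const]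
    refine ENNReal.add_ne_top.2 ⟨ENNReal.mul_ne_top (ENNReal.mul_ne_top (by norm_num) hC) ?_,
      ENNReal.mul_ne_top (ENNReal.mul_ne_top (by norm_num) hDt) hsob⟩
    simp
  exact ne_top_of_le_ne_top h1 (setLIntegral_mono' measurableSet_Icc hpt)

/-- A path with frequencies in a fixed finite set is controlled as soon as its low modes satisfy
the equation. -/
theorem exists_isControlled_of_finite {α₀ : ℝ} {N₀ : ℕ} {Q : H →L[ℝ] H}
    (hQ : NoiseAssumption α₀ N₀ Q)
    (hα : 3 / 2 < 2 * α₀ + 1 / 2) {s t : ℝ} {a D : ℝ → H} {S : Set ZStar} (hS : S.Finite)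
    (ha : ContinuousOn a (Icc s t)) (hD : ContinuousOn D (Icc s t))
    (hderiv : ∀ σ ∈ Icc s t, HasDerivWithinAt a (D σ) (Icc s t) σ)
    (haS : ∀ σ ∈ Icc s t, ∀ k ∉ S, coef (a σ) k = 0)
    (hDS : ∀ σ ∈ Icc s t, ∀ k ∉ S, coef (D σ) k = 0)
    (hlow : ∀ k, IsLow N₀ k → ∀ σ ∈ Icc s t, coef (D σ) k + ‖kvec k‖ ^ 2 • coef (a σ) k
      + ‖kvec k‖ • coef (bilin hα (a σ) (a σ)) k = 0) :
    ∃ w, IsControlled hα Q s t a w := by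
  classical
  obtain ⟨M, hM⟩ := isCompact_Icc.exists_bound_of_continuousOn ha
  obtain ⟨M', hM'⟩ := isCompact_Icc.exists_bound_of_continuousOn hD
  obtain ⟨n, hn⟩ := (hS.image fun k => ‖kvec k‖).bddAbove
  have hn' : ∀ k ∈ S, ‖kvec k‖ ≤ n := fun k hk => hn ⟨k, hk, rfl⟩
  have hsum : ∀ f : ZStar → ℝ≥0∞, (∀ k ∉ S, f k = 0) → ∑' k, f k = ∑ k ∈ hS.toFinset, f k :=
    fun f hf => tsum_eq_sum fun k hk => hf k (by simpa using hk)
  refine exists_isControlled_of_sobSq hQ hα (d := fun k σ => coef (D σ) k) ha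
    (fun k => (continuous_coef k).comp_continuousOn hD) (fun k σ => coef_mem _ _)
    (fun k σ hσ => ?_) hlow
    (C := ∑ k ∈ hS.toFinset, (wt 1 k * ENNReal.ofReal (M' + ‖kvec k‖ ^ 2 * M)) ^ 2)
    ?_ (fun σ hσ => ?_) ?_
  · exact ((coefL k).hasFDerivAt.comp_hasDerivWithinAt σ (hderiv σ hσ))
  · exact (ENNReal.sum_lt_top.2 fun k _ => ENNReal.pow_lt_top
      (ENNReal.mul_lt_top ENNReal.ofReal_lt_top ENNReal.ofReal_lt_top)).ne
  · refine (ENNReal.tsum_comp_le_tsum_of_injective Subtype.val_injective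
      (fun k : ZStar => (wt 1 k * ‖coef (D σ) k + ‖kvec k‖ ^ 2 • coef (a σ) k‖ₑ) ^ 2)).trans ?_
    rw [hsum _ fun k hk => by rw [haS σ hσ k hk, hDS σ hσ k hk]; simp]
    refine Finset.sum_le_sum fun k _ => ?_
    gcongr
    rw [← ofReal_norm]
    refine ENNReal.ofReal_le_ofReal ((norm_add_le _ _).trans ?_)
    rw [norm_smul, norm_pow, norm_norm]
    gcongr
    · exact (norm_coef_le _ _).trans (hM' σ hσ)
    · exact (norm_coef_le _ _).trans (hM σ hσ)
  · have : ∀ σ ∈ Icc s t, sobSq 2 (a σ) ≤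
        ∑ k ∈ hS.toFinset, (wt 2 k * ENNReal.ofReal M) ^ 2 := by
      intro σ hσ
      rw [sobSq, hsum _ fun k hk => by rw [haS σ hσ k hk]; simp]
      refine Finset.sum_le_sum fun k _ => ?_
      gcongr
      rw [← ofReal_norm]
      exact ENNReal.ofReal_le_ofReal ((norm_coef_le _ _).trans (hM σ hσ))
    refine ne_top_of_le_ne_top ?_ (setLIntegral_mono' measurableSet_Icc this)
    rw [lintegral_const]
    refine ENNReal.mul_ne_top (ENNReal.sum_lt_top.2 fun k _ => ENNReal.pow_lt_top
      (ENNReal.mul_lt_top ENNReal.ofReal_lt_top ENNReal.ofReal_lt_top)).ne ?_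
    simp

/-! ### The uncontrolled evolution and its regularization -/

theorem hasDerivAt_duhamel {V : Type*} [NormedAddCommGroup V] [NormedSpace ℝ V] [CompleteSpace V]
    {g : ℝ → V} (hg : Continuous g) (l : ℝ) (x : V) (t : ℝ) :
    HasDerivAt (fun t => Real.exp (-(t * l)) • x + ∫ r in (0 : ℝ)..t, Real.exp (-(r * l)) • g (t - r))
      (-(l • (Real.exp (-(t * l)) • x + ∫ r in (0 : ℝ)..t, Real.exp (-(r * l)) • g (t - r)))
        + g t) t := by
  -- The substitution `s = t - r` removes `t` from the integrand, after which the fundamental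
  -- theorem of calculus applies.
  have h1 : ∀ t, Real.exp (-(t * l)) • x + ∫ r in (0 : ℝ)..t, Real.exp (-(r * l)) • g (t - r)
      = Real.exp (-(t * l)) • (x + ∫ s in (0 : ℝ)..t, Real.exp (s * l) • g s) := by
    intro t
    rw [smul_add, ← intervalIntegral.integral_smul]
    congr 1
    have h2 := intervalIntegral.integral_comp_sub_left (a := 0) (b := t)
      (fun s => Real.exp (-((t - s) * l)) • g s) t
    simp only [sub_sub_cancel, sub_self, sub_zero] at h2
    rw [h2]
    refine intervalIntegral.integral_congr fun s _ => ?_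
    rw [smul_smul, ← Real.exp_add]
    congr 2
    ring
  simp only [h1]
  have hc : Continuous fun s => Real.exp (s * l) • g s := by fun_prop
  have d1 : HasDerivAt (fun t => x + ∫ s in (0 : ℝ)..t, Real.exp (s * l) • g s)
      (Real.exp (t * l) • g t) t := by
    simpa using (hc.integral_hasStrictDerivAt 0 t).hasDerivAt.const_add x
  have d2 : HasDerivAt (fun t => Real.exp (-(t * l))) (Real.exp (-(t * l)) * -(1 * l)) t :=
    (((hasDerivAt_id t).mul_const l).neg).exp
  refine (d2.fun_smul d1).congr_deriv ?_
  rw [smul_smul, ← Real.exp_add, neg_add_cancel, Real.exp_zero, one_smul, ← mul_smul, add_comm,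
    ← neg_smul]
  congr 2
  ring

/-- The derivative of `‖y‖²` is `-2 n² ‖y‖² + 2 n ⟨y, g⟩ ≤ -n² ‖y‖² + ‖g‖²`. Summed over the modes,
this gains a full derivative in `L²` in time, although the forcing itself carries a factor `n`. -/
theorem energy_estimate {V : Type*} [NormedAddCommGroup V] [InnerProductSpace ℝ V]
    {y g : ℝ → V} {n τ : ℝ} (hg : Continuous g) (hτ : 0 ≤ τ)
    (hy : ∀ t, HasDerivAt y (-(n ^ 2 • y t) + n • g t) t) :
    ∫ t in (0 : ℝ)..τ, n ^ 2 * ‖y t‖ ^ 2 ≤ ‖y 0‖ ^ 2 + ∫ t in (0 : ℝ)..τ, ‖g t‖ ^ 2 := by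
  have hyc : Continuous y := continuous_iff_continuousAt.2 fun t => (hy t).continuousAt
  have hd : ∀ t, HasDerivAt (fun t => ‖y t‖ ^ 2)
      (2 * inner ℝ (y t) (-(n ^ 2 • y t) + n • g t)) t := fun t => (hy t).norm_sq
  have hc : Continuous fun t => 2 * inner ℝ (y t) (-(n ^ 2 • y t) + n • g t) := by fun_prop
  have hftc := intervalIntegral.integral_eq_sub_of_hasDerivAt (fun t _ => hd t)
    (hc.intervalIntegrable 0 τ)
  have hle : ∀ t, n ^ 2 * ‖y t‖ ^ 2 - ‖g t‖ ^ 2 ≤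
      -(2 * inner ℝ (y t) (-(n ^ 2 • y t) + n • g t)) := by
    intro t
    have h1 : inner ℝ (y t) (-(n ^ 2 • y t) + n • g t)
        = -(n ^ 2 * ‖y t‖ ^ 2) + inner ℝ (n • y t) (g t) := by
      rw [inner_add_right, inner_neg_right, inner_smul_right, inner_smul_right,
        real_inner_self_eq_norm_sq, real_inner_smul_left]
    have h2 := real_inner_le_norm (n • y t) (g t)
    have h3 : ‖n • y t‖ ^ 2 = n ^ 2 * ‖y t‖ ^ 2 := by
      rw [norm_smul, mul_pow, Real.norm_eq_abs, sq_abs]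
    rw [h1]
    nlinarith [sq_nonneg (‖n • y t‖ - ‖g t‖)]
  have hint : ∫ t in (0 : ℝ)..τ, (n ^ 2 * ‖y t‖ ^ 2 - ‖g t‖ ^ 2) ≤
      ∫ t in (0 : ℝ)..τ, -(2 * inner ℝ (y t) (-(n ^ 2 • y t) + n • g t)) :=
    intervalIntegral.integral_mono hτ
      (Continuous.intervalIntegrable (by fun_prop) _ _) (hc.neg.intervalIntegrable _ _) hle
  rw [intervalIntegral.integral_neg, hftc, intervalIntegral.integral_sub
    (Continuous.intervalIntegrable (by fun_prop) _ _)
    (Continuous.intervalIntegrable (by fun_prop) _ _)] at hint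
  nlinarith [sq_nonneg ‖y τ‖]

theorem lintegral_ofReal_eq {f : ℝ → ℝ} (hf : Continuous f) (h0 : ∀ t, 0 ≤ f t) {τ : ℝ}
    (hτ : 0 ≤ τ) :
    ∫⁻ t in Ioc 0 τ, ENNReal.ofReal (f t) = ENNReal.ofReal (∫ t in (0 : ℝ)..τ, f t) := by
  rw [intervalIntegral.integral_of_le hτ, ofReal_integral_eq_lintegral_ofReal]
  · exact (hf.integrableOn_Icc).mono_set Ioc_subset_Icc_self
  · exact Eventually.of_forall h0

theorem norm_bilin_le {α : ℝ} (hα : 3 / 2 < α) (a b : H) :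
    ‖bilin hα a b‖ ≤ Real.sqrt (bilinConst α α).toReal * ‖a‖ * ‖b‖ :=
  norm_bilinFun_le hα a b

set_option maxHeartbeats 800000 in
-- With zero control, the mild solution has `∫ |a|²_{V_1} < ∞` by the energy estimate, so it lies in
-- `V_1` at almost every time and one such time is chosen. That time may depend on `x`; the bound on
-- the path and the range of times do not.
theorem exists_reach_regular {α : ℝ} (hα : 3 / 2 < α) (Q : H →L[ℝ] H) {R : ℝ} (hR : 0 ≤ R) :
    ∃ τ₀ > 0, ∀ τ, 0 < τ → τ ≤ τ₀ → ∀ x : H, ‖x‖ ≤ R →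
      ∃ s ∈ Ioc 0 τ, ∃ z : H, Reach hα Q (R + 1) 0 s x z ∧ sobSq 1 z ≠ ⊤ := by
  obtain ⟨τ₀, hτ₀, hmild⟩ := exists_mild (S := heat) (K := heatHalf) continuousOn_heat
    (fun t ht => norm_heat_le ht) continuousOn_heatHalf (fun r hr => norm_heatHalf_le hr)
    (-bilin hα) hR
  refine ⟨τ₀, hτ₀, fun τ hτ hττ₀ x hx => ?_⟩
  obtain ⟨a, hac, han, hamild⟩ := hmild x hx
  obtain ⟨G, hG⟩ : ∃ G : ℝ → H, ∀ t, G t = -bilin hα (a t) (a t) := ⟨_, fun _ => rfl⟩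
  have hGc : Continuous G := by
    rw [funext hG]
    exact ((continuous_bilin_self hα).comp hac).neg
  obtain ⟨C, hC⟩ : ∃ C, C = Real.sqrt (bilinConst α α).toReal * (R + 1) * (R + 1) := ⟨_, rfl⟩
  have hGn : ∀ t, ‖G t‖ ≤ C := by
    intro t
    rw [hG, norm_neg, hC]
    refine (norm_bilin_le hα _ _).trans ?_
    have := han t
    gcongr
  have hamild : ∀ t ∈ Icc 0 τ₀, a t = heat t x + ∫ r in (0 : ℝ)..t, heatHalf r (G (t - r)) := by
    intro t ht
    simp only [hG]
    exact hamild t ht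
  have hGk : ∀ k, Continuous fun t => coef (G t) k := fun k => (continuous_coef k).comp hGc
  -- The Duhamel formula for each mode is taken for all real times, so that it can be differentiated
  -- without boundary cases; it agrees with the coefficient of `a` on `[0,τ₀]`.
  obtain ⟨y, hy⟩ : ∃ y : ZStar → ℝ → E3, ∀ k t, y k t =
    Real.exp (-(t * ‖kvec k‖ ^ 2)) • coef x k
      + ∫ r in (0 : ℝ)..t, Real.exp (-(r * ‖kvec k‖ ^ 2)) • (‖kvec k‖ • coef (G (t - r)) k) :=
    ⟨_, fun _ _ => rfl⟩
  have hyd : ∀ k t, HasDerivAt (y k) (-(‖kvec k‖ ^ 2 • y k t) + ‖kvec k‖ • coef (G t) k) t :=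
    fun k t => by
      rw [funext (hy k)]
      exact hasDerivAt_duhamel ((hGk k).const_smul ‖kvec k‖) (‖kvec k‖ ^ 2) (coef x k) t
  have hyc : ∀ k, Continuous (y k) := fun k =>
    continuous_iff_continuousAt.2 fun t => (hyd k t).continuousAt
  have hya : ∀ k, ∀ t ∈ Icc 0 τ₀, coef (a t) k = y k t := by
    intro k t ht
    have hint := intervalIntegrable_kernel (K := heatHalf) continuousOn_heatHalf
      (fun r hr => norm_heatHalf_le hr) (g := fun r => G (t - r)) ht.1
      (hGc.comp (continuous_const.sub continuous_id)) (fun r => hGn _)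
    have h1 := (coefL k).intervalIntegral_comp_comm hint
    rw [hamild t ht, coef_add, coef_heat ht.1]
    change _ + coefL k (∫ r in (0 : ℝ)..t, heatHalf r (G (t - r))) = _
    rw [← h1]
    simp only [hy]
    congr 1
    refine intervalIntegral.integral_congr_ae (Eventually.of_forall fun r hr => ?_)
    rw [uIoc_of_le ht.1] at hr
    rw [coefL_apply, coef_heatHalf hr.1, smul_smul, mul_comm]
  have hy0 : ∀ k, y k 0 = coef x k := fun k => by simp [hy]
  have ha0 : a 0 = x := coef_injective fun k => by
    rw [hya k 0 ⟨le_rfl, hτ₀.le⟩, hy0]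
  have hctrl : ∀ s ∈ Icc 0 τ₀, IsControlled hα Q 0 s a (fun _ => 0) := by
    intro s hs
    refine ⟨MemLp.zero', hac.continuousOn, fun k r hr => ?_⟩
    have hr' : r ∈ Icc 0 τ₀ := ⟨hr.1, hr.2.trans hs.2⟩
    rw [hya k r hr', hya k 0 ⟨le_rfl, hτ₀.le⟩]
    have hcont : Continuous fun t => -(‖kvec k‖ ^ 2 • y k t) + ‖kvec k‖ • coef (G t) k :=
      ((hyc k).const_smul (‖kvec k‖ ^ 2)).neg.add ((hGk k).const_smul ‖kvec k‖)
    rw [← intervalIntegral.integral_eq_sub_of_hasDerivAt (fun t _ => hyd k t)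
      (hcont.intervalIntegrable 0 r)]
    refine intervalIntegral.integral_congr fun σ hσ => ?_
    rw [uIcc_of_le hr.1] at hσ
    simp only [modeRhs, map_zero, coef_zero, smul_zero, add_zero]
    rw [hya k σ ⟨hσ.1, hσ.2.trans hr'.2⟩, hG]
    rw [coef_neg, smul_neg, sub_eq_add_neg]
  have hsum : ∫⁻ σ in Ioc 0 τ, sobSq 1 (a σ) ≠ ⊤ := by
    have hk : ∀ k, ∫⁻ σ in Ioc 0 τ, (wt 1 k * ‖coef (a σ) k‖ₑ) ^ 2 ≤
        ‖coef x k‖ₑ ^ 2 + ∫⁻ σ in Ioc 0 τ, ‖coef (G σ) k‖ₑ ^ 2 := by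
      intro k
      have he := energy_estimate (hGk k) hτ.le (hyd k)
      have he' := ENNReal.ofReal_le_ofReal he
      have hyk := hyc k
      have hGk' := hGk k
      rw [hy0, ENNReal.ofReal_add (by positivity)
        (intervalIntegral.integral_nonneg hτ.le fun t _ => by positivity),
        ← lintegral_ofReal_eq (by fun_prop) (fun t => by positivity) hτ.le,
        ← lintegral_ofReal_eq (by fun_prop) (fun t => by positivity) hτ.le] at he'
      simp only [ENNReal.ofReal_pow (norm_nonneg _), ofReal_norm] at he'
      refine le_trans (le_of_eq ?_) he'
      refine setLIntegral_congr_fun measurableSet_Ioc fun σ hσ => ?_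
      rw [hya k σ ⟨hσ.1.le, hσ.2.trans hττ₀⟩, mul_pow, ENNReal.ofReal_mul (by positivity), wt_one,
        ENNReal.ofReal_pow (norm_nonneg _), ENNReal.ofReal_pow (norm_nonneg _), ofReal_norm,
        ofReal_norm]
    unfold sobSq
    have hak : ∀ k, Continuous fun σ => coef (a σ) k := fun k => (continuous_coef k).comp hac
    rw [lintegral_tsum fun k => (((hak k).enorm.measurable.const_mul _).pow_const 2).aemeasurable]
    refine ne_top_of_le_ne_top ?_ (ENNReal.tsum_le_tsum hk)
    rw [ENNReal.tsum_add, tsum_enorm_coef_sq,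
      ← lintegral_tsum fun k => ((hGk k).enorm.measurable.pow_const 2).aemeasurable]
    simp only [tsum_enorm_coef_sq]
    refine ENNReal.add_ne_top.2 ⟨ENNReal.pow_ne_top enorm_ne_top, ?_⟩
    refine ne_top_of_le_ne_top ?_ (lintegral_mono (g := fun _ => ENNReal.ofReal C ^ 2) fun σ => ?_)
    · rw [lintegral_const]
      refine ENNReal.mul_ne_top (ENNReal.pow_ne_top ENNReal.ofReal_ne_top) ?_
      simp
    · simp only
      gcongr
      rw [← ofReal_norm]
      exact ENNReal.ofReal_le_ofReal (hGn σ)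
  have hne : NeBot (ae (volume.restrict (Ioc (0 : ℝ) τ))) := by
    rw [ae_neBot, Ne, Measure.restrict_eq_zero]
    simp [hτ]
  have hak : ∀ k, Continuous fun σ => coef (a σ) k := fun k => (continuous_coef k).comp hac
  have hm : AEMeasurable (fun σ => sobSq 1 (a σ)) (volume.restrict (Ioc (0 : ℝ) τ)) :=
    AEMeasurable.tsum fun k =>
      (((hak k).enorm.measurable.const_mul _).pow_const 2).aemeasurable
  obtain ⟨s, hs1, hs2⟩ := ((ae_lt_top' hm hsum).and (ae_restrict_mem measurableSet_Ioc)).exists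
  refine ⟨s, hs2, a s, ⟨a, fun _ => 0, hctrl s ⟨hs2.1.le, hs2.2.trans hττ₀⟩, ha0, rfl,
    fun σ _ => han σ⟩, hs1.ne⟩

/-! ### The equation for the low modes -/

theorem norm_quadratic_sub_le {E : Type*} [NormedAddCommGroup E] [NormedSpace ℝ E]
    (B : E →L[ℝ] E →L[ℝ] E) {m : ℝ} {x y : E} (hx : ‖x‖ ≤ m) (hy : ‖y‖ ≤ m) :
    ‖B x x - B y y‖ ≤ 2 * ‖B‖ * m * ‖x - y‖ := by
  have h : B x x - B y y = B (x - y) x + B y (x - y) := by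
    simp only [map_sub, sub_apply]
    abel
  rw [h]
  refine (norm_add_le _ _).trans ?_
  have h1 := B.le_opNorm₂ (x - y) x
  have h2 := B.le_opNorm₂ y (x - y)
  have h3 : ‖B‖ * ‖x - y‖ * ‖x‖ ≤ ‖B‖ * ‖x - y‖ * m := by gcongr
  have h4 : ‖B‖ * ‖y‖ * ‖x - y‖ ≤ ‖B‖ * m * ‖x - y‖ := by gcongr
  linarith

/-- Local existence for `ℓ' = A ℓ + B (ℓ + η, ℓ + η)`, on an interval whose length depends on the
size of the data only. -/
theorem exists_quadratic_ode {E : Type*} [NormedAddCommGroup E] [NormedSpace ℝ E] [CompleteSpace E]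
    (A : E →L[ℝ] E) (B : E →L[ℝ] E →L[ℝ] E) {R : ℝ} (hR : 0 ≤ R) :
    ∃ δ > 0, ∀ t₀ t₁ s₀ : ℝ, s₀ ∈ Icc t₀ t₁ → t₁ - t₀ ≤ δ → ∀ η : ℝ → E,
      ContinuousOn η (Icc t₀ t₁) → (∀ t ∈ Icc t₀ t₁, ‖η t‖ ≤ R) → ∀ ℓ₀ : E, ‖ℓ₀‖ ≤ R →
      ∃ ℓ : ℝ → E, ℓ s₀ = ℓ₀ ∧
        (∀ t ∈ Icc t₀ t₁, HasDerivWithinAt ℓ (A (ℓ t) + B (ℓ t + η t) (ℓ t + η t))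
          (Icc t₀ t₁) t) ∧
        ∀ t ∈ Icc t₀ t₁, ‖ℓ t‖ ≤ R + 1 := by
  set m := 2 * R + 1 with hm
  have hm0 : 0 ≤ m := by positivity
  have hA0 : 0 ≤ ‖A‖ := norm_nonneg A
  have hB0 : 0 ≤ ‖B‖ := norm_nonneg B
  set L := ‖A‖ * (R + 1) + ‖B‖ * m * m with hL
  have hL0 : 0 ≤ L := by positivity
  set K := ‖A‖ + 2 * ‖B‖ * m with hK
  have hK0 : 0 ≤ K := by positivity
  -- On the unit ball around `ℓ₀` the vector field is bounded by `L`, so a solution cannot leave it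
  -- within time `1/(L+1)`. The initial time `s₀` is arbitrary because the equation is also solved
  -- backwards, from `s₀ = t₁`.
  refine ⟨1 / (L + 1), by positivity, fun t₀ t₁ s₀ hs₀ hδ η hη hηR ℓ₀ hℓ₀ => ?_⟩
  set f : ℝ → E → E := fun t ℓ => A ℓ + B (ℓ + η t) (ℓ + η t) with hf
  have hball : ∀ x ∈ Metric.closedBall ℓ₀ ((1 : NNReal) : ℝ), ‖x‖ ≤ R + 1 := by
    intro x hx
    have h1 := norm_le_norm_add_norm_sub' x ℓ₀
    rw [mem_closedBall_iff_norm] at hx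
    have : ((1 : NNReal) : ℝ) = 1 := rfl
    linarith
  have hsum : ∀ t ∈ Icc t₀ t₁, ∀ x ∈ Metric.closedBall ℓ₀ ((1 : NNReal) : ℝ), ‖x + η t‖ ≤ m := by
    intro t ht x hx
    have := hball x hx
    have := hηR t ht
    have := norm_add_le x (η t)
    linarith
  have hpl : IsPicardLindelof f (⟨s₀, hs₀⟩ : Icc t₀ t₁) ℓ₀ 1 0 ⟨L, hL0⟩ ⟨K, hK0⟩ := by
    refine ⟨fun t ht => ?_, fun x _ => ?_, fun t ht x hx => ?_, ?_⟩
    · refine LipschitzOnWith.of_dist_le_mul fun x hx y hy => ?_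
      rw [dist_eq_norm, dist_eq_norm]
      have h1 := norm_quadratic_sub_le B (hsum t ht x hx) (hsum t ht y hy)
      rw [add_sub_add_right_eq_sub] at h1
      have h2 := A.le_opNorm (x - y)
      have h3 : f t x - f t y = A (x - y)
          + (B (x + η t) (x + η t) - B (y + η t) (y + η t)) := by
        simp only [hf, map_sub]
        abel
      rw [h3]
      change _ ≤ K * _
      have h4 := norm_add_le (A (x - y)) (B (x + η t) (x + η t) - B (y + η t) (y + η t))
      rw [hK, add_mul]
      linarith
    · have h1 : ContinuousOn (fun t => x + η t) (Icc t₀ t₁) := continuousOn_const.add hη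
      exact continuousOn_const.add ((B.continuous.comp_continuousOn h1).clm_apply h1)
    · refine (norm_add_le _ _).trans (add_le_add ?_ ?_)
      · exact (A.le_opNorm x).trans (by have := hball x hx; gcongr)
      · refine (B.le_opNorm₂ _ _).trans ?_
        have := hsum t ht x hx
        gcongr
    · change L * max (t₁ - s₀) (s₀ - t₀) ≤ 1 - 0
      have h1 : max (t₁ - s₀) (s₀ - t₀) ≤ 1 / (L + 1) :=
        max_le (by linarith [hs₀.1]) (by linarith [hs₀.2])
      calc L * max (t₁ - s₀) (s₀ - t₀) ≤ L * (1 / (L + 1)) := by gcongr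
        _ ≤ 1 - 0 := by
          rw [mul_one_div, sub_zero, div_le_one (by positivity)]
          linarith
  have hx : ℓ₀ ∈ Metric.closedBall ℓ₀ ((0 : NNReal) : ℝ) := by simp
  obtain ⟨β, hβ⟩ := ODE.FunSpace.exists_isFixedPt_next hpl hx
  have hmem : ∀ t, β.compProj t ∈ Metric.closedBall ℓ₀ ((1 : NNReal) : ℝ) := fun t =>
    β.compProj_mem_closedBall hpl.mul_max_le
  refine ⟨β.compProj, ?_, fun t ht => ?_, fun t _ => hball _ (hmem t)⟩
  · have := ODE.FunSpace.next_apply₀ hpl hx β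
    rw [hβ] at this
    exact (ODE.FunSpace.compProj_val (t := ⟨s₀, hs₀⟩)).trans this
  · refine (ODE.hasDerivWithinAt_picard_Icc hs₀ hpl.continuousOn_uncurry
      β.continuous_compProj.continuousOn (fun t _ => hmem t) ℓ₀ ht).congr_of_mem
      (fun t ht => ?_) ht
    have h1 := (ODE.FunSpace.isFixedPt_next_iff hpl hx).1 hβ ⟨t, ht⟩
    exact (ODE.FunSpace.compProj_of_mem ht).trans h1

theorem finite_isLow (N : ℕ) : {k : ZStar | IsLow N k}.Finite := by
  have h : (Icc (fun _ => -(N : ℤ)) (fun _ => (N : ℤ)) : Set (Fin 3 → ℤ)).Finite := finite_Icc _ _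
  refine (h.preimage (Subtype.val_injective.injOn)).subset fun k hk => ?_
  exact ⟨fun i => (abs_le.1 (hk i)).1, fun i => (abs_le.1 (hk i)).2⟩

open Classical in
/-- The multiplier with symbol `m` on the low modes. -/
def lowDiag (N : ℕ) (m : ZStar → ℝ) : H →L[ℝ] H := diag fun k => if IsLow N k then m k else 0

theorem exists_low_bound (N : ℕ) (m : ZStar → ℝ) : ∃ C, ∀ k, IsLow N k → |m k| ≤ C := by
  obtain ⟨C, hC⟩ := ((finite_isLow N).image fun k => |m k|).bddAbove
  exact ⟨C, fun k hk => hC ⟨k, hk, rfl⟩⟩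

open Classical in
theorem coef_lowDiag (N : ℕ) (m : ZStar → ℝ) (u : H) (k : ZStar) :
    coef (lowDiag N m u) k = (if IsLow N k then m k else 0) • coef u k := by
  obtain ⟨C, hC⟩ := exists_low_bound N m
  refine coef_diag (C := max C 0) (fun k => ?_) u k
  split_ifs with h
  · exact (hC k h).trans (le_max_left _ _)
  · simp

theorem coef_lowDiag_of_isLow {N : ℕ} (m : ZStar → ℝ) (u : H) {k : ZStar} (hk : IsLow N k) :
    coef (lowDiag N m u) k = m k • coef u k := by
  rw [coef_lowDiag, if_pos hk]

theorem coef_lowDiag_of_not_isLow {N : ℕ} (m : ZStar → ℝ) (u : H) {k : ZStar} (hk : ¬ IsLow N k) :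
    coef (lowDiag N m u) k = 0 := by
  rw [coef_lowDiag, if_neg hk, zero_smul]

/-- The low part of the right-hand side, as a quadratic map. -/
def lowBilin {α : ℝ} (hα : 3 / 2 < α) (N : ℕ) : H →L[ℝ] H →L[ℝ] H :=
  (ContinuousLinearMap.compL ℝ H H H (-lowDiag N fun k => ‖kvec k‖)).comp (bilin hα)

theorem lowBilin_apply {α : ℝ} (hα : 3 / 2 < α) (N : ℕ) (a b : H) :
    lowBilin hα N a b = -lowDiag N (fun k => ‖kvec k‖) (bilin hα a b) := rfl

/-- Once the high part `η` is prescribed, the requirement that the residual vanish on the low modes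
is a quadratic ODE in finitely many unknowns. The high coefficients of `ℓ` have zero derivative and
vanish at `s₀`, so `ℓ` stays low. -/
theorem exists_low_ode {α : ℝ} (hα : 3 / 2 < α) (N : ℕ) {R : ℝ} (hR : 0 ≤ R) :
    ∃ δ > 0, ∀ t₀ t₁ s₀ : ℝ, s₀ ∈ Icc t₀ t₁ → t₁ - t₀ ≤ δ → ∀ η : ℝ → H,
      ContinuousOn η (Icc t₀ t₁) → (∀ t ∈ Icc t₀ t₁, ‖η t‖ ≤ R) → ∀ ℓ₀ : H, ‖ℓ₀‖ ≤ R →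
      (∀ k, ¬ IsLow N k → coef ℓ₀ k = 0) →
      ∃ ℓ D : ℝ → H, ℓ s₀ = ℓ₀ ∧ ContinuousOn ℓ (Icc t₀ t₁) ∧ ContinuousOn D (Icc t₀ t₁) ∧
        (∀ t ∈ Icc t₀ t₁, HasDerivWithinAt ℓ (D t) (Icc t₀ t₁) t) ∧
        (∀ t ∈ Icc t₀ t₁, ∀ k, IsLow N k → coef (D t) k + ‖kvec k‖ ^ 2 • coef (ℓ t) k
          + ‖kvec k‖ • coef (bilin hα (ℓ t + η t) (ℓ t + η t)) k = 0) ∧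
        (∀ t ∈ Icc t₀ t₁, ∀ k, ¬ IsLow N k → coef (ℓ t) k = 0) ∧
        (∀ t ∈ Icc t₀ t₁, ∀ k, ¬ IsLow N k → coef (D t) k = 0) ∧
        ∀ t ∈ Icc t₀ t₁, ‖ℓ t‖ ≤ R + 1 := by
  obtain ⟨δ, hδ, h⟩ := exists_quadratic_ode (-lowDiag N fun k => ‖kvec k‖ ^ 2) (lowBilin hα N) hR
  refine ⟨δ, hδ, fun t₀ t₁ s₀ hs₀ hle η hη hηR ℓ₀ hℓ₀ hlow => ?_⟩
  obtain ⟨ℓ, h0, hd, hn⟩ := h t₀ t₁ s₀ hs₀ hle η hη hηR ℓ₀ hℓ₀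
  obtain ⟨D, hD⟩ : ∃ D : ℝ → H, ∀ t, D t = -lowDiag N (fun k => ‖kvec k‖ ^ 2) (ℓ t)
      - lowDiag N (fun k => ‖kvec k‖) (bilin hα (ℓ t + η t) (ℓ t + η t)) := ⟨_, fun _ => rfl⟩
  have hd' : ∀ t ∈ Icc t₀ t₁, HasDerivWithinAt ℓ (D t) (Icc t₀ t₁) t := by
    intro t ht
    rw [hD, sub_eq_add_neg]
    exact hd t ht
  have hc : ContinuousOn ℓ (Icc t₀ t₁) := fun t ht => (hd' t ht).continuousWithinAt
  have hDk : ∀ t, ∀ k, ¬ IsLow N k → coef (D t) k = 0 := by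
    intro t k hk
    rw [hD, coef_sub, coef_neg, coef_lowDiag_of_not_isLow _ _ hk, coef_lowDiag_of_not_isLow _ _ hk]
    simp
  refine ⟨ℓ, D, h0, hc, ?_, hd', fun t _ k hk => ?_, fun t ht k hk => ?_, fun t _ => hDk t, hn⟩
  · rw [funext hD]
    exact (((lowDiag N fun k => ‖kvec k‖ ^ 2).continuous.comp_continuousOn hc).neg).sub
      ((lowDiag N fun k => ‖kvec k‖).continuous.comp_continuousOn
        ((continuous_bilin_self hα).comp_continuousOn (hc.add hη)))
  · rw [hD, coef_sub, coef_neg, coef_lowDiag_of_isLow _ _ hk, coef_lowDiag_of_isLow _ _ hk]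
    abel
  · have hconst : ∀ x ∈ Icc t₀ t₁, coef (ℓ x) k = coef (ℓ t₀) k := by
      have hdk : ∀ x ∈ Icc t₀ t₁,
          HasDerivWithinAt (fun t => coef (ℓ t) k) (0 : E3) (Icc t₀ t₁) x := by
        intro x hx
        rw [← hDk x k hk]
        exact (coefL k).hasFDerivAt.comp_hasDerivWithinAt x (hd' x hx)
      refine constant_of_has_deriv_right_zero ((continuous_coef k).comp_continuousOn hc)
        fun x hx => ?_
      exact (hdk x ⟨hx.1, hx.2.le⟩).mono_of_mem_nhdsWithin (Icc_mem_nhdsGE_of_mem hx)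
    rw [hconst t ht, ← hconst s₀ hs₀, h0, hlow k hk]

/-! ### Pairs of high frequencies that interact at a prescribed low frequency only -/

theorem triple_comm (p q r : ZStar) : triple p q r = triple q p r := by
  unfold triple
  congr 1
  funext ξ
  ring

theorem triple_eq_zero {p q r : ZStar} (h₁ : p.1 + q.1 + r.1 ≠ 0) (h₂ : p.1 + q.1 - r.1 ≠ 0)
    (h₃ : p.1 - q.1 + r.1 ≠ 0) (h₄ : p.1 - q.1 - r.1 ≠ 0) : triple p q r = 0 := by
  rw [triple_eq, cosMean_of_ne h₁, cosMean_of_ne h₂, cosMean_of_ne h₃, cosMean_of_ne h₄]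
  simp

/-- The vector `(k₁, -k₀, 0)` works unless it vanishes, and then the first basis vector does; `-v`
is as good as `v`. -/
theorem exists_isPos_orthogonal {N : ℕ} (hN : 1 ≤ N) {k : ZStar} (hk : IsLow N k) :
    ∃ v : ZStar, IsPos v.1 ∧ IsLow N v ∧ ∑ i, k.1 i * v.1 i = 0 := by
  suffices h : ∃ v : ZStar, IsLow N v ∧ ∑ i, k.1 i * v.1 i = 0 by
    obtain ⟨v, h1, h2⟩ := h
    rcases isPos_or_neg v with h | h
    · exact ⟨v, h, h1, h2⟩
    · refine ⟨neg v, h, fun i => ?_, ?_⟩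
      · rw [neg_val, Pi.neg_apply, abs_neg]
        exact h1 i
      · simp [neg_val, h2]
  by_cases h0 : k.1 0 = 0 ∧ k.1 1 = 0
  · refine ⟨⟨![1, 0, 0], fun h => by simpa using congrFun h 0⟩, fun i => ?_, ?_⟩
    · fin_cases i <;> simp
      exact_mod_cast hN
    · simp [Fin.sum_univ_three, h0.1]
  · refine ⟨⟨![k.1 1, -k.1 0, 0], fun h => h0 ?_⟩, fun i => ?_, ?_⟩
    · have h1 := congrFun h 0
      have h2 := congrFun h 1
      simp at h1 h2
      exact ⟨h2, h1⟩
    · fin_cases i <;> simp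
      · exact hk 1
      · exact hk 0
    · simp [Fin.sum_univ_three]
      ring

theorem exists_coord_ne_zero (v : ZStar) : ∃ m, 1 ≤ |v.1 m| := by
  obtain ⟨m, hm⟩ := Function.ne_iff.1 v.2
  exact ⟨m, Int.one_le_abs hm⟩

/-- Positive frequencies orthogonal to the given low ones, mutually far apart. -/
theorem exists_separated {N : ℕ} (hN : 1 ≤ N) : ∃ l : ZStar → ZStar,
    (∀ i, IsLow N i → IsPos (l i).1 ∧ ∑ m, i.1 m * (l i).1 m = 0 ∧ ∃ m, 3 * (N : ℤ) < |(l i).1 m|) ∧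
    ∀ i j, IsLow N i → IsLow N j → i ≠ j → ∃ m, 3 * (N : ℤ) < |(l i).1 m + (l j).1 m| ∧
      3 * (N : ℤ) < |(l i).1 m - (l j).1 m| := by
  classical
  have hex : ∀ k, ∃ v : ZStar, IsLow N k → IsPos v.1 ∧ IsLow N v ∧ ∑ i, k.1 i * v.1 i = 0 := by
    intro k
    by_cases hk : IsLow N k
    · obtain ⟨v, hv⟩ := exists_isPos_orthogonal hN hk
      exact ⟨v, fun _ => hv⟩
    · exact ⟨k, fun h => absurd h hk⟩
  choose v hv using hex
  obtain ⟨idx, hidx⟩ := exists_injective_nat ZStar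
  -- The scales grow by a factor of at least `4N + 1`, and the entries of the `v i` are at most `N`.
  -- Where `v j` has a nonzero entry, the larger multiple exceeds the smaller by at least `(4N + 1)
  -- c_i - N c_i > 3N`.
  obtain ⟨c, hc⟩ : ∃ c : ZStar → ℤ, ∀ k, c k = (4 * (N : ℤ) + 1) ^ (idx k + 1) :=
    ⟨_, fun _ => rfl⟩
  have hB : 1 ≤ 4 * (N : ℤ) + 1 := by omega
  have hcB : ∀ k, 4 * (N : ℤ) + 1 ≤ c k := by
    intro k
    rw [hc]
    exact le_self_pow₀ hB (by simp)
  have hc0 : ∀ k, 0 < c k := fun k => by have := hcB k; omega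
  have hcmul : ∀ i j, idx i < idx j → (4 * (N : ℤ) + 1) * c i ≤ c j := by
    intro i j h
    rw [hc, hc, ← pow_succ']
    exact pow_le_pow_right₀ hB (by omega)
  have hsep : ∀ i j, IsLow N i → IsLow N j → idx i < idx j →
      ∃ m, 3 * (N : ℤ) < |c i * (v i).1 m + c j * (v j).1 m| ∧
        3 * (N : ℤ) < |c i * (v i).1 m - c j * (v j).1 m| := by
    intro i j hi hj hij
    obtain ⟨m, hm⟩ := exists_coord_ne_zero (v j)
    have h1 : |c i * (v i).1 m| ≤ c i * N := by
      rw [abs_mul, abs_of_pos (hc0 i)]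
      exact mul_le_mul_of_nonneg_left ((hv i hi).2.1 m) (hc0 i).le
    have h2 : c j ≤ |c j * (v j).1 m| := by
      rw [abs_mul, abs_of_pos (hc0 j)]
      exact le_mul_of_one_le_right (hc0 j).le hm
    have h3 := hcmul i j hij
    have h4 : 3 * (N : ℤ) < (3 * (N : ℤ) + 1) * c i := by
      have := hc0 i
      nlinarith
    have h5 : 3 * (N : ℤ) < |c j * (v j).1 m| - |c i * (v i).1 m| := by nlinarith
    refine ⟨m, h5.trans_le ?_, h5.trans_le ?_⟩
    · have := abs_sub_abs_le_abs_sub (c j * (v j).1 m) (-(c i * (v i).1 m))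
      rw [abs_neg, sub_neg_eq_add, add_comm (c j * (v j).1 m)] at this
      exact this
    · rw [abs_sub_comm]
      exact abs_sub_abs_le_abs_sub _ _
  refine ⟨fun k => ⟨fun m => c k * (v k).1 m, fun h => (v k).2 ?_⟩, fun i hi => ⟨?_, ?_, ?_⟩,
    fun i j hi hj hij => ?_⟩
  · funext m
    have := congrFun h m
    simpa [(hc0 k).ne'] using this
  · have h := (hv i hi).1
    have := hc0 i
    simp only [IsPos] at h ⊢
    simpa [this, this.ne'] using h
  · simp only
    rw [← mul_zero (c i), ← (hv i hi).2.2, Finset.mul_sum]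
    exact Finset.sum_congr rfl fun m _ => by ring
  · obtain ⟨m, hm⟩ := exists_coord_ne_zero (v i)
    refine ⟨m, ?_⟩
    simp only
    rw [abs_mul, abs_of_pos (hc0 i)]
    have := hcB i
    have := hc0 i
    nlinarith
  · rcases lt_trichotomy (idx i) (idx j) with h | h | h
    · exact hsep i j hi hj h
    · exact absurd (hidx h) hij
    · obtain ⟨m, h1, h2⟩ := hsep j i hj hi h
      refine ⟨m, ?_, ?_⟩
      · rwa [add_comm]
      · rwa [abs_sub_comm]

theorem shift_of_isPos {k : ZStar} (h : IsPos k.1) : shift k = 0 := if_pos h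

theorem shift_congr {k l : ZStar} (h : IsPos k.1 ↔ IsPos l.1) : shift k = shift l := by
  unfold shift
  by_cases hk : IsPos k.1
  · rw [if_pos hk, if_pos (h.1 hk)]
  · rw [if_neg hk, if_neg fun h' => hk (h.2 h')]

/-- The sign of a frequency decides whether its mode is a cosine or a sine, so this prescribes the
parity of `e_q`. -/
theorem exists_sign {m : Fin 3 → ℤ} (hm : m ≠ 0) (P : Prop) :
    ∃ (q : ZStar) (σ : ℤ), (σ = 1 ∨ σ = -1) ∧ (∀ i, q.1 i = σ * m i) ∧ (IsPos q.1 ↔ P) := by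
  set k : ZStar := ⟨m, hm⟩ with hk
  have h1 : ∃ (q : ZStar) (σ : ℤ), (σ = 1 ∨ σ = -1) ∧ (∀ i, q.1 i = σ * m i) ∧ IsPos q.1 := by
    rcases isPos_or_neg k with h | h
    · exact ⟨k, 1, Or.inl rfl, fun i => by simp [hk], h⟩
    · exact ⟨neg k, -1, Or.inr rfl, fun i => by simp [hk, neg_val], h⟩
  obtain ⟨q, σ, hσ, hq, hp⟩ := h1
  by_cases hP : P
  · exact ⟨q, σ, hσ, hq, by simp [hP, hp]⟩
  · refine ⟨neg q, -σ, by omega, fun i => by simp [neg_val, hq], ?_⟩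
    simp only [hP, iff_false]
    exact not_isPos_neg hp

/-- For every low frequency `k` a pair of high frequencies `l k ⟂ k` and `q k = ±(k - l k)`
which interact at `k` and at no other low frequency. -/
theorem exists_companions {N : ℕ} (hN : 1 ≤ N) : ∃ l q : ZStar → ZStar,
    (∀ i, IsLow N i → ¬ IsLow N (l i) ∧ ¬ IsLow N (q i) ∧ ∑ m, i.1 m * (l i).1 m = 0 ∧
      (∃ σ : ℤ, (σ = 1 ∨ σ = -1) ∧ ∀ m, (q i).1 m = σ * (i.1 m - (l i).1 m)) ∧
      triple (l i) (q i) (neg i) ≠ 0) ∧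
    ∀ i j k, IsLow N i → IsLow N j → IsLow N k →
      triple i (l j) (neg k) = 0 ∧ triple i (q j) (neg k) = 0 ∧ triple (l i) (l j) (neg k) = 0 ∧
      triple (q i) (q j) (neg k) = 0 ∧ (¬ (i = j ∧ j = k) → triple (l i) (q j) (neg k) = 0) := by
  obtain ⟨l, hl, hsep⟩ := exists_separated hN
  -- The mode `q k` is given the parity of `e (neg k)`, while `l k` is a cosine. The triple product
  -- is then nonzero at `k`, and it vanishes at `-k`, where the frequencies are resonant as well.
  have hex : ∀ k, ∃ (q : ZStar) (σ : ℤ), IsLow N k → (σ = 1 ∨ σ = -1) ∧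
      (∀ m, q.1 m = σ * (k.1 m - (l k).1 m)) ∧ (IsPos q.1 ↔ IsPos (neg k).1) := by
    intro k
    by_cases hk : IsLow N k
    · have hm : k.1 - (l k).1 ≠ 0 := by
        intro h
        obtain ⟨m, hm⟩ := (hl k hk).2.2
        have h1 := hk m
        have h2 := congrFun h m
        simp only [Pi.sub_apply, Pi.zero_apply] at h2
        rw [show (l k).1 m = k.1 m by omega] at hm
        omega
      obtain ⟨q, σ, h⟩ := exists_sign hm (IsPos (neg k).1)
      exact ⟨q, σ, fun _ => h⟩
    · exact ⟨k, 0, fun h => absurd h hk⟩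
  choose q σ hq using hex
  refine ⟨l, q, fun i hi => ⟨fun h => ?_, fun h => ?_, (hl i hi).2.1, ⟨σ i, (hq i hi).1, (hq i hi).2.1⟩,
    ?_⟩, fun i j k hi hj hk => ⟨?_, ?_, ?_, ?_, fun hne => ?_⟩⟩
  · obtain ⟨m, hm⟩ := (hl i hi).2.2
    have := h m
    omega
  · obtain ⟨m, hm⟩ := (hl i hi).2.2
    have h1 := h m
    have h2 := hi m
    rw [(hq i hi).2.1 m] at h1
    rw [lt_abs] at hm
    rw [abs_le] at h1 h2
    rcases (hq i hi).1 with hs | hs <;> rw [hs] at h1 <;> omega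
  · obtain ⟨m, hm⟩ := (hl i hi).2.2
    have h2 := hi m
    rw [lt_abs] at hm
    rw [abs_le] at h2
    have hqm := (hq i hi).2.1
    have hm' := hqm m
    -- Exactly one of the four signed sums vanishes. Of the others, two contain `±2 l` and are
    -- nonzero at the coordinate `m` where `l` is large; the last is `±2 i`, nonzero at `m'`.
    obtain ⟨m', hm''⟩ := Function.ne_iff.1 i.2
    have hqm' := hqm m'
    simp only [Pi.zero_apply] at hm''
    rw [triple_eq, shift_of_isPos (hl i hi).1, shift_congr (hq i hi).2.2]
    rcases (hq i hi).1 with hs | hs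
    · simp only [hs, one_mul] at hqm hm' hqm'
      have z1 : (l i).1 + (q i).1 + (neg i).1 = 0 := by
        funext x
        simp only [Pi.add_apply, neg_val, Pi.neg_apply, hqm, Pi.zero_apply]
        omega
      rw [z1, cosMean_of_ne (n := (l i).1 + (q i).1 - (neg i).1),
        cosMean_of_ne (n := (l i).1 - (q i).1 + (neg i).1),
        cosMean_of_ne (n := (l i).1 - (q i).1 - (neg i).1)]
      · rw [cosMean, if_pos rfl]
        unfold shift
        split_ifs <;> simp
      · intro h
        have := congrFun h m
        simp only [Pi.sub_apply, neg_val, Pi.neg_apply, Pi.zero_apply] at this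
        omega
      · intro h
        have := congrFun h m
        simp only [Pi.add_apply, Pi.sub_apply, neg_val, Pi.neg_apply, Pi.zero_apply] at this
        omega
      · intro h
        have := congrFun h m'
        simp only [Pi.add_apply, Pi.sub_apply, neg_val, Pi.neg_apply, Pi.zero_apply] at this
        omega
    · simp only [hs] at hqm hm' hqm'
      have z1 : (l i).1 - (q i).1 + (neg i).1 = 0 := by
        funext x
        simp only [Pi.add_apply, Pi.sub_apply, neg_val, Pi.neg_apply, hqm, Pi.zero_apply]
        omega
      rw [z1, cosMean_of_ne (n := (l i).1 + (q i).1 - (neg i).1),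
        cosMean_of_ne (n := (l i).1 + (q i).1 + (neg i).1),
        cosMean_of_ne (n := (l i).1 - (q i).1 - (neg i).1)]
      · simp [cosMean]
      · intro h
        have := congrFun h m'
        simp only [Pi.sub_apply, neg_val, Pi.neg_apply, Pi.zero_apply] at this
        omega
      · intro h
        have := congrFun h m
        simp only [Pi.add_apply, neg_val, Pi.neg_apply, Pi.zero_apply] at this
        omega
      · intro h
        have := congrFun h m
        simp only [Pi.add_apply, Pi.sub_apply, neg_val, Pi.neg_apply, Pi.zero_apply] at this
        omega
  · obtain ⟨m, hm⟩ := (hl j hj).2.2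
    have h1 := hi m
    have h2 := hk m
    rw [lt_abs] at hm
    rw [abs_le] at h1 h2
    refine triple_eq_zero ?_ ?_ ?_ ?_ <;>
    · intro h
      have := congrFun h m
      simp only [Pi.add_apply, Pi.sub_apply, neg_val, Pi.neg_apply, Pi.zero_apply] at this
      omega
  · obtain ⟨m, hm⟩ := (hl j hj).2.2
    have h1 := hi m
    have h2 := hk m
    have h3 := hj m
    have h4 := (hq j hj).2.1 m
    rw [lt_abs] at hm
    rw [abs_le] at h1 h2 h3
    refine triple_eq_zero ?_ ?_ ?_ ?_ <;>
    · intro h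
      have := congrFun h m
      simp only [Pi.add_apply, Pi.sub_apply, neg_val, Pi.neg_apply, Pi.zero_apply] at this
      rcases (hq j hj).1 with hs | hs <;> rw [hs] at h4 <;> omega
  · have hk0 := k.2
    by_cases hij : i = j
    · subst hij
      obtain ⟨m, hm⟩ := (hl i hi).2.2
      have h2 := hk m
      rw [lt_abs] at hm
      rw [abs_le] at h2
      obtain ⟨m', hm'⟩ := Function.ne_iff.1 hk0
      simp only [Pi.zero_apply] at hm'
      refine triple_eq_zero ?_ ?_ ?_ ?_ <;>
      · intro h
        have := congrFun h m
        have := congrFun h m'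
        simp only [Pi.add_apply, Pi.sub_apply, neg_val, Pi.neg_apply, Pi.zero_apply] at *
        omega
    · obtain ⟨m, hm1, hm2⟩ := hsep i j hi hj hij
      have h2 := hk m
      rw [lt_abs] at hm1 hm2
      rw [abs_le] at h2
      refine triple_eq_zero ?_ ?_ ?_ ?_ <;>
      · intro h
        have := congrFun h m
        simp only [Pi.add_apply, Pi.sub_apply, neg_val, Pi.neg_apply, Pi.zero_apply] at *
        omega
  · have hk0 := k.2
    by_cases hij : i = j
    · subst hij
      obtain ⟨m, hm⟩ := (hl i hi).2.2
      have h2 := hk m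
      have h3 := hi m
      have h4 := (hq i hi).2.1 m
      rw [lt_abs] at hm
      rw [abs_le] at h2 h3
      obtain ⟨m', hm'⟩ := Function.ne_iff.1 hk0
      simp only [Pi.zero_apply] at hm'
      refine triple_eq_zero ?_ ?_ ?_ ?_ <;>
      · intro h
        have := congrFun h m
        have := congrFun h m'
        simp only [Pi.add_apply, Pi.sub_apply, neg_val, Pi.neg_apply, Pi.zero_apply] at *
        rcases (hq i hi).1 with hs | hs <;> rw [hs] at h4 <;> omega
    · obtain ⟨m, hm1, hm2⟩ := hsep i j hi hj hij
      have h2 := hk m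
      have h3 := hi m
      have h4 := hj m
      have h5 := (hq i hi).2.1 m
      have h6 := (hq j hj).2.1 m
      rw [lt_abs] at hm1 hm2
      rw [abs_le] at h2 h3 h4
      refine triple_eq_zero ?_ ?_ ?_ ?_ <;>
      · intro h
        have := congrFun h m
        simp only [Pi.add_apply, Pi.sub_apply, neg_val, Pi.neg_apply, Pi.zero_apply] at this
        rcases (hq i hi).1 with hs | hs <;> rw [hs] at h5 <;>
          rcases (hq j hj).1 with hs' | hs' <;> rw [hs'] at h6 <;> omega
  · by_cases hij : i = j
    · subst hij
      have hik : i ≠ k := fun h => hne ⟨rfl, h⟩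
      obtain ⟨m, hm⟩ := (hl i hi).2.2
      have h2 := hk m
      have h3 := hi m
      have h4 := (hq i hi).2.1
      have h4m := h4 m
      rw [lt_abs] at hm
      rw [abs_le] at h2 h3
      -- At `k = -i` there is a resonance, and only the phases help: each of the four shifts is
      -- `π/2` up to sign, so every cosine vanishes.
      by_cases hneg : i = neg k
      · subst hneg
        have hsq : shift (q (neg k)) = Real.pi / 2 - shift (neg k) := by
          rw [shift_congr (hq _ hi).2.2, shift_neg (neg k)]
        rw [triple_eq, shift_of_isPos (hl _ hi).1, hsq]
        have g : ∀ n : Fin 3 → ℤ, cosMean n (0 + (Real.pi / 2 - shift (neg k)) + shift (neg k)) = 0 := by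
          intro n
          unfold cosMean
          rw [show 0 + (Real.pi / 2 - shift (neg k)) + shift (neg k) = Real.pi / 2 by ring]
          simp
        have g' : ∀ n : Fin 3 → ℤ, cosMean n (0 - (Real.pi / 2 - shift (neg k)) - shift (neg k)) = 0 := by
          intro n
          unfold cosMean
          rw [show 0 - (Real.pi / 2 - shift (neg k)) - shift (neg k) = -(Real.pi / 2) by ring]
          simp
        have g2 : ∀ n : Fin 3 → ℤ, cosMean n (0 + (Real.pi / 2 - shift (neg k)) - shift (neg k)) = 0 := by
          intro n
          unfold cosMean shift
          split_ifs <;> simp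
        have g3 : ∀ n : Fin 3 → ℤ, cosMean n (0 - (Real.pi / 2 - shift (neg k)) + shift (neg k)) = 0 := by
          intro n
          unfold cosMean shift
          split_ifs <;> simp
        rw [g, g', g2, g3]
        simp
      · have e1 : i.1 - k.1 ≠ 0 := fun h => hik (Subtype.ext (sub_eq_zero.1 h))
        have e2 : i.1 + k.1 ≠ 0 := fun h => hneg (Subtype.ext (eq_neg_of_add_eq_zero_left h))
        obtain ⟨m1, hm1⟩ := Function.ne_iff.1 e1
        obtain ⟨m2, hm2⟩ := Function.ne_iff.1 e2
        have h41 := h4 m1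
        have h42 := h4 m2
        simp only [Pi.sub_apply, Pi.add_apply, Pi.zero_apply] at hm1 hm2
        refine triple_eq_zero ?_ ?_ ?_ ?_ <;>
        · intro h
          have h5 := congrFun h m
          have h6 := congrFun h m1
          have h7 := congrFun h m2
          simp only [Pi.add_apply, Pi.sub_apply, neg_val, Pi.neg_apply, Pi.zero_apply] at h5 h6 h7
          rcases (hq i hi).1 with hs | hs <;> rw [hs] at h41 h42 h4m <;> omega
    · obtain ⟨m, hm1, hm2⟩ := hsep i j hi hj hij
      have h2 := hk m
      have h4 := hj m
      have h6 := (hq j hj).2.1 m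
      rw [lt_abs] at hm1 hm2
      rw [abs_le] at h2 h4
      refine triple_eq_zero ?_ ?_ ?_ ?_ <;>
      · intro h
        have := congrFun h m
        simp only [Pi.add_apply, Pi.sub_apply, neg_val, Pi.neg_apply, Pi.zero_apply] at this
        rcases (hq j hj).1 with hs' | hs' <;> rw [hs'] at h6 <;> omega

/-! ### Forcing the low modes through the nonlinearity -/

theorem mem_kperp_iff {k : ZStar} {y : E3} : y ∈ kperp k ↔ inner ℝ (kvec k) y = 0 :=
  Submodule.mem_orthogonal_singleton_iff_inner_right

theorem modeL_eq_mode (k : ZStar) (c : E3) :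
    modeL k c = mode k ((kperp k).orthogonalProjectionOnto c) := by
  simp [modeL, modeₗᵢ_apply]

theorem coef_modeL_of_ne {k l : ZStar} (h : l ≠ k) (c : E3) : coef (modeL k c) l = 0 := by
  rw [modeL_eq_mode, coef_mode_of_ne h]

theorem lift_smul_modeL {α : ℝ} (hα : 0 ≤ α) (k : ZStar) (c : E3) :
    lift α (‖kvec k‖ ^ α • modeL k c) = modeL k c := by
  refine coef_injective fun l => ?_
  rw [coef_lift hα, coef_smul]
  by_cases h : l = k
  · subst h
    rw [smul_smul, ← Real.rpow_add (norm_kvec_pos l), neg_add_cancel, Real.rpow_zero, one_smul]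
  · rw [coef_modeL_of_ne h, smul_zero, smul_zero]

theorem bcoef_modeL_eq_zero {k p q : ZStar} (h : triple p q (neg k) = 0) (a b : E3) :
    bcoef k (modeL p a) (modeL q b) = 0 := by
  rw [modeL_eq_mode, modeL_eq_mode, bcoef_mode, h]
  simp

theorem bcoef_modeL_right_eq_zero {k q : ZStar} {u : H}
    (h : ∀ p, coef u p ≠ 0 → triple p q (neg k) = 0) (b : E3) : bcoef k u (modeL q b) = 0 := by
  have hs := ((bcoef k).flip (modeL q b)).hasSum (hasSum_mode u)
  have h0 : ∀ p, (bcoef k).flip (modeL q b) (mode p ⟨coef u p, coef_mem u p⟩) = 0 := by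
    intro p
    rw [ContinuousLinearMap.flip_apply, ← modeL_of_mem]
    by_cases hp : coef u p = 0
    · rw [hp]
      simp
    · exact bcoef_modeL_eq_zero (h p hp) _ _
  simp only [h0] at hs
  exact hs.unique hasSum_zero

theorem bcoef_modeL_left_eq_zero {k q : ZStar} {u : H}
    (h : ∀ p, coef u p ≠ 0 → triple p q (neg k) = 0) (b : E3) : bcoef k (modeL q b) u = 0 := by
  have hs := (bcoef k (modeL q b)).hasSum (hasSum_mode u)
  have h0 : ∀ p, bcoef k (modeL q b) (mode p ⟨coef u p, coef_mem u p⟩) = 0 := by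
    intro p
    rw [← modeL_of_mem]
    by_cases hp : coef u p = 0
    · rw [hp]
      simp
    · exact bcoef_modeL_eq_zero (by rw [triple_comm]; exact h p hp) _ _
  simp only [h0] at hs
  exact hs.unique hasSum_zero

theorem inner_kvec (k l : ZStar) : inner ℝ (kvec k) (kvec l) = ((∑ m, k.1 m * l.1 m : ℤ) : ℝ) := by
  simp [kvec, PiLp.inner_apply, mul_comm]

theorem exists_kvec_smul {k l q : ZStar} {σ : ℤ} (h : ∀ m, q.1 m = σ * (k.1 m - l.1 m)) :
    kvec q = (σ : ℝ) • (kvec k - kvec l) := by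
  ext m
  simp [kvec, h]

/-- The vector `y + (l·y / |k|²) k`, which is orthogonal to `k - l` if `y, l ⟂ k`. -/
def tilt (k l : ZStar) : E3 →L[ℝ] E3 :=
  ContinuousLinearMap.id ℝ E3 + ((1 / ‖kvec k‖ ^ 2) • innerSL ℝ (kvec l)).smulRight (kvec k)

theorem tilt_apply (k l : ZStar) (y : E3) :
    tilt k l y = y + ((1 / ‖kvec k‖ ^ 2) * inner ℝ (kvec l) y) • kvec k := by
  simp [tilt]

/-- The added multiple of `k` makes the `q`-mode divergence-free, and it is invisible after
projection to `k^⊥`. -/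
theorem tilt_mem {k l q : ZStar} {σ : ℤ} (hl : ∑ m, k.1 m * l.1 m = 0)
    (hq : ∀ m, q.1 m = σ * (k.1 m - l.1 m)) {y : E3} (hy : y ∈ kperp k) : tilt k l y ∈ kperp q := by
  have h1 : inner ℝ (kvec k) (kvec l) = 0 := by rw [inner_kvec, hl, Int.cast_zero]
  have h2 := mem_kperp_iff.1 hy
  have hk := norm_kvec_pos k
  rw [mem_kperp_iff, exists_kvec_smul hq, tilt_apply, real_inner_smul_left, inner_sub_left,
    inner_add_right, inner_add_right, inner_smul_right, inner_smul_right, h2,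
    real_inner_self_eq_norm_sq, real_inner_comm (kvec k) (kvec l), h1]
  field_simp
  ring

theorem starProjection_kvec (k : ZStar) : (kperp k).starProjection (kvec k) = 0 := by
  rw [Submodule.starProjection_apply_eq_zero_iff, kperp]
  exact Submodule.le_orthogonal_orthogonal _ (Submodule.mem_span_singleton_self _)

theorem starProjection_tilt {k l : ZStar} {y : E3} (hy : y ∈ kperp k) :
    (kperp k).starProjection (tilt k l y) = y := by
  rw [tilt_apply, map_add, map_smul, starProjection_kvec, smul_zero, add_zero,
    Submodule.starProjection_eq_self_iff.2 hy]

/-- The `l`-mode has amplitude `k`, which is admissible because `l ⟂ k`. When it is the transported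
field, the outcome is parallel to `k` and the projection kills it; when it is the transporting
field, the factor `k·k` appears and the projection returns `y`. -/
theorem bcoef_companions {k l q : ZStar} {σ : ℤ} (hl : ∑ m, k.1 m * l.1 m = 0)
    (hq : ∀ m, q.1 m = σ * (k.1 m - l.1 m)) {y : E3} (hy : y ∈ kperp k) :
    bcoef k (modeL l (kvec k)) (modeL q (tilt k l y))
      + bcoef k (modeL q (tilt k l y)) (modeL l (kvec k)) =
      -(triple l q (neg k) * ‖kvec k‖ ^ 2) • y := by
  have hk : kvec k ∈ kperp l := by
    rw [mem_kperp_iff, real_inner_comm, inner_kvec, hl, Int.cast_zero]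
  rw [modeL_of_mem hk, modeL_of_mem (tilt_mem hl hq hy), bcoef_mode, bcoef_mode]
  simp only
  rw [starProjection_kvec, starProjection_tilt hy, smul_zero, add_zero, real_inner_self_eq_norm_sq]

/-- A steady field and a linear feedback, both on finitely many high modes, through which any
prescribed force acts on the low modes. -/
theorem exists_low_forcing {α : ℝ} (hα : 3 / 2 < α) {N : ℕ} (hN : 1 ≤ N) :
    ∃ (S : Set ZStar) (f : H) (b : H →L[ℝ] H), S.Finite ∧ (∀ k ∈ S, ¬ IsLow N k) ∧
      (∀ k ∉ S, coef f k = 0) ∧ (∀ g, ∀ k ∉ S, coef (b g) k = 0) ∧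
      ∀ ℓ g : H, (∀ k, ¬ IsLow N k → coef ℓ k = 0) → ∀ k, IsLow N k →
        ‖kvec k‖ • coef (bilin hα (ℓ + (f + b g)) (ℓ + (f + b g))) k =
          ‖kvec k‖ • coef (bilin hα ℓ ℓ) k + coef g k := by
  classical
  have hα0 : 0 ≤ α := by linarith
  obtain ⟨l, q, hlq, hint⟩ := exists_companions hN
  obtain ⟨low, hlow⟩ : ∃ low : Finset ZStar, ∀ k, k ∈ low ↔ IsLow N k :=
    ⟨(finite_isLow N).toFinset, fun k => by simp⟩
  -- Normalization that cancels the factor in `bcoef_companions` and the weights of the coordinates,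
  -- so that the force on the mode `k` is `coef g k` exactly.
  obtain ⟨β, hβ⟩ : ∃ β : ZStar → ℝ, ∀ k, β k =
      -(‖kvec k‖ ^ (-α) / (triple (l k) (q k) (neg k) * ‖kvec k‖ ^ 2)) := ⟨_, fun _ => rfl⟩
  obtain ⟨V, hV⟩ : ∃ V : H → ZStar → H, ∀ g k, V g k = modeL (q k) (tilt k (l k) (β k • coef g k)) :=
    ⟨_, fun _ _ => rfl⟩
  obtain ⟨h, hh⟩ : ∃ h : ZStar → H, ∀ k, h k = modeL (l k) (kvec k) := ⟨_, fun _ => rfl⟩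
  obtain ⟨b, hb⟩ : ∃ b : H →L[ℝ] H, ∀ g, b g = ∑ k ∈ low, ‖kvec (q k)‖ ^ α • V g k := by
    refine ⟨∑ k ∈ low, (‖kvec (q k)‖ ^ α) •
      ((modeL (q k)).comp ((tilt k (l k)).comp (β k • coefL k))), fun g => ?_⟩
    rw [sum_apply]
    refine Finset.sum_congr rfl fun k _ => ?_
    rw [hV]
    rfl
  have hf : lift α (∑ k ∈ low, ‖kvec (l k)‖ ^ α • h k) = ∑ k ∈ low, h k := by
    rw [map_sum]
    refine Finset.sum_congr rfl fun k _ => ?_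
    rw [hh, lift_smul_modeL hα0]
  have hbl : ∀ g, lift α (b g) = ∑ k ∈ low, V g k := by
    intro g
    rw [hb, map_sum]
    refine Finset.sum_congr rfl fun k _ => ?_
    rw [hV, lift_smul_modeL hα0]
  refine ⟨↑(low.image l ∪ low.image q), ∑ k ∈ low, ‖kvec (l k)‖ ^ α • h k, b, Finset.finite_toSet _,
    fun k hk => ?_, fun k hk => ?_, fun g k hk => ?_, fun ℓ g hℓ k hk => ?_⟩
  · simp only [Finset.coe_union, Finset.coe_image, mem_union, mem_image, Finset.mem_coe] at hk
    rcases hk with ⟨i, hi, rfl⟩ | ⟨i, hi, rfl⟩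
    · exact (hlq i ((hlow i).1 hi)).1
    · exact (hlq i ((hlow i).1 hi)).2.1
  · rw [coef_sum]
    refine Finset.sum_eq_zero fun i hi => ?_
    rw [coef_smul, hh, coef_modeL_of_ne, smul_zero]
    rintro rfl
    exact hk (Finset.mem_coe.2 (Finset.mem_union_left _ (Finset.mem_image_of_mem _ hi)))
  · rw [hb, coef_sum]
    refine Finset.sum_eq_zero fun i hi => ?_
    rw [coef_smul, hV, coef_modeL_of_ne, smul_zero]
    rintro rfl
    exact hk (Finset.mem_coe.2 (Finset.mem_union_right _ (Finset.mem_image_of_mem _ hi)))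
  · obtain ⟨u, hu⟩ : ∃ u, u = lift α ℓ := ⟨_, rfl⟩
    have hul : ∀ p, coef u p ≠ 0 → IsLow N p := by
      intro p hp
      by_contra hp'
      apply hp
      rw [hu, coef_lift hα0, hℓ p hp', smul_zero]
    -- Of the nine products of `u + h + V`, the low self-interaction is kept. The interactions
    -- low–`l`, low–`q`, `l`–`l` and `q`–`q` vanish at `k`, and of the `l`–`q` ones only the pair
    -- attached to `k` survives.
    have z1 : bcoef k u (∑ i ∈ low, h i) = 0 := by
      rw [map_sum]
      refine Finset.sum_eq_zero fun i hi => ?_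
      rw [hh]
      exact bcoef_modeL_right_eq_zero (fun p hp => (hint p i k (hul p hp) ((hlow i).1 hi) hk).1) _
    have z2 : bcoef k u (∑ i ∈ low, V g i) = 0 := by
      rw [map_sum]
      refine Finset.sum_eq_zero fun i hi => ?_
      rw [hV]
      exact bcoef_modeL_right_eq_zero (fun p hp => (hint p i k (hul p hp) ((hlow i).1 hi) hk).2.1) _
    have z3 : bcoef k (∑ i ∈ low, h i) u = 0 := by
      rw [map_sum (bcoef k), sum_apply]
      refine Finset.sum_eq_zero fun i hi => ?_
      rw [hh]
      exact bcoef_modeL_left_eq_zero (fun p hp => (hint p i k (hul p hp) ((hlow i).1 hi) hk).1) _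
    have z4 : bcoef k (∑ i ∈ low, V g i) u = 0 := by
      rw [map_sum (bcoef k), sum_apply]
      refine Finset.sum_eq_zero fun i hi => ?_
      rw [hV]
      exact bcoef_modeL_left_eq_zero (fun p hp => (hint p i k (hul p hp) ((hlow i).1 hi) hk).2.1) _
    have z5 : bcoef k (∑ i ∈ low, h i) (∑ j ∈ low, h j) = 0 := by
      rw [map_sum (bcoef k), sum_apply]
      refine Finset.sum_eq_zero fun i hi => ?_
      rw [map_sum]
      refine Finset.sum_eq_zero fun j hj => ?_
      rw [hh, hh]
      exact bcoef_modeL_eq_zero (hint i j k ((hlow i).1 hi) ((hlow j).1 hj) hk).2.2.1 _ _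
    have z6 : bcoef k (∑ i ∈ low, V g i) (∑ j ∈ low, V g j) = 0 := by
      rw [map_sum (bcoef k), sum_apply]
      refine Finset.sum_eq_zero fun i hi => ?_
      rw [map_sum]
      refine Finset.sum_eq_zero fun j hj => ?_
      rw [hV, hV]
      exact bcoef_modeL_eq_zero (hint i j k ((hlow i).1 hi) ((hlow j).1 hj) hk).2.2.2.1 _ _
    have hkl : k ∈ low := (hlow k).2 hk
    have z7 : bcoef k (∑ i ∈ low, h i) (∑ j ∈ low, V g j) = bcoef k (h k) (V g k) := by
      have hz : ∀ i ∈ low, ∀ j ∈ low, ¬ (i = j ∧ j = k) → bcoef k (h i) (V g j) = 0 := by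
        intro i hi j hj hne
        rw [hh, hV]
        exact bcoef_modeL_eq_zero
          ((hint i j k ((hlow i).1 hi) ((hlow j).1 hj) hk).2.2.2.2 hne) _ _
      rw [map_sum (bcoef k), sum_apply, Finset.sum_eq_single_of_mem k hkl, map_sum,
        Finset.sum_eq_single_of_mem k hkl]
      · intro j hj hjk
        exact hz k hkl j hj fun h => hjk h.2
      · intro i hi hik
        rw [map_sum]
        exact Finset.sum_eq_zero fun j hj => hz i hi j hj fun h => hik (h.1.trans h.2)
    have z8 : bcoef k (∑ i ∈ low, V g i) (∑ j ∈ low, h j) = bcoef k (V g k) (h k) := by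
      have hz : ∀ i ∈ low, ∀ j ∈ low, ¬ (i = j ∧ j = k) → bcoef k (V g i) (h j) = 0 := by
        intro i hi j hj hne
        rw [hh, hV]
        refine bcoef_modeL_eq_zero ?_ _ _
        rw [triple_comm]
        exact (hint j i k ((hlow j).1 hj) ((hlow i).1 hi) hk).2.2.2.2
          fun h => hne ⟨h.1.symm, h.1.trans h.2⟩
      rw [map_sum (bcoef k), sum_apply, Finset.sum_eq_single_of_mem k hkl, map_sum,
        Finset.sum_eq_single_of_mem k hkl]
      · intro j hj hjk
        exact hz k hkl j hj fun h => hjk h.2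
      · intro i hi hik
        rw [map_sum]
        exact Finset.sum_eq_zero fun j hj => hz i hi j hj fun h => hik (h.1.trans h.2)
    obtain ⟨-, -, ho, ⟨σ, -, hσ⟩, htr⟩ := hlq k hk
    have hkp := norm_kvec_pos k
    have z9 : bcoef k (h k) (V g k) + bcoef k (V g k) (h k) = ‖kvec k‖ ^ (-α) • coef g k := by
      rw [hh, hV, bcoef_companions ho hσ (Submodule.smul_mem _ _ (coef_mem g k)), smul_smul, hβ]
      congr 1
      field_simp
    have key : bcoef k (lift α (ℓ + (∑ i ∈ low, ‖kvec (l i)‖ ^ α • h i + b g)))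
        (lift α (ℓ + (∑ i ∈ low, ‖kvec (l i)‖ ^ α • h i + b g))) =
        bcoef k (lift α ℓ) (lift α ℓ) + ‖kvec k‖ ^ (-α) • coef g k := by
      rw [map_add (lift α) ℓ, map_add (lift α) _ (b g), hf, hbl, ← hu]
      simp only [map_add, add_apply] at z1 z2 z3 z4 z5 z6 z7 z8 ⊢
      rw [z1, z2, z3, z4, z5, z6, z7, z8, ← z9]
      abel
    rw [coef_bilin, coef_bilin, key, smul_add, smul_add, smul_smul ‖kvec k‖ (‖kvec k‖ ^ (α - 1))
      (‖kvec k‖ ^ (-α) • coef g k), smul_smul (‖kvec k‖ * ‖kvec k‖ ^ (α - 1)) _ (coef g k)]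
    have : ‖kvec k‖ * ‖kvec k‖ ^ (α - 1) * ‖kvec k‖ ^ (-α) = 1 := by
      rw [Real.rpow_sub_one hkp.ne', mul_div_cancel₀ _ hkp.ne', ← Real.rpow_add hkp, add_neg_cancel,
        Real.rpow_zero]
    rw [this, one_smul]

/-! ### Steering through finitely many modes -/

/-- Cubic Hermite interpolation. -/
theorem exists_hermite {E : Type*} [NormedAddCommGroup E] [NormedSpace ℝ E] (K : Submodule ℝ E)
    {t₀ t₁ : ℝ} (ht : t₀ < t₁) {V : ℝ} (hV : 0 ≤ V) :
    ∃ C, 0 ≤ C ∧ ∀ p₀ ∈ K, ∀ v₀ ∈ K, ∀ p₁ ∈ K, ∀ v₁ ∈ K,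
      ‖p₀‖ ≤ V → ‖v₀‖ ≤ V → ‖p₁‖ ≤ V → ‖v₁‖ ≤ V →
      ∃ ℓ ℓ' ℓ'' : ℝ → E, Continuous ℓ'' ∧ (∀ t, HasDerivAt ℓ (ℓ' t) t) ∧
        (∀ t, HasDerivAt ℓ' (ℓ'' t) t) ∧ (∀ t, ℓ t ∈ K) ∧ (∀ t, ℓ' t ∈ K) ∧
        ℓ t₀ = p₀ ∧ ℓ' t₀ = v₀ ∧ ℓ t₁ = p₁ ∧ ℓ' t₁ = v₁ ∧
        ∀ t ∈ Icc t₀ t₁, ‖ℓ t‖ ≤ C ∧ ‖ℓ' t‖ ≤ C := by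
  obtain ⟨τ, hτ⟩ : ∃ τ, τ = t₁ - t₀ := ⟨_, rfl⟩
  have hτ0 : 0 < τ := by rw [hτ]; linarith
  obtain ⟨Cc, hCc⟩ : ∃ Cc, Cc = 3 / τ ^ 2 * (V + V) + (2 / τ * V + 1 / τ * V) := ⟨_, rfl⟩
  obtain ⟨Cd, hCd⟩ : ∃ Cd, Cd = 2 / τ ^ 3 * (V + V) + 1 / τ ^ 2 * (V + V) := ⟨_, rfl⟩
  have hCc0 : 0 ≤ Cc := by rw [hCc]; positivity
  have hCd0 : 0 ≤ Cd := by rw [hCd]; positivity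
  refine ⟨(V + τ * V + τ ^ 2 * Cc + τ ^ 3 * Cd) + (V + 2 * τ * Cc + 3 * τ ^ 2 * Cd), by positivity,
    fun p₀ hp₀ v₀ hv₀ p₁ hp₁ v₁ hv₁ np₀ nv₀ np₁ nv₁ => ?_⟩
  -- The vectors `c` and `d` solve the two linear conditions that position and velocity at `t₁`
  -- impose on the cubic.
  obtain ⟨c, hc⟩ : ∃ c, c = (3 / τ ^ 2) • (p₁ - p₀) - ((2 / τ) • v₀ + (1 / τ) • v₁) := ⟨_, rfl⟩
  obtain ⟨d, hd⟩ : ∃ d, d = -((2 / τ ^ 3) • (p₁ - p₀)) + (1 / τ ^ 2) • (v₀ + v₁) := ⟨_, rfl⟩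
  have hcK : c ∈ K := by
    rw [hc]
    exact K.sub_mem (K.smul_mem _ (K.sub_mem hp₁ hp₀))
      (K.add_mem (K.smul_mem _ hv₀) (K.smul_mem _ hv₁))
  have hdK : d ∈ K := by
    rw [hd]
    exact K.add_mem (K.neg_mem (K.smul_mem _ (K.sub_mem hp₁ hp₀)))
      (K.smul_mem _ (K.add_mem hv₀ hv₁))
  have hsmul : ∀ (r : ℝ) (x : E) (m : ℝ), 0 ≤ r → ‖x‖ ≤ m → ‖r • x‖ ≤ r * m := by
    intro r x m hr hx
    rw [norm_smul, Real.norm_of_nonneg hr]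
    gcongr
  have ncc : ‖c‖ ≤ Cc := by
    rw [hc, hCc]
    refine (norm_sub_le _ _).trans (add_le_add (hsmul _ _ _ (by positivity) ?_) ?_)
    · exact (norm_sub_le _ _).trans (add_le_add np₁ np₀)
    · exact (norm_add_le _ _).trans (add_le_add (hsmul _ _ _ (by positivity) nv₀)
        (hsmul _ _ _ (by positivity) nv₁))
  have ncd : ‖d‖ ≤ Cd := by
    rw [hd, hCd]
    refine (norm_add_le _ _).trans (add_le_add ?_ (hsmul _ _ _ (by positivity) ?_))
    · rw [norm_neg]
      exact hsmul _ _ _ (by positivity) ((norm_sub_le _ _).trans (add_le_add np₁ np₀))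
    · exact (norm_add_le _ _).trans (add_le_add nv₀ nv₁)
  have hid : ∀ t, HasDerivAt (fun t : ℝ => t - t₀) 1 t := fun t => (hasDerivAt_id t).sub_const t₀
  refine ⟨fun t => p₀ + (t - t₀) • v₀ + (t - t₀) ^ 2 • c + (t - t₀) ^ 3 • d,
    fun t => v₀ + (2 * (t - t₀)) • c + (3 * (t - t₀) ^ 2) • d,
    fun t => (2 : ℝ) • c + (6 * (t - t₀)) • d, by fun_prop, fun t => ?_, fun t => ?_, fun t => ?_,
    fun t => ?_, ?_, ?_, ?_, ?_, fun t htt => ⟨?_, ?_⟩⟩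
  · have h1 := (hid t).smul_const v₀
    have h2 := ((hid t).fun_pow 2).smul_const c
    have h3 := ((hid t).fun_pow 3).smul_const d
    refine (((h1.const_add p₀).add h2).add h3).congr_deriv ?_
    simp
  · have h2 := ((hid t).const_mul 2).smul_const c
    have h3 := (((hid t).fun_pow 2).const_mul 3).smul_const d
    refine ((h2.const_add v₀).add h3).congr_deriv ?_
    simp only [mul_one]
    congr 2
    push_cast
    ring
  · exact K.add_mem (K.add_mem (K.add_mem hp₀ (K.smul_mem _ hv₀)) (K.smul_mem _ hcK))
      (K.smul_mem _ hdK)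
  · exact K.add_mem (K.add_mem hv₀ (K.smul_mem _ hcK)) (K.smul_mem _ hdK)
  · simp
  · simp
  · simp only
    rw [← hτ, hc, hd]
    match_scalars <;> field_simp <;> ring
  · simp only
    rw [← hτ, hc, hd]
    match_scalars <;> field_simp <;> ring
  · have h0 : 0 ≤ t - t₀ := by linarith [htt.1]
    have h1 : t - t₀ ≤ τ := by rw [hτ]; linarith [htt.2]
    have b1 : ‖(t - t₀) • v₀‖ ≤ τ * V := (hsmul _ _ _ h0 nv₀).trans (by gcongr)
    have b2 : ‖(t - t₀) ^ 2 • c‖ ≤ τ ^ 2 * Cc := (hsmul _ _ _ (by positivity) ncc).trans (by gcongr)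
    have b3 : ‖(t - t₀) ^ 3 • d‖ ≤ τ ^ 3 * Cd := (hsmul _ _ _ (by positivity) ncd).trans (by gcongr)
    have b4 : 0 ≤ V + 2 * τ * Cc + 3 * τ ^ 2 * Cd := by positivity
    refine le_trans ?_ (le_add_of_nonneg_right b4)
    exact (norm_add_le _ _).trans (add_le_add ((norm_add_le _ _).trans (add_le_add
      ((norm_add_le _ _).trans (add_le_add np₀ b1)) b2)) b3)
  · have h0 : 0 ≤ t - t₀ := by linarith [htt.1]
    have h1 : t - t₀ ≤ τ := by rw [hτ]; linarith [htt.2]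
    have b2 : ‖(2 * (t - t₀)) • c‖ ≤ 2 * τ * Cc :=
      (hsmul _ _ _ (by positivity) ncc).trans (by gcongr)
    have b3 : ‖(3 * (t - t₀) ^ 2) • d‖ ≤ 3 * τ ^ 2 * Cd :=
      (hsmul _ _ _ (by positivity) ncd).trans (by gcongr)
    have b4 : 0 ≤ V + τ * V + τ ^ 2 * Cc + τ ^ 3 * Cd := by positivity
    refine le_trans ?_ (le_add_of_nonneg_left b4)
    exact (norm_add_le _ _).trans (add_le_add ((norm_add_le _ _).trans (add_le_add nv₀ b2)) b3)

/-- A path between two points along which the force `g` that makes it a solution of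
`ℓ' = A ℓ + B (ℓ, ℓ) - g` vanishes at both ends. -/
theorem exists_interpolation {E : Type*} [NormedAddCommGroup E] [NormedSpace ℝ E]
    (A b : E →L[ℝ] E) (B : E →L[ℝ] E →L[ℝ] E) (f : E) (K : Submodule ℝ E) (hA : ∀ x, A x ∈ K)
    (hB : ∀ x y, B x y ∈ K) {t₀ t₁ : ℝ} (ht : t₀ < t₁) {R : ℝ} (hR : 0 ≤ R) :
    ∃ M, ∀ p₀ ∈ K, ∀ p₁ ∈ K, ‖p₀‖ ≤ R → ‖p₁‖ ≤ R → ∃ ℓ ℓ' g g' : ℝ → E,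
      Continuous ℓ' ∧ Continuous g' ∧ (∀ t, HasDerivAt ℓ (ℓ' t) t) ∧
      (∀ t, HasDerivAt g (g' t) t) ∧ (∀ t, ℓ t ∈ K) ∧ (∀ t, ℓ' t ∈ K) ∧
      (∀ t, ℓ' t + g t = A (ℓ t) + B (ℓ t) (ℓ t)) ∧
      ℓ t₀ = p₀ ∧ g t₀ = 0 ∧ ℓ t₁ = p₁ ∧ g t₁ = 0 ∧
      ∀ t ∈ Icc t₀ t₁, ‖ℓ t + (f + b (g t))‖ ≤ M := by
  have hA0 : 0 ≤ ‖A‖ := norm_nonneg A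
  have hB0 : 0 ≤ ‖B‖ := norm_nonneg B
  have hAB : ∀ x r, ‖x‖ ≤ r → ‖A x + B x x‖ ≤ ‖A‖ * r + ‖B‖ * r * r := by
    intro x r hx
    refine (norm_add_le _ _).trans (add_le_add ((A.le_opNorm x).trans ?_)
      ((B.le_opNorm₂ x x).trans ?_))
    · gcongr
    · have := (norm_nonneg x).trans hx
      gcongr
  obtain ⟨V, hV⟩ : ∃ V, V = R + (‖A‖ * R + ‖B‖ * R * R) := ⟨_, rfl⟩
  have hV0 : 0 ≤ V := by rw [hV]; positivity
  have hRV : R ≤ V := by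
    have : 0 ≤ ‖A‖ * R + ‖B‖ * R * R := by positivity
    linarith
  obtain ⟨C, hC0, hC⟩ := exists_hermite K ht hV0
  refine ⟨C + (‖f‖ + ‖b‖ * (‖A‖ * C + ‖B‖ * C * C + C)), fun p₀ hp₀ p₁ hp₁ n₀ n₁ => ?_⟩
  -- The end velocities are those of the unforced equation, so that `g` vanishes at both ends and
  -- the high part is exactly `f` there. A second derivative of `ℓ` is required because the path
  -- contains `b g`, and `g` contains `ℓ'`.
  obtain ⟨ℓ, ℓ', ℓ'', hc, hd, hd', hK, hK', e0, e0', e1, e1', hb⟩ := hC p₀ hp₀ (A p₀ + B p₀ p₀)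
    (K.add_mem (hA _) (hB _ _)) p₁ hp₁ (A p₁ + B p₁ p₁) (K.add_mem (hA _) (hB _ _))
    (n₀.trans hRV) ((hAB _ _ n₀).trans (by linarith)) (n₁.trans hRV)
    ((hAB _ _ n₁).trans (by linarith))
  have hcℓ : Continuous ℓ := continuous_iff_continuousAt.2 fun t => (hd t).continuousAt
  have hcℓ' : Continuous ℓ' := continuous_iff_continuousAt.2 fun t => (hd' t).continuousAt
  refine ⟨ℓ, ℓ', fun t => A (ℓ t) + B (ℓ t) (ℓ t) - ℓ' t,
    fun t => A (ℓ' t) + (B (ℓ' t) (ℓ t) + B (ℓ t) (ℓ' t)) - ℓ'' t, hcℓ', ?_, hd, fun t => ?_, hK, hK',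
    fun t => add_sub_cancel _ _, e0, ?_, e1, ?_, fun t htt => ?_⟩
  · exact ((A.continuous.comp hcℓ').add (((B.continuous.comp hcℓ').clm_apply hcℓ).add
      ((B.continuous.comp hcℓ).clm_apply hcℓ'))).sub hc
  · have h1 : HasDerivAt (fun t => A (ℓ t)) (A (ℓ' t)) t := A.hasFDerivAt.comp_hasDerivAt t (hd t)
    have h2 : HasDerivAt (fun t => B (ℓ t)) (B (ℓ' t)) t := B.hasFDerivAt.comp_hasDerivAt t (hd t)
    exact (h1.add (h2.clm_apply (hd t))).sub (hd' t)
  · simp only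
    rw [e0, e0', sub_self]
  · simp only
    rw [e1, e1', sub_self]
  · obtain ⟨b1, b2⟩ := hb t htt
    refine (norm_add_le _ _).trans (add_le_add b1 ((norm_add_le _ _).trans (add_le_add le_rfl ?_)))
    refine (b.le_opNorm _).trans ?_
    gcongr
    exact (norm_sub_le _ _).trans (add_le_add (hAB _ _ b1) b2)

/-- The fields with low modes only. -/
def lowFields (N : ℕ) : Submodule ℝ H where
  carrier := {a | ∀ k, ¬ IsLow N k → coef a k = 0}
  zero_mem' := fun k _ => coef_zero k
  add_mem' := fun {a b} ha hb k hk => by rw [coef_add, ha k hk, hb k hk, add_zero]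
  smul_mem' := fun c a ha k hk => by rw [coef_smul, ha k hk, smul_zero]

theorem lowDiag_mem (N : ℕ) (m : ZStar → ℝ) (a : H) : lowDiag N m a ∈ lowFields N :=
  fun _ hk => coef_lowDiag_of_not_isLow m a hk

/-- Exact steering between two fields that differ by low modes only. -/
theorem exists_reach_low {α₀ : ℝ} {N₀ : ℕ} {Q : H →L[ℝ] H} (hQ : NoiseAssumption α₀ N₀ Q)
    (hα : 3 / 2 < 2 * α₀ + 1 / 2) {S : Set ZStar} {f : H} {b : H →L[ℝ] H} (hS : S.Finite)
    (hSlow : ∀ k ∈ S, ¬ IsLow N₀ k) (hf : ∀ k ∉ S, coef f k = 0)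
    (hb : ∀ g, ∀ k ∉ S, coef (b g) k = 0)
    (hforce : ∀ ℓ g : H, (∀ k, ¬ IsLow N₀ k → coef ℓ k = 0) → ∀ k, IsLow N₀ k →
        ‖kvec k‖ • coef (bilin hα (ℓ + (f + b g)) (ℓ + (f + b g))) k =
          ‖kvec k‖ • coef (bilin hα ℓ ℓ) k + coef g k)
    {t₀ t₁ : ℝ} (ht : t₀ < t₁) {R : ℝ} (hR : 0 ≤ R) :
    ∃ M, ∀ p₀ ∈ lowFields N₀, ∀ p₁ ∈ lowFields N₀, ‖p₀‖ ≤ R → ‖p₁‖ ≤ R →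
      Reach hα Q M t₀ t₁ (p₀ + f) (p₁ + f) := by
  obtain ⟨M, hM⟩ := exists_interpolation (-lowDiag N₀ fun k => ‖kvec k‖ ^ 2) b (lowBilin hα N₀) f
    (lowFields N₀) (fun x => Submodule.neg_mem _ (lowDiag_mem N₀ _ x))
    (fun x y => by
      rw [lowBilin_apply]
      exact Submodule.neg_mem _ (lowDiag_mem N₀ _ _)) ht hR
  refine ⟨M, fun p₀ hp₀ p₁ hp₁ n₀ n₁ => ?_⟩
  obtain ⟨ℓ, ℓ', g, g', hc, hc', hd, hd', hK, hK', heq, e0, e0', e1, e1', hbd⟩ :=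
    hM p₀ hp₀ p₁ hp₁ n₀ n₁
  have hderiv : ∀ t, HasDerivAt (fun t => ℓ t + (f + b (g t))) (ℓ' t + b (g' t)) t := fun t =>
    (hd t).add ((b.hasFDerivAt.comp_hasDerivAt t (hd' t)).const_add f)
  have hcont : Continuous fun t => ℓ t + (f + b (g t)) :=
    continuous_iff_continuousAt.2 fun t => (hderiv t).continuousAt
  have hDc : Continuous fun t => ℓ' t + b (g' t) := hc.add (b.continuous.comp hc')
  have hnS : ∀ k, IsLow N₀ k → k ∉ S := fun k hk hkS => hSlow k hkS hk
  obtain ⟨w, hw⟩ := exists_isControlled_of_finite hQ hα (s := t₀) (t := t₁)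
    (hS.union (finite_isLow N₀))
    hcont.continuousOn hDc.continuousOn
    (fun σ _ => (hderiv σ).hasDerivWithinAt)
    (fun σ _ k hk => by
      simp only [mem_union, not_or, mem_ofPred_eq] at hk
      rw [coef_add, coef_add, hK σ k hk.2, hf k hk.1, hb _ k hk.1]
      simp)
    (fun σ _ k hk => by
      simp only [mem_union, not_or, mem_ofPred_eq] at hk
      rw [coef_add, hK' σ k hk.2, hb _ k hk.1, add_zero])
    (fun k hk σ _ => by
      rw [hforce (ℓ σ) (g σ) (hK σ) k hk]
      have h1 := congrArg (fun x => coef x k) (heq σ)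
      simp only [neg_apply, lowBilin_apply, coef_add, coef_neg, coef_lowDiag_of_isLow _ _ hk] at h1
      simp only [coef_add, hf k (hnS k hk), hb _ k (hnS k hk), add_zero]
      rw [eq_sub_of_add_eq h1]
      abel)
  refine ⟨_, w, hw, ?_, ?_, fun σ hσ => hbd σ hσ⟩
  · simp only [e0, e0', map_zero, add_zero]
  · simp only [e1, e1', map_zero, add_zero]

/-! ### The final approach to the target -/

theorem exists_low_add_high (N : ℕ) (a : H) : ∃ p q : H, p ∈ lowFields N ∧
    (∀ k, IsLow N k → coef q k = 0) ∧ p + q = a ∧ ‖p‖ ≤ ‖a‖ ∧ ‖q‖ ≤ ‖a‖ ∧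
    (∀ k, ¬ IsLow N k → coef q k = coef a k) := by
  classical
  have hp : ∀ k, coef (lowDiag N (fun _ => 1) a) k = if IsLow N k then coef a k else 0 := by
    intro k
    rw [coef_lowDiag]
    split_ifs <;> simp
  have hq : ∀ k, coef (a - lowDiag N (fun _ => 1) a) k = if IsLow N k then 0 else coef a k := by
    intro k
    rw [coef_sub, hp]
    split_ifs <;> simp
  refine ⟨lowDiag N (fun _ => 1) a, a - lowDiag N (fun _ => 1) a, lowDiag_mem _ _ _,
    fun k hk => by rw [hq, if_pos hk], add_sub_cancel _ _, ?_, ?_, fun k hk => by rw [hq, if_neg hk]⟩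
  · rw [← one_mul ‖a‖]
    refine norm_le_of_coef_le zero_le_one fun k => ?_
    rw [hp]
    split_ifs <;> simp
  · rw [← one_mul ‖a‖]
    refine norm_le_of_coef_le zero_le_one fun k => ?_
    rw [hq]
    split_ifs <;> simp

/-- The high modes move linearly from `f` to those of `y`, and the low ones solve their ODE
backwards from the low part of `y`. The low part `p` at the beginning cannot be prescribed, only
bounded; `exists_reach_low` is what arrives there. -/
theorem exists_reach_target {α₀ : ℝ} {N₀ : ℕ} {Q : H →L[ℝ] H} (hQ : NoiseAssumption α₀ N₀ Q)
    (hα : 3 / 2 < 2 * α₀ + 1 / 2) {S : Set ZStar} {f : H} (hS : S.Finite)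
    (hSlow : ∀ k ∈ S, ¬ IsLow N₀ k) (hf : ∀ k ∉ S, coef f k = 0) {R : ℝ} (hR : 0 ≤ R)
    (hfR : ‖f‖ ≤ R) :
    ∃ δ > 0, ∀ t₀ t₁ : ℝ, t₀ < t₁ → t₁ - t₀ ≤ δ → ∀ y : H, ‖y‖ ≤ R →
      ∀ F : Set ZStar, F.Finite → (∀ k ∉ F, coef y k = 0) →
      ∃ p ∈ lowFields N₀, ‖p‖ ≤ R + 1 ∧ Reach hα Q (R + 1 + R) t₀ t₁ (p + f) y := by
  obtain ⟨δ, hδ, hode⟩ := exists_low_ode hα N₀ hR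
  refine ⟨δ, hδ, fun t₀ t₁ ht hle y hy F hF hyF => ?_⟩
  obtain ⟨p, q, hp, hq, hpq, np, nq, hqc⟩ := exists_low_add_high N₀ y
  obtain ⟨τ, hτ⟩ : ∃ τ, τ = t₁ - t₀ := ⟨_, rfl⟩
  have hτ0 : 0 < τ := by rw [hτ]; linarith
  obtain ⟨η, hη⟩ : ∃ η : ℝ → H, ∀ t, η t = f + ((t - t₀) / τ) • (q - f) := ⟨_, fun _ => rfl⟩
  have hηd : ∀ t, HasDerivAt η ((1 / τ) • (q - f)) t := by
    intro t
    rw [funext hη]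
    exact ((((hasDerivAt_id t).sub_const t₀).div_const τ).smul_const (q - f)).const_add f
  have hηc : Continuous η := continuous_iff_continuousAt.2 fun t => (hηd t).continuousAt
  have hηR : ∀ t ∈ Icc t₀ t₁, ‖η t‖ ≤ R := by
    intro t htt
    have h0 : 0 ≤ (t - t₀) / τ := div_nonneg (by linarith [htt.1]) hτ0.le
    have h1 : (t - t₀) / τ ≤ 1 := by rw [div_le_one hτ0, hτ]; linarith [htt.2]
    have : η t = (1 - (t - t₀) / τ) • f + ((t - t₀) / τ) • q := by
      rw [hη]
      module
    rw [this]
    refine (norm_add_le _ _).trans ?_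
    rw [norm_smul, norm_smul, Real.norm_of_nonneg h0, Real.norm_of_nonneg (by linarith)]
    nlinarith [nq.trans hy]
  have hηlow : ∀ t k, IsLow N₀ k → coef (η t) k = 0 := by
    intro t k hk
    have h1 := hf k fun hkS => hSlow k hkS hk
    rw [hη, coef_add, coef_smul, coef_sub, hq k hk, h1]
    simp
  obtain ⟨ℓ, D, e1, hℓc, hDc, hℓd, heq, hℓK, hDK, hℓn⟩ := hode t₀ t₁ t₁ ⟨ht.le, le_rfl⟩ hle η
    hηc.continuousOn hηR p (np.trans hy) hp
  have hfin : ((S ∪ F) ∪ {k | IsLow N₀ k}).Finite := (hS.union hF).union (finite_isLow N₀)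
  have hqS : ∀ k, k ∉ S ∪ F ∪ {k | IsLow N₀ k} → coef q k = 0 ∧ coef f k = 0 ∧ ¬ IsLow N₀ k := by
    intro k hk
    simp only [mem_union, not_or, mem_ofPred_eq] at hk
    exact ⟨by rw [hqc k hk.2, hyF k hk.1.2], hf k hk.1.1, hk.2⟩
  obtain ⟨w, hw⟩ := exists_isControlled_of_finite hQ hα (s := t₀) (t := t₁)
    (a := fun t => ℓ t + η t) (D := fun t => D t + (1 / τ) • (q - f)) hfin
    (hℓc.add hηc.continuousOn) (hDc.add continuousOn_const)
    (fun σ hσ => (hℓd σ hσ).add (hηd σ).hasDerivWithinAt)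
    (fun σ hσ k hk => by
      obtain ⟨h1, h2, h3⟩ := hqS k hk
      rw [coef_add, hℓK σ hσ k h3, hη, coef_add, coef_smul, coef_sub, h1, h2]
      simp)
    (fun σ hσ k hk => by
      obtain ⟨h1, h2, h3⟩ := hqS k hk
      rw [coef_add, hDK σ hσ k h3, coef_smul, coef_sub, h1, h2]
      simp)
    (fun k hk σ hσ => by
      have h1 := hf k fun hkS => hSlow k hkS hk
      rw [coef_add, coef_smul, coef_sub, hq k hk, h1, coef_add, hηlow σ k hk]
      simpa using heq σ hσ k hk)
  refine ⟨ℓ t₀, hℓK t₀ ⟨le_rfl, ht.le⟩, hℓn t₀ ⟨le_rfl, ht.le⟩, _, w, hw, ?_, ?_, fun σ hσ =>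
    (norm_add_le _ _).trans (add_le_add (hℓn σ hσ) (hηR σ hσ))⟩
  · simp [hη]
  · simp only [e1, hη]
    rw [← hτ, div_self hτ0.ne', one_smul, add_sub_cancel, hpq]

/-! ### Reaching the steady high modes -/

theorem sobSq_add_le (s : ℝ) (u v : H) : sobSq s (u + v) ≤ 2 * (sobSq s u + sobSq s v) := by
  unfold sobSq
  rw [← ENNReal.tsum_add, ← ENNReal.tsum_mul_left]
  refine ENNReal.tsum_le_tsum fun k => ?_
  refine le_trans ?_ (ENNReal_add_sq_le _ _)
  rw [← mul_add, coef_add]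
  gcongr
  exact enorm_add_le _ _

theorem sobSq_smul_le (s : ℝ) {c : ℝ} (hc : |c| ≤ 1) (u : H) : sobSq s (c • u) ≤ sobSq s u := by
  unfold sobSq
  refine ENNReal.tsum_le_tsum fun k => ?_
  rw [coef_smul]
  gcongr
  rw [← ofReal_norm, ← ofReal_norm, norm_smul]
  refine ENNReal.ofReal_le_ofReal (mul_le_of_le_one_left (norm_nonneg _) hc)

theorem exists_sobSq_le (s : ℝ) {S : Set ZStar} (hS : S.Finite) {M : ℝ} :
    ∃ C : ℝ≥0∞, C ≠ ⊤ ∧ ∀ u : H, (∀ k ∉ S, coef u k = 0) → ‖u‖ ≤ M → sobSq s u ≤ C := by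
  refine ⟨∑ k ∈ hS.toFinset, (wt s k * ENNReal.ofReal M) ^ 2,
    (ENNReal.sum_lt_top.2 fun k _ => ENNReal.pow_lt_top
      (ENNReal.mul_lt_top ENNReal.ofReal_lt_top ENNReal.ofReal_lt_top)).ne, fun u hu hM => ?_⟩
  rw [sobSq, tsum_eq_sum (s := hS.toFinset)]
  · refine Finset.sum_le_sum fun k _ => ?_
    gcongr
    rw [← ofReal_norm]
    exact ENNReal.ofReal_le_ofReal ((norm_coef_le _ _).trans hM)
  · intro k hk
    rw [hu k (by simpa using hk)]
    simp

theorem sobSq_ne_top_of_finite (s : ℝ) {S : Set ZStar} (hS : S.Finite) {u : H}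
    (hu : ∀ k ∉ S, coef u k = 0) : sobSq s u ≠ ⊤ := by
  obtain ⟨C, hC, h⟩ := exists_sobSq_le s hS (M := ‖u‖)
  exact ne_top_of_le_ne_top hC (h u hu le_rfl)

theorem lintegral_exp_sq_le {t₀ t₁ : ℝ} (ht : t₀ ≤ t₁) {l : ℝ} (hl : 0 ≤ l) :
    ∫⁻ σ in Icc t₀ t₁, ENNReal.ofReal (l * Real.exp (-((σ - t₀) * l)) ^ 2) ≤ 1 := by
  -- The explicit primitive gives a bound independent of `l`, which is the parabolic gain of one
  -- derivative.
  have hd : ∀ σ, HasDerivAt (fun σ => -(1 / 2) * Real.exp (-((σ - t₀) * l)) ^ 2)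
      (l * Real.exp (-((σ - t₀) * l)) ^ 2) σ := by
    intro σ
    have h1 : HasDerivAt (fun σ : ℝ => -((σ - t₀) * l)) (-(1 * l)) σ :=
      (((hasDerivAt_id σ).sub_const t₀).mul_const l).fun_neg
    refine ((h1.exp.fun_pow 2).const_mul (-(1 / 2))).congr_deriv ?_
    simp
    ring
  have hc : Continuous fun σ => l * Real.exp (-((σ - t₀) * l)) ^ 2 := by fun_prop
  rw [← Measure.restrict_congr_set Ioc_ae_eq_Icc, ← ofReal_integral_eq_lintegral_ofReal
    ((hc.integrableOn_Icc).mono_set Ioc_subset_Icc_self) (Eventually.of_forall fun σ => by positivity),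
    ← intervalIntegral.integral_of_le ht,
    intervalIntegral.integral_eq_sub_of_hasDerivAt (fun σ _ => hd σ) (hc.intervalIntegrable _ _)]
  rw [ENNReal.ofReal_le_one]
  have := Real.exp_pos (-((t₁ - t₀) * l))
  simp only [sub_self, zero_mul, neg_zero, Real.exp_zero]
  nlinarith [sq_nonneg (Real.exp (-((t₁ - t₀) * l)))]

theorem wt_two_sq (k : ZStar) : wt 2 k ^ 2 = ENNReal.ofReal (‖kvec k‖ ^ 2) * wt 1 k ^ 2 := by
  have h : wt 2 k = wt 1 k * wt 1 k := by rw [← wt_add]; norm_num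
  rw [h, wt_one, ENNReal.ofReal_pow (norm_nonneg _), ofReal_norm]
  ring

/-- Parabolic smoothing: `∫ |A e^{-tA} z|² dt ≤ |A^{1/2} z|²`. -/
theorem lintegral_sobSq_heat_le {t₀ t₁ : ℝ} (ht : t₀ ≤ t₁) (z : H) :
    ∫⁻ σ in Icc t₀ t₁, sobSq 2 (heat (σ - t₀) z) ≤ sobSq 1 z := by
  have hpt : ∀ σ ∈ Icc t₀ t₁, sobSq 2 (heat (σ - t₀) z) ≤ ∑' k,
      ENNReal.ofReal (‖kvec k‖ ^ 2 * Real.exp (-((σ - t₀) * ‖kvec k‖ ^ 2)) ^ 2)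
        * (wt 1 k * ‖coef z k‖ₑ) ^ 2 := by
    intro σ hσ
    refine ENNReal.tsum_le_tsum fun k => le_of_eq ?_
    rw [coef_heat (by linarith [hσ.1]), mul_pow, wt_two_sq, enorm_smul, mul_pow, mul_pow,
      ENNReal.ofReal_mul (by positivity), ENNReal.ofReal_pow (Real.exp_nonneg _),
      ← ofReal_norm (Real.exp _), Real.norm_of_nonneg (Real.exp_nonneg _)]
    ring
  refine (setLIntegral_mono' measurableSet_Icc hpt).trans ?_
  rw [lintegral_tsum]
  · refine ENNReal.tsum_le_tsum fun k => ?_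
    rw [lintegral_mul_const']
    · exact mul_le_of_le_one_left' (lintegral_exp_sq_le ht (by positivity))
    · exact ENNReal.pow_ne_top (ENNReal.mul_ne_top ENNReal.ofReal_ne_top enorm_ne_top)
  · intro k
    refine (Measurable.mul_const ?_ _).aemeasurable
    exact (Continuous.measurable (by fun_prop)).ennreal_ofReal

/-- The derivative of the `k`-th coefficient of `(1 - r) e^{-(σ-t₀)A} q + r f`,
`r = (σ - t₀) / τ`. -/
def switchDeriv (t₀ τ : ℝ) (q f : H) (k : ZStar) (σ : ℝ) : E3 :=
  ((1 - (σ - t₀) / τ) * (Real.exp (-((σ - t₀) * ‖kvec k‖ ^ 2)) * -(1 * ‖kvec k‖ ^ 2))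
      + -(1 / τ) * Real.exp (-((σ - t₀) * ‖kvec k‖ ^ 2))) • coef q k + (1 / τ) • coef f k

theorem hasDerivAt_switch (t₀ τ : ℝ) (q f : H) (k : ZStar) (σ : ℝ) :
    HasDerivAt (fun σ => ((1 - (σ - t₀) / τ) * Real.exp (-((σ - t₀) * ‖kvec k‖ ^ 2))) • coef q k
      + ((σ - t₀) / τ) • coef f k) (switchDeriv t₀ τ q f k σ) σ := by
  have h0 : HasDerivAt (fun σ : ℝ => (σ - t₀) / τ) (1 / τ) σ :=
    ((hasDerivAt_id σ).sub_const t₀).div_const τ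
  have h1 : HasDerivAt (fun σ : ℝ => -((σ - t₀) * ‖kvec k‖ ^ 2)) (-(1 * ‖kvec k‖ ^ 2)) σ :=
    (((hasDerivAt_id σ).sub_const t₀).mul_const _).fun_neg
  have h2 := ((h0.const_sub 1).fun_mul h1.exp).smul_const (coef q k)
  refine (h2.add (h0.smul_const (coef f k))).congr_deriv ?_
  unfold switchDeriv
  rw [add_comm (-(1 / τ) * _)]

theorem continuous_switchDeriv (t₀ τ : ℝ) (q f : H) (k : ZStar) :
    Continuous (switchDeriv t₀ τ q f k) := by
  unfold switchDeriv
  fun_prop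

theorem switchDeriv_mem (t₀ τ : ℝ) (q f : H) (k : ZStar) (σ : ℝ) :
    switchDeriv t₀ τ q f k σ ∈ kperp k :=
  Submodule.add_mem _ (Submodule.smul_mem _ _ (coef_mem _ _))
    (Submodule.smul_mem _ _ (coef_mem _ _))

/-- The Stokes flow solves the linear equation, so the terms `|k|² q` cancel and only the derivative
of the cut-off acts on `q`. One derivative of `q` is therefore enough, while three fall on `f`,
which has finitely many modes. -/
theorem enorm_switch_residual_le {t₀ τ σ : ℝ} (hτ : 0 < τ) (hσ : t₀ ≤ σ) (hσ' : σ - t₀ ≤ τ)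
    (q f : H) (k : ZStar) :
    wt 1 k * ‖switchDeriv t₀ τ q f k σ + ‖kvec k‖ ^ 2 •
      (((1 - (σ - t₀) / τ) * Real.exp (-((σ - t₀) * ‖kvec k‖ ^ 2))) • coef q k
        + ((σ - t₀) / τ) • coef f k)‖ₑ ≤
    ENNReal.ofReal (1 / τ + 1) * (wt 1 k * ‖coef q k‖ₑ + wt 3 k * ‖coef f k‖ₑ) := by
  have hn := one_le_norm_kvec k
  have hn2 : 1 ≤ ‖kvec k‖ ^ 2 := one_le_pow₀ hn
  have hr0 : 0 ≤ (σ - t₀) / τ := div_nonneg (by linarith) hτ.le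
  have hr1 : (σ - t₀) / τ ≤ 1 := (div_le_one hτ).2 hσ'
  have hE : Real.exp (-((σ - t₀) * ‖kvec k‖ ^ 2)) ≤ 1 := by
    rw [Real.exp_le_one_iff, neg_nonpos]
    exact mul_nonneg (by linarith) (by positivity)
  have hE0 := Real.exp_pos (-((σ - t₀) * ‖kvec k‖ ^ 2))
  have h1τ : 0 < 1 / τ := by positivity
  have heq : switchDeriv t₀ τ q f k σ + ‖kvec k‖ ^ 2 •
      (((1 - (σ - t₀) / τ) * Real.exp (-((σ - t₀) * ‖kvec k‖ ^ 2))) • coef q k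
        + ((σ - t₀) / τ) • coef f k) =
      (-(1 / τ) * Real.exp (-((σ - t₀) * ‖kvec k‖ ^ 2))) • coef q k
        + (1 / τ + (σ - t₀) / τ * ‖kvec k‖ ^ 2) • coef f k := by
    unfold switchDeriv
    module
  have hle : ‖(-(1 / τ) * Real.exp (-((σ - t₀) * ‖kvec k‖ ^ 2))) • coef q k
        + (1 / τ + (σ - t₀) / τ * ‖kvec k‖ ^ 2) • coef f k‖ ≤
      (1 / τ + 1) * (‖coef q k‖ + ‖kvec k‖ ^ 2 * ‖coef f k‖) := by
    refine (norm_add_le _ _).trans ?_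
    rw [mul_add]
    refine add_le_add ?_ ?_
    · rw [norm_smul, norm_mul, norm_neg, Real.norm_of_nonneg h1τ.le, Real.norm_of_nonneg hE0.le]
      gcongr
      nlinarith
    · rw [norm_smul, Real.norm_of_nonneg (by positivity), ← mul_assoc]
      gcongr
      nlinarith
  rw [heq]
  have h3 : wt 3 k = wt 1 k * ENNReal.ofReal (‖kvec k‖ ^ 2) := by
    have : wt 3 k = wt 1 k * (wt 1 k * wt 1 k) := by
      rw [← wt_add, ← wt_add]
      norm_num
    rw [this, wt_one, ENNReal.ofReal_pow (norm_nonneg _), ofReal_norm, sq]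
  calc _ ≤ wt 1 k * ENNReal.ofReal ((1 / τ + 1) * (‖coef q k‖ + ‖kvec k‖ ^ 2 * ‖coef f k‖)) := by
        gcongr
        rw [← ofReal_norm]
        exact ENNReal.ofReal_le_ofReal hle
    _ = _ := by
        rw [ENNReal.ofReal_mul (by positivity), ENNReal.ofReal_add (norm_nonneg (coef q k))
          (by positivity), ENNReal.ofReal_mul (sq_nonneg ‖kvec k‖), ofReal_norm, ofReal_norm, h3]
        ring

/-- Linear interpolation from `q` to `f` would leave `A q` in the residual, which is too rough when
`q` has infinitely many modes. The high part follows `(1 - r) e^{-(t-t₀)A} q + r f` instead: its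
linear residual needs `q ∈ V_1` only, and parabolic smoothing from `V_1` puts the path in `L²` in
time with values in `V_2`, as the nonlinear residual requires. -/
theorem exists_reach_steady {α₀ : ℝ} {N₀ : ℕ} {Q : H →L[ℝ] H} (hQ : NoiseAssumption α₀ N₀ Q)
    (hα : 3 / 2 < 2 * α₀ + 1 / 2) {S : Set ZStar} {f : H} (hS : S.Finite)
    (hSlow : ∀ k ∈ S, ¬ IsLow N₀ k) (hf : ∀ k ∉ S, coef f k = 0) {R : ℝ} (hR : 0 ≤ R)
    (hfR : ‖f‖ ≤ R) :
    ∃ δ > 0, ∀ t₀ t₁ : ℝ, t₀ < t₁ → t₁ - t₀ ≤ δ → ∀ z : H, ‖z‖ ≤ R → sobSq 1 z ≠ ⊤ →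
      ∃ p ∈ lowFields N₀, ‖p‖ ≤ R + 1 ∧ Reach hα Q (R + 1 + R) t₀ t₁ z (p + f) := by
  obtain ⟨δ, hδ, hode⟩ := exists_low_ode hα N₀ hR
  refine ⟨δ, hδ, fun t₀ t₁ ht hle z hz hzs => ?_⟩
  obtain ⟨p, q, hp, hq, hpq, np, nq, hqc⟩ := exists_low_add_high N₀ z
  have hqle : ∀ k, ‖coef q k‖ₑ ≤ ‖coef z k‖ₑ := by
    intro k
    by_cases hk : IsLow N₀ k
    · rw [hq k hk]
      simp
    · rw [hqc k hk]
  have hqs : sobSq 1 q ≠ ⊤ := ne_top_of_le_ne_top hzs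
    (ENNReal.tsum_le_tsum fun k => pow_le_pow_left' (mul_le_mul' le_rfl (hqle k)) 2)
  have hflow : ∀ k, IsLow N₀ k → coef f k = 0 := fun k hk => hf k fun hkS => hSlow k hkS hk
  obtain ⟨τ, hτ⟩ : ∃ τ, τ = t₁ - t₀ := ⟨_, rfl⟩
  have hτ0 : 0 < τ := by rw [hτ]; linarith
  have hr : ∀ t ∈ Icc t₀ t₁, 0 ≤ (t - t₀) / τ ∧ (t - t₀) / τ ≤ 1 := fun t htt =>
    ⟨div_nonneg (by linarith [htt.1]) hτ0.le, by rw [div_le_one hτ0, hτ]; linarith [htt.2]⟩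
  obtain ⟨η, hη⟩ : ∃ η : ℝ → H, ∀ t, η t =
      (1 - (t - t₀) / τ) • heat (t - t₀) q + ((t - t₀) / τ) • f := ⟨_, fun _ => rfl⟩
  have hηcoef : ∀ t ∈ Icc t₀ t₁, ∀ k, coef (η t) k =
      ((1 - (t - t₀) / τ) * Real.exp (-((t - t₀) * ‖kvec k‖ ^ 2))) • coef q k
        + ((t - t₀) / τ) • coef f k := by
    intro t htt k
    rw [hη, coef_add, coef_smul, coef_smul, coef_heat (by linarith [htt.1]), smul_smul]
  have hηc : ContinuousOn η (Icc t₀ t₁) := by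
    rw [funext hη]
    have h1 : ContinuousOn (fun t => heat (t - t₀) q) (Icc t₀ t₁) :=
      (continuousOn_heat q).comp (by fun_prop) fun t htt => by
        simp only [mem_Ici]
        linarith [htt.1]
    have h2 : Continuous fun t : ℝ => (t - t₀) / τ := by fun_prop
    exact ((continuous_const.sub h2).continuousOn.smul h1).add
      (h2.continuousOn.smul continuousOn_const)
  have hηR : ∀ t ∈ Icc t₀ t₁, ‖η t‖ ≤ R := by
    intro t htt
    obtain ⟨h0, h1⟩ := hr t htt
    have hh : ‖heat (t - t₀) q‖ ≤ R := by
      refine ((heat (t - t₀)).le_opNorm q).trans ?_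
      have := norm_heat_le (t := t - t₀) (by linarith [htt.1])
      have := nq.trans hz
      nlinarith [norm_nonneg q]
    rw [hη]
    refine (norm_add_le _ _).trans ?_
    rw [norm_smul, norm_smul, Real.norm_of_nonneg h0, Real.norm_of_nonneg (by linarith)]
    nlinarith
  have hηlow : ∀ t ∈ Icc t₀ t₁, ∀ k, IsLow N₀ k → coef (η t) k = 0 := by
    intro t htt k hk
    rw [hηcoef t htt, hq k hk, hflow k hk]
    simp
  obtain ⟨ℓ, D, e0, hℓc, hDc, hℓd, heq, hℓK, hDK, hℓn⟩ := hode t₀ t₁ t₀ ⟨le_rfl, ht.le⟩ hle η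
    hηc hηR p (np.trans hz) hp
  obtain ⟨C₁, hC₁, hC₁'⟩ := exists_sobSq_le 2 (finite_isLow N₀) (M := R + 1)
  have hf2 := sobSq_ne_top_of_finite 2 hS hf
  have hf3 := sobSq_ne_top_of_finite 3 hS hf
  obtain ⟨w, hw⟩ := exists_isControlled_of_sobSq hQ hα (s := t₀) (t := t₁)
    (a := fun t => ℓ t + η t) (d := fun k σ => coef (D σ) k + switchDeriv t₀ τ q f k σ)
    (hℓc.add hηc)
    (fun k => ((continuous_coef k).comp_continuousOn hDc).add
      (continuous_switchDeriv t₀ τ q f k).continuousOn)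
    (fun k σ => Submodule.add_mem _ (coef_mem _ _) (switchDeriv_mem t₀ τ q f k σ))
    (fun k σ hσ => by
      have h1 : HasDerivWithinAt (fun σ => coef (ℓ σ) k) (coef (D σ) k) (Icc t₀ t₁) σ :=
        (coefL k).hasFDerivAt.comp_hasDerivWithinAt σ (hℓd σ hσ)
      have h2 := (hasDerivAt_switch t₀ τ q f k σ).hasDerivWithinAt (s := Icc t₀ t₁)
      refine (h1.add h2).congr (fun t htt => ?_) ?_
      · simp only [coef_add, Pi.add_apply, hηcoef t htt]
      · simp only [coef_add, Pi.add_apply, hηcoef σ hσ])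
    (fun k hk σ hσ => by
      have h1 := heq σ hσ k hk
      have h2 : switchDeriv t₀ τ q f k σ = 0 := by
        rw [switchDeriv, hq k hk, hflow k hk]
        simp
      rw [h2, add_zero, coef_add, hηlow σ hσ k hk, add_zero]
      exact h1)
    (C := ENNReal.ofReal (1 / τ + 1) ^ 2 * (2 * (sobSq 1 q + sobSq 3 f)))
    (ENNReal.mul_ne_top (ENNReal.pow_ne_top ENNReal.ofReal_ne_top)
      (ENNReal.mul_ne_top (by norm_num) (ENNReal.add_ne_top.2 ⟨hqs, hf3⟩)))
    (fun σ hσ => by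
      have hk : ∀ k : {k // ¬ IsLow N₀ k}, (wt 1 k * ‖coef (D σ) k + switchDeriv t₀ τ q f k σ
          + ‖kvec k.1‖ ^ 2 • coef (ℓ σ + η σ) k‖ₑ) ^ 2 ≤ ENNReal.ofReal (1 / τ + 1) ^ 2 *
          (2 * ((wt 1 k * ‖coef q k‖ₑ) ^ 2 + (wt 3 k * ‖coef f k‖ₑ) ^ 2)) := by
        rintro ⟨k, hk⟩
        simp only
        rw [hDK σ hσ k hk, zero_add, coef_add, hℓK σ hσ k hk, zero_add, hηcoef σ hσ]
        refine (pow_le_pow_left' (enorm_switch_residual_le hτ0 hσ.1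
          (by rw [hτ]; linarith [hσ.2]) q f k) 2).trans ?_
        rw [mul_pow]
        gcongr
        exact ENNReal_add_sq_le _ _
      refine (ENNReal.tsum_le_tsum hk).trans ?_
      refine (ENNReal.tsum_comp_le_tsum_of_injective Subtype.val_injective
        (fun k : ZStar => ENNReal.ofReal (1 / τ + 1) ^ 2 *
          (2 * ((wt 1 k * ‖coef q k‖ₑ) ^ 2 + (wt 3 k * ‖coef f k‖ₑ) ^ 2)))).trans ?_
      rw [ENNReal.tsum_mul_left, ENNReal.tsum_mul_left, ENNReal.tsum_add]
      rfl)
    (by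
      have hpt : ∀ σ ∈ Icc t₀ t₁, sobSq 2 (ℓ σ + η σ) ≤
          (2 * C₁ + 4 * sobSq 2 f) + 4 * sobSq 2 (heat (σ - t₀) q) := by
        intro σ hσ
        obtain ⟨h0, h1⟩ := hr σ hσ
        refine (sobSq_add_le 2 _ _).trans ?_
        have b1 : sobSq 2 (ℓ σ) ≤ C₁ := hC₁' _ (hℓK σ hσ) (hℓn σ hσ)
        have b2 : sobSq 2 (η σ) ≤ 2 * (sobSq 2 (heat (σ - t₀) q) + sobSq 2 f) := by
          rw [hη]
          refine (sobSq_add_le 2 _ _).trans ?_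
          gcongr
          · exact sobSq_smul_le 2 (by rw [abs_le]; constructor <;> linarith) _
          · exact sobSq_smul_le 2 (by rw [abs_le]; constructor <;> linarith) _
        refine (mul_le_mul' le_rfl (add_le_add b1 b2)).trans (le_of_eq ?_)
        ring
      refine ne_top_of_le_ne_top ?_ (setLIntegral_mono' measurableSet_Icc hpt)
      rw [lintegral_add_left measurable_const, lintegral_const_mul' _ _ (by norm_num),
        lintegral_const]
      refine ENNReal.add_ne_top.2 ⟨ENNReal.mul_ne_top (ENNReal.add_ne_top.2
        ⟨ENNReal.mul_ne_top (by norm_num) hC₁, ENNReal.mul_ne_top (by norm_num) hf2⟩) (by simp),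
        ENNReal.mul_ne_top (by norm_num)
          (ne_top_of_le_ne_top hqs (lintegral_sobSq_heat_le ht.le q))⟩)
  refine ⟨ℓ t₁, hℓK t₁ ⟨ht.le, le_rfl⟩, hℓn t₁ ⟨ht.le, le_rfl⟩, _, w, hw, ?_, ?_, fun σ hσ =>
    (norm_add_le _ _).trans (add_le_add (hℓn σ hσ) (hηR σ hσ))⟩
  · simp only [e0, hη, sub_self, zero_div, sub_zero, one_smul, zero_smul, add_zero, heat_zero, hpq]
  · simp only [hη]
    rw [← hτ, div_self hτ0.ne', sub_self, zero_smul, one_smul, zero_add]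

/-! ### Approximate controllability -/

theorem Reach.norm_right_le {α : ℝ} {hα : 3 / 2 < α} {Q : H →L[ℝ] H} {M s t : ℝ} {x y : H}
    (h : Reach hα Q M s t x y) (hst : s ≤ t) : ‖y‖ ≤ M := by
  obtain ⟨a, w, -, -, rfl, h4⟩ := h
  exact h4 t ⟨hst, le_rfl⟩

/-- Exact controllability to targets with finitely many modes, with a bound on the path that
depends on the size of the data and on the time only. -/
theorem exists_reach {α₀ : ℝ} {N₀ : ℕ} {Q : H →L[ℝ] H} (hQ : NoiseAssumption α₀ N₀ Q)
    (hα : 3 / 2 < 2 * α₀ + 1 / 2) {R T : ℝ} (hR : 0 ≤ R) (hT : 0 < T) :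
    ∃ M, ∀ x y : H, ‖x‖ ≤ R → ‖y‖ ≤ R → ∀ F : Set ZStar, F.Finite → (∀ k ∉ F, coef y k = 0) →
      Reach hα Q M 0 T x y := by
  obtain ⟨S, f, b, hS, hSlow, hf, hb, hforce⟩ := exists_low_forcing hα hQ.one_le
  -- A common bound for the regularized field, whose norm is at most `R + 1`, for the steady field
  -- and for the target.
  obtain ⟨R₁, hR₁⟩ : ∃ R₁, R₁ = R + 1 + ‖f‖ := ⟨_, rfl⟩
  have hf0 := norm_nonneg f
  have hR₁0 : 0 ≤ R₁ := by linarith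
  have hfR : ‖f‖ ≤ R₁ := by linarith
  obtain ⟨τ₀, hτ₀, hfree⟩ := exists_reach_regular hα Q hR
  obtain ⟨δ₂, hδ₂, hsteady⟩ := exists_reach_steady hQ hα hS hSlow hf hR₁0 hfR
  obtain ⟨δ₄, hδ₄, htarget⟩ := exists_reach_target hQ hα hS hSlow hf hR₁0 hfR
  -- The legs are `[0,s]`, `[s,2σ]`, `[2σ,T-σ]` and `[T-σ,T]` with `s ≤ σ`. The second leg absorbs
  -- the dependence of `s` on `x`, so the steering interval, and with it `M₃`, is fixed before the
  -- data are given.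
  obtain ⟨σ, hσ0, hσ₁, hσ₂, hσ₄, hσT⟩ :
      ∃ σ, 0 < σ ∧ σ ≤ τ₀ ∧ 2 * σ ≤ δ₂ ∧ σ ≤ δ₄ ∧ 4 * σ ≤ T := by
    refine ⟨min (min τ₀ (δ₂ / 2)) (min δ₄ (T / 4)), by positivity, ?_, ?_, ?_, ?_⟩
    · exact (min_le_left _ _).trans (min_le_left _ _)
    · have := (min_le_left (min τ₀ (δ₂ / 2)) (min δ₄ (T / 4))).trans (min_le_right _ _)
      linarith
    · exact (min_le_right _ _).trans (min_le_left _ _)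
    · have := (min_le_right (min τ₀ (δ₂ / 2)) (min δ₄ (T / 4))).trans (min_le_right _ _)
      linarith
  obtain ⟨M₃, hM₃⟩ := exists_reach_low hQ hα hS hSlow hf hb hforce
    (show 2 * σ < T - σ by linarith) (show 0 ≤ R₁ + 1 by linarith)
  obtain ⟨M, hM1, hM2, hM3⟩ : ∃ M, R + 1 ≤ M ∧ R₁ + 1 + R₁ ≤ M ∧ M₃ ≤ M :=
    ⟨max (R + 1) (max (R₁ + 1 + R₁) M₃), le_max_left _ _,
      (le_max_left _ _).trans (le_max_right _ _), (le_max_right _ _).trans (le_max_right _ _)⟩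
  refine ⟨M, fun x y hx hy F hF hyF => ?_⟩
  obtain ⟨s, hs, z, h1, hz⟩ := hfree σ hσ0 hσ₁ x hx
  have hzR : ‖z‖ ≤ R₁ := (h1.norm_right_le hs.1.le).trans (by linarith)
  obtain ⟨p₀, hp₀, np₀, h2⟩ := hsteady s (2 * σ) (by linarith [hs.2]) (by linarith [hs.1]) z hzR hz
  obtain ⟨p₁, hp₁, np₁, h4⟩ := htarget (T - σ) T (by linarith) (by linarith) y (by linarith) F hF hyF
  have h3 := hM₃ p₀ hp₀ p₁ hp₁ np₀ np₁
  have h12 : Reach hα Q M 0 (2 * σ) x (p₀ + f) :=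
    (h1.mono hM1).trans hs.1.le (by linarith [hs.2]) (h2.mono hM2)
  have h123 : Reach hα Q M 0 (T - σ) x (p₁ + f) :=
    h12.trans (by linarith) (by linarith) (h3.mono hM3)
  exact h123.trans (by linarith) (by linarith) (h4.mono hM2)

/-! ### Return from weighted coordinates to `V_α` and to the weak equation. -/

theorem weight_coef_lift {α : ℝ} (hα : 0 ≤ α) (a : H) (k : ZStar) :
    ‖kvec k‖ ^ (2 * α) * ‖coef (lift α a) k‖ ^ 2 = ‖coef a k‖ ^ 2 := by
  have hk := norm_kvec_pos k
  rw [coef_lift hα, norm_smul, Real.norm_of_nonneg (by positivity), mul_pow, ← mul_assoc,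
    ← Real.rpow_natCast (‖kvec k‖ ^ (-α)), ← Real.rpow_mul hk.le, ← Real.rpow_add hk]
  norm_num
  rw [show 2 * α + -(α * 2) = 0 by ring, Real.rpow_zero, one_mul]

theorem memV_lift {α : ℝ} (hα : 0 ≤ α) (a : H) : MemV α (lift α a) := by
  unfold MemV
  simp only [weight_coef_lift hα]
  exact (hasSum_norm_coef_sq a).summable

theorem normV_lift {α : ℝ} (hα : 0 ≤ α) (a : H) : normV α (lift α a) = ‖a‖ := by
  unfold normV
  simp only [weight_coef_lift hα]
  rw [(hasSum_norm_coef_sq a).tsum_eq, Real.sqrt_sq (norm_nonneg _)]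

theorem exists_lift_eq {α : ℝ} (hα : 0 ≤ α) {x : H} (hx : MemV α x) : ∃ a, lift α a = x := by
  obtain ⟨a, ha⟩ := exists_coef_eq (fun k => ‖kvec k‖ ^ α • coef x k)
    (fun k => Submodule.smul_mem _ _ (coef_mem x k)) (by
      refine hx.congr fun k => ?_
      have hk := norm_kvec_pos k
      rw [norm_smul, Real.norm_of_nonneg (by positivity), mul_pow,
        ← Real.rpow_natCast (‖kvec k‖ ^ α), ← Real.rpow_mul hk.le, mul_comm (2 : ℝ)]
      norm_num)
  refine ⟨a, coef_injective fun k => ?_⟩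
  rw [coef_lift hα, ha, smul_smul, ← Real.rpow_add (norm_kvec_pos k), neg_add_cancel,
    Real.rpow_zero, one_smul]

/-- A partial Fourier sum. Its norm does not exceed that of `y`, so the bound on the path is
independent of `ε`. -/
theorem exists_truncation (y : H) {ε : ℝ} (hε : 0 < ε) : ∃ (F : Set ZStar) (z : H), F.Finite ∧
    (∀ k ∉ F, coef z k = 0) ∧ ‖z‖ ≤ ‖y‖ ∧ ‖z - y‖ ≤ ε := by
  classical
  obtain ⟨F, hF⟩ := (Metric.tendsto_nhds.1 (hasSum_mode y) ε hε).exists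
  have hc : ∀ k, coef (∑ l ∈ F, mode l ⟨coef y l, coef_mem y l⟩) k =
      if k ∈ F then coef y k else 0 := by
    intro k
    rw [coef_sum]
    split_ifs with h
    · rw [Finset.sum_eq_single_of_mem k h, coef_mode_self]
      intro l _ hl
      exact coef_mode_of_ne hl.symm _
    · refine Finset.sum_eq_zero fun l hl => coef_mode_of_ne ?_ _
      rintro rfl
      exact h hl
  refine ⟨↑F, _, F.finite_toSet, fun k hk => ?_, ?_, (dist_eq_norm _ y ▸ hF).le⟩
  · rw [hc, if_neg (by simpa using hk)]
  · rw [← one_mul ‖y‖]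
    refine norm_le_of_coef_le zero_le_one fun k => ?_
    rw [hc]
    split_ifs <;> simp

/-- Testing with `y e_k` is the functional `|k|^{-α} ⟨·, y⟩` on the weighted coefficient, and under
it the weights in `modeRhs` cancel. -/
theorem IsControlled.solvesNS {α : ℝ} {hα : 3 / 2 < α} {Q : H →L[ℝ] H} {T : ℝ} {a w : ℝ → H}
    (h : IsControlled hα Q 0 T a w) :
    SolvesNS T (fun t => lift α (a t)) (fun t => Q (w t)) := by
  have hα0 : 0 ≤ α := by linarith
  intro k y t ht
  obtain ⟨L, hL⟩ : ∃ L : E3 →L[ℝ] ℝ, ∀ v, L v = ‖kvec k‖ ^ (-α) * inner ℝ v (y : E3) :=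
    ⟨‖kvec k‖ ^ (-α) • innerSL ℝ (y : E3), fun v => by simp [real_inner_comm]⟩
  have hk := norm_kvec_pos k
  have hcoef : ∀ v, inner ℝ (lift α v) (mode k y) = L (coef v k) := by
    intro v
    rw [inner_mode, coef_lift hα0, real_inner_smul_left, hL]
  have hint : IntervalIntegrable (fun σ => modeRhs hα k (a σ) (Q (w σ))) volume 0 t := by
    refine IntegrableOn.intervalIntegrable ((integrableOn_modeRhs hα h.memLp h.continuousOn k).mono_set ?_)
    rw [uIcc_of_le ht.1]
    exact Icc_subset_Icc_right ht.2
  simp only [hcoef]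
  rw [← map_sub, h.eq k t ht, ← L.intervalIntegral_comp_comm hint]
  refine intervalIntegral.integral_congr fun σ _ => ?_
  simp only [modeRhs]
  rw [← inner_bcoef, inner_mode, coef_bilin, map_add, map_sub, map_neg, map_smul]
  simp only [hL, real_inner_smul_left, smul_eq_mul]
  have h1 : ‖kvec k‖ ^ (-α) * ‖kvec k‖ ^ α = 1 := by
    rw [← Real.rpow_add hk, neg_add_cancel, Real.rpow_zero]
  have h2 : ‖kvec k‖ * ‖kvec k‖ ^ (α - 1) = ‖kvec k‖ ^ α := by
    rw [Real.rpow_sub_one hk.ne', mul_div_cancel₀ _ hk.ne']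
  rw [← mul_assoc ‖kvec k‖, h2, ← mul_assoc (‖kvec k‖ ^ (-α)), ← mul_assoc (‖kvec k‖ ^ (-α)), h1]
  ring

end NSControl

end


open NSControl MeasureTheory Set in
theorem lemmal (α₀ : ℝ) (N₀ : ℕ) (Q : H →L[ℝ] H) (hQ : NoiseAssumption α₀ N₀ Q) :
    ∃ ρ₀ : ℝ → ℝ → ℝ → ℝ, ∀ T : ℝ, 0 < T → ∀ x y : H,
      MemV (2 * α₀ + 1 / 2) x → MemV (2 * α₀ + 1 / 2) y → ∀ ε : ℝ, 0 < ε →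
        ∃ u w : ℝ → H,
          MemLp w 2 (volume.restrict (Icc 0 T)) ∧
          ContinuousInV (2 * α₀ + 1 / 2) T u ∧
          u 0 = x ∧
          MemV (2 * α₀ + 1 / 2) (u T - y) ∧
          normV (2 * α₀ + 1 / 2) (u T - y) ≤ ε ∧
          (∀ t ∈ Icc 0 T, normV (2 * α₀ + 1 / 2) (u t) ≤
            ρ₀ (normV (2 * α₀ + 1 / 2) x) (normV (2 * α₀ + 1 / 2) y) T) ∧
          SolvesNS T u (fun t => Q (w t)) := by
  have hα : 3 / 2 < 2 * α₀ + 1 / 2 := by linarith [hQ.half_lt]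
  have hα0 : 0 ≤ 2 * α₀ + 1 / 2 := by linarith
  -- The sign conditions are placed after `M`, so that the choice yields a bound defined for all
  -- real `R` and `T`; its value outside the admissible range is immaterial.
  have hex : ∀ R T : ℝ, ∃ M, 0 ≤ R → 0 < T → ∀ x y : H, ‖x‖ ≤ R → ‖y‖ ≤ R →
      ∀ F : Set ZStar, F.Finite → (∀ k ∉ F, coef y k = 0) → Reach hα Q M 0 T x y := by
    intro R T
    by_cases h : 0 ≤ R ∧ 0 < T
    · obtain ⟨M, hM⟩ := exists_reach hQ hα h.1 h.2
      exact ⟨M, fun _ _ => hM⟩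
    · exact ⟨0, fun h1 h2 => absurd ⟨h1, h2⟩ h⟩
  choose M hM using hex
  refine ⟨fun r₁ r₂ T => M (max r₁ r₂) T, fun T hT x y hx hy ε hε => ?_⟩
  obtain ⟨a₀, rfl⟩ := exists_lift_eq hα0 hx
  obtain ⟨a₁, rfl⟩ := exists_lift_eq hα0 hy
  obtain ⟨F, z, hF, hzF, hz, hzε⟩ := exists_truncation a₁ hε
  simp only [normV_lift hα0]
  obtain ⟨a, w, hc, e0, e1, hb⟩ := hM (max ‖a₀‖ ‖a₁‖) T (le_max_of_le_left (norm_nonneg _)) hT a₀ z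
    (le_max_left _ _) (hz.trans (le_max_right _ _)) F hF hzF
  refine ⟨fun t => lift _ (a t), w, hc.memLp, ⟨fun t _ => memV_lift hα0 _, fun t₀ ht₀ => ?_⟩,
    by simp only [e0], ?_, ?_, fun t ht => ?_, hc.solvesNS⟩
  · simp only [← map_sub, normV_lift hα0]
    exact tendsto_iff_norm_sub_tendsto_zero.1 (hc.continuousOn t₀ ht₀)
  · rw [← map_sub]
    exact memV_lift hα0 _
  · rw [← map_sub, normV_lift hα0, e1]
    exact hzε
  · rw [normV_lift hα0]
    exact hb t ht
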